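/- Let $m\ge 1$, let $M$ be a compact smooth ($C^\infty$) $m$-dimensional manifold with boundary, and let $F:M\to\mathbf{R}^n$ be a smooth (up to the boundary) immersion whose mean curvature vector vanishes identically, i.e. a compact immersed minimal submanifold of $\mathbf{R}^n$ (if $M$ is an embedded minimal submanifold of $\mathbf{R}^n$, $F$ is the inclusion). Let $|\partial M|=\int_{\mathbf{R}^n}\#\{x\in\partial M: F(x)=y\}\,d\mathcal{H}^{m-1}(y)$ be the $(m-1)$-dimensional measure of the boundary, counted with multiplicity, and let $\omega_m$ be the Lebesgue measure of the unit ball in $\mathbf{R}^m$. Distances are Euclidean distances in $\mathbf{R}^n$, with $\operatorname{dist}(p,\emptyset)=\infty$. (1) For every $p\in F(M)$, \[ m\,\omega_m\operatorname{dist}(p,F(\partial M))^{m-1}\le|\partial M| \] (where $t^0=1$ for every $t\in[0,\infty]$). (2) If $m\ge 2$ and $p\in F(M)$, then equality holds in (1) if and only if $M$ is a flat $m$-disk centered at $p$ with multiplicity $1$, i.e. if and only if $F$ is injective and $F(M)=\{y: y-p\in V,\ |y-p|\le r\}$ for some $m$-dimensional linear subspace $V\subset\mathbf{R}^n$ and some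 $r>0$. (3) If $m\ge 2$, $M$ is connected, and $\partial M=\Gamma_1\cup\Gamma_2$ with $\Gamma_1,\Gamma_2$ nonempty, closed and disjoint (not necessarily connected), then \[ \operatorname{dist}(F(\Gamma_1),F(\Gamma_2))\le 2\left(\frac{|\partial M|}{m\,\omega_m}\right)^{1/(m-1)}. \] -/

import Mathlib

open Set MeasureTheory
open scoped Manifold ContDiff ENNReal

noncomputable section

/-- The mean curvature vector at `u` of a parametrised `m`-dimensional surface
`f : ℝᵐ ⊇ s → ℝⁿ` : with `gᵢⱼ = ⟪∂ᵢf, ∂ⱼf⟫` the first fundamental form, it is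
`∑ᵢⱼ gⁱʲ (∂ᵢ∂ⱼ f)^⊥`, the trace of the second fundamental form, where `⊥` denotes the component
orthogonal to the tangent space, the span of the `∂ᵢf`. (The derivatives are taken within `s`, so
that boundary points of a half-space are allowed.) -/
def meanCurvatureOfParam {m n : ℕ} (f : EuclideanSpace ℝ (Fin m) → EuclideanSpace ℝ (Fin n))
    (s : Set (EuclideanSpace ℝ (Fin m))) (u : EuclideanSpace ℝ (Fin m)) :
    EuclideanSpace ℝ (Fin n) :=
  let e : Fin m → EuclideanSpace ℝ (Fin m) := fun i => EuclideanSpace.single i 1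
  let T : Submodule ℝ (EuclideanSpace ℝ (Fin n)) := (fderivWithin ℝ f s u).range
  let g : Matrix (Fin m) (Fin m) ℝ :=
    Matrix.of fun i j => inner ℝ (fderivWithin ℝ f s u (e i)) (fderivWithin ℝ f s u (e j))
  ∑ i, ∑ j, (g⁻¹ i j) •
    Tᗮ.starProjection (fderivWithin ℝ (fun y => fderivWithin ℝ f s y) s u (e i) (e j))

section Immersion

variable (m : ℕ) {n : ℕ} [NeZero m] {M : Type*} [TopologicalSpace M]
  [ChartedSpace (EuclideanHalfSpace m) M]

/-- The mean curvature vector at `x` of an immersion `F : M → ℝⁿ` of an `m`-manifold with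
boundary, computed in the preferred chart at `x` (it does not depend on the chart). -/
def meanCurvatureVector (F : M → EuclideanSpace ℝ (Fin n)) (x : M) :
    EuclideanSpace ℝ (Fin n) :=
  meanCurvatureOfParam (F ∘ (extChartAt (𝓡∂ m) x).symm) (range (𝓡∂ m)) (extChartAt (𝓡∂ m) x x)

/-- `F : M → ℝⁿ` is a smooth (up to the boundary) immersion whose mean curvature vanishes
everywhere. -/
structure IsMinimalImmersion (F : M → EuclideanSpace ℝ (Fin n)) : Prop where
  contMDiff : ContMDiff (𝓡∂ m) (𝓡 n) ∞ F
  injective_mfderiv : ∀ x : M, Function.Injective (mfderiv (𝓡∂ m) (𝓡 n) F x)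
  meanCurvature_eq_zero : ∀ x : M, meanCurvatureVector m F x = 0

/-- `|∂M|`: the `(m-1)`-dimensional Euclidean Hausdorff measure of the boundary of the immersed
surface `F : M → ℝⁿ`, counted with multiplicity, i.e. the integral over `y ∈ ℝⁿ` of the number of
boundary points of `M` that `F` maps to `y`. When `F` is injective on the boundary this is the
Hausdorff measure of `F(∂M)`. -/
def boundaryMeasure (F : M → EuclideanSpace ℝ (Fin n)) : ℝ≥0∞ :=
  ∫⁻ y, ((({x ∈ (𝓡∂ m).boundary M | F x = y}).encard : ℕ∞) : ℝ≥0∞) ∂(μHE[m - 1])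

end Immersion

/-- `ω_m`: the Lebesgue measure of the unit ball of `ℝᵐ`. -/
def unitBallVolume (m : ℕ) : ℝ≥0∞ :=
  volume (Metric.ball (0 : EuclideanSpace ℝ (Fin m)) 1)

/-- `D` is a flat `m`-disk in `ℝⁿ` centered at `p`. -/
def IsFlatDisk {n : ℕ} (m : ℕ) (p : EuclideanSpace ℝ (Fin n))
    (D : Set (EuclideanSpace ℝ (Fin n))) : Prop :=
  ∃ V : Submodule ℝ (EuclideanSpace ℝ (Fin n)), Module.finrank ℝ V = m ∧
    ∃ r : ℝ, 0 < r ∧ D = {y | y - p ∈ V ∧ dist y p ≤ r}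

end

/-! Write m = k + 1, let p = F(q) with q interior, and let x = y - p. On an m-plane through p the
field x / |x|^m has divergence zero away from p and a point mass m ω_m at p. Along a minimal
submanifold its divergence is m |x^⊥|² / |x|^(m+2) ≥ 0 away from p, where x^⊥ is the normal part of
x, and each interior preimage of p still carries the mass m ω_m. Minimality enters because the
normal part of a field contributes to the divergence only through the mean curvature. On the
boundary the field has length |x|^(-(m-1)) ≤ d^(-(m-1)), with d = dist(p, F(∂M)), so the divergence
theorem gives m ω_m ≤ |∂M| d^(-(m-1)), which is (1).

The singularity is smoothed: `regField` is x / (|x|² + ε²)^(m/2), its divergence along the surface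
is computed in `tangentialDiv_regField`, and `eventually_le_integral_massKernel` shows that the
smoothed mass near an interior preimage is asymptotically at least ω_m. The divergence theorem is
`integral_tangentialDiv_le`, and `mul_volume_ball_le` is the resulting density inequality.

If equality holds, nothing may be lost: x^⊥ = 0 everywhere, so the surface is conical
(`normalPart_eq_zero`); p has one preimage (`eq_of_apply_eq`); and F(∂M) lies on the sphere of
radius d (`norm_sub_eq_of_mem_boundary`). A cone that is smooth at its vertex lies in its tangent
plane there, which `sub_mem_range_of_cone` proves by a maximum principle. The map into that plane is
a local homeomorphism at interior points with a single sheet over the centre, so connectedness of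
the disk makes F a bijection onto the closed disk. Conversely, on a flat disk the field -(y - p)
gives the opposite inequality (`bdMeasure_le_of_disk`).

For (3), connectedness yields a point of M equally far from both boundary pieces; (1) bounds that
distance and the triangle inequality doubles it.

Measures on M count the points of the fibres of F against Hausdorff measure of the target, so |∂M|
is the total mass of a measure on M. The area formula `fiberMeasure_image` expresses these measures
in charts. -/

namespace MinimalImmersion
open Filter Module
open scoped Topology NNReal
set_option linter.unusedSectionVars false

/-! ### Metric comparison of an immersion with its derivative. -/

section AreaFormula

/-- The correspondence h v ↦ g v is well defined and a-Lipschitz on h(B). Stating this for two maps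
out of one set allows a map and its derivative to be compared in both directions. -/
theorem euclideanHausdorffMeasure_image_le_of_dist_le {X Y Z : Type*} [MetricSpace Y]
    [MeasurableSpace Y] [BorelSpace Y] [MetricSpace Z] [MeasurableSpace Z] [BorelSpace Z]
    {g : X → Y} {h : X → Z} {B : Set X} {a : ℝ≥0} (d : ℕ)
    (H : ∀ v ∈ B, ∀ w ∈ B, dist (g v) (g w) ≤ a * dist (h v) (h w)) :
    μHE[d] (g '' B) ≤ (a : ℝ≥0∞) ^ d * μHE[d] (h '' B) := by
  classical
  rcases B.eq_empty_or_nonempty with rfl | ⟨b, hb⟩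
  · simp
  let φ : Z → Y := fun z => if hz : z ∈ h '' B then g hz.choose else g b
  have hφ : ∀ v ∈ B, φ (h v) = g v := by
    intro v hv
    have hz : h v ∈ h '' B := ⟨v, hv, rfl⟩
    simp only [φ, dif_pos hz]
    have := H _ hz.choose_spec.1 v hv
    rw [hz.choose_spec.2, dist_self, mul_zero] at this
    exact dist_le_zero.1 this
  have hL : LipschitzOnWith a φ (h '' B) := by
    refine LipschitzOnWith.of_dist_le_mul ?_
    rintro _ ⟨v, hv, rfl⟩ _ ⟨w, hw, rfl⟩
    rw [hφ v hv, hφ w hw]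
    exact H v hv w hw
  have himg : g '' B = φ '' (h '' B) := by
    rw [image_image]
    exact image_congr fun v hv => (hφ v hv).symm
  rw [himg, Measure.euclideanHausdorffMeasure_def, Measure.euclideanHausdorffMeasure_def,
    Measure.smul_apply, Measure.smul_apply, mul_smul_comm]
  have := hL.hausdorffMeasure_image_le (d := d) (Nat.cast_nonneg d)
  rw [ENNReal.rpow_natCast] at this
  simp only [ENNReal.smul_def, smul_eq_mul]
  gcongr

variable {U V : Type*} [NormedAddCommGroup U] [InnerProductSpace ℝ U] [FiniteDimensional ℝ U]
  [NormedAddCommGroup V] [InnerProductSpace ℝ V] [FiniteDimensional ℝ V]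

theorem continuous_normDet : Continuous fun L : U →L[ℝ] V => (L : U →ₗ[ℝ] V).normDet := by
  have h : ∀ L : U →L[ℝ] V, (L : U →ₗ[ℝ] V).normDet
      = Real.sqrt (((ContinuousLinearMap.adjoint L) ∘L L).det) := by
    intro L
    rw [← L.normDet_sq]
    exact (Real.sqrt_sq (LinearMap.normDet_nonneg _)).symm
  simp_rw [h]
  refine Real.continuous_sqrt.comp (ContinuousLinearMap.continuous_det.comp ?_)
  exact (ContinuousLinearMap.adjoint.continuous).clm_comp continuous_id

theorem exists_pow_le_of_one_lt {c : ℝ} (hc : 1 < c) (d : ℕ) :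
    ∃ a : ℝ≥0, 1 < a ∧ (a : ℝ) ^ d ≤ c := by
  have h1 : Tendsto (fun a : ℝ≥0 => (a : ℝ) ^ d) (𝓝[>] 1) (𝓝 1) := by
    have : ContinuousAt (fun a : ℝ≥0 => (a : ℝ) ^ d) 1 := by fun_prop
    have h := this.tendsto
    simp only [NNReal.coe_one, one_pow] at h
    exact h.mono_left nhdsWithin_le_nhds
  obtain ⟨a, ha, ha'⟩ := ((h1.eventually (gt_mem_nhds hc)).and self_mem_nhdsWithin).exists
  exact ⟨a, ha', ha.le⟩

/-- Injectivity bounds ‖u‖ by K ‖L u‖, so an error small relative to ‖u‖ is small relative to ‖L u‖.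
The choice ε = (1 - 1/a) / K makes it at most (1 - 1/a) ‖L u‖; the upper bound then uses 2 - 1/a ≤
a. -/
theorem exists_approx_bounds (L : U →L[ℝ] V) (hL : Function.Injective L) {a : ℝ≥0} (ha : 1 < a) :
    ∃ ε : ℝ, 0 < ε ∧ ∀ v w : V, ∀ u : U, ‖v - w - L u‖ ≤ ε * ‖u‖ →
      ‖v - w‖ ≤ a * ‖L u‖ ∧ ‖L u‖ ≤ a * ‖v - w‖ := by
  obtain ⟨K, hK, hKL⟩ := L.exists_antilipschitzWith (LinearMap.ker_eq_bot.2 hL)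
  have ha' : (1 : ℝ) < a := by exact_mod_cast ha
  have hK' : (0 : ℝ) < K := by exact_mod_cast hK
  have ha0 : (0 : ℝ) < a := by linarith
  have hδ : (0 : ℝ) < 1 - (a : ℝ)⁻¹ := by
    have := inv_lt_one_of_one_lt₀ ha'
    linarith
  refine ⟨(1 - (a : ℝ)⁻¹) / K, by positivity, fun v w u h => ?_⟩
  have h1 : ‖u‖ ≤ K * ‖L u‖ := by
    simpa using hKL.le_mul_dist u 0
  have h2 : ‖v - w - L u‖ ≤ (1 - (a : ℝ)⁻¹) * ‖L u‖ := by
    refine h.trans ?_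
    calc (1 - (a : ℝ)⁻¹) / K * ‖u‖ ≤ (1 - (a : ℝ)⁻¹) / K * (K * ‖L u‖) := by gcongr
      _ = _ := by field_simp
  have h3 : ‖v - w‖ ≤ ‖v - w - L u‖ + ‖L u‖ := by
    simpa using norm_add_le (v - w - L u) (L u)
  have h4 : ‖L u‖ ≤ ‖v - w - L u‖ + ‖v - w‖ := by
    have := norm_sub_le (v - w) (v - w - L u)
    simp only [sub_sub_cancel] at this
    linarith
  have hinv : (a : ℝ) * (a : ℝ)⁻¹ = 1 := mul_inv_cancel₀ ha0.ne'
  have hn := norm_nonneg (L u)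
  refine ⟨?_, ?_⟩
  · have : 2 - (a : ℝ)⁻¹ ≤ a := by nlinarith [sq_nonneg ((a : ℝ) - 1)]
    nlinarith
  · have h5 : (a : ℝ)⁻¹ * ‖L u‖ ≤ ‖v - w‖ := by linarith
    calc ‖L u‖ = a * ((a : ℝ)⁻¹ * ‖L u‖) := by rw [← mul_assoc, hinv, one_mul]
      _ ≤ _ := by gcongr

variable [MeasurableSpace U] [BorelSpace U] [MeasurableSpace V] [BorelSpace V]

/-- A map which on `s` is uniformly approximated to first order near each point by an injective
derivative which varies continuously. -/
structure ImmersedOn (f : U → V) (f' : U → U →L[ℝ] V) (s : Set U) : Prop where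
  approx : ∀ u ∈ s, ∀ ε : ℝ, 0 < ε → ∃ N ∈ 𝓝[s] u, ∀ v ∈ N, ∀ w ∈ N,
    ‖f v - f w - f' u (v - w)‖ ≤ ε * ‖v - w‖
  continuousOn : ContinuousOn f' s
  injective : ∀ u ∈ s, Function.Injective (f' u)

/-- Near u the map f distorts distances of the linear map f' u by a factor close to 1, so the linear
area formula for f' u transfers to f. -/
theorem ImmersedOn.exists_nhds {f : U → V} {f' : U → U →L[ℝ] V} {s : Set U}
    (h : ImmersedOn f f' s) {u : U} (hu : u ∈ s) {c : ℝ} (hc : 1 < c) :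
    ∃ N ∈ 𝓝[s] u, InjOn f N ∧
      (∀ v ∈ N, ∀ w ∈ N, ‖f v - f w‖ ≤ c * ‖f' u (v - w)‖ ∧ ‖f' u (v - w)‖ ≤ c * ‖f v - f w‖) ∧
      ∀ B ⊆ N, μHE[finrank ℝ U] (f '' B) ≤
          ENNReal.ofReal (c * (f' u : U →ₗ[ℝ] V).normDet) * volume B ∧
        ENNReal.ofReal (f' u : U →ₗ[ℝ] V).normDet * volume B ≤
          ENNReal.ofReal c * μHE[finrank ℝ U] (f '' B) := by
  -- The extra 1 in the exponent secures a ≤ c as well as a ^ dim ≤ c, also in dimension 0.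
  obtain ⟨a, ha, hac⟩ := exists_pow_le_of_one_lt hc (finrank ℝ U + 1)
  have ha1 : (1 : ℝ) ≤ a := by exact_mod_cast ha.le
  have hac1 : (a : ℝ) ≤ c := (le_self_pow₀ ha1 (by simp)).trans hac
  have hac2 : (a : ℝ) ^ finrank ℝ U ≤ c :=
    (pow_le_pow_right₀ ha1 (Nat.le_succ _)).trans hac
  obtain ⟨ε, hε, H⟩ := exists_approx_bounds (f' u) (h.injective u hu) ha
  obtain ⟨N, hN, hNε⟩ := h.approx u hu ε hε
  have key : ∀ v ∈ N, ∀ w ∈ N, ‖f v - f w‖ ≤ a * ‖f' u (v - w)‖ ∧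
      ‖f' u (v - w)‖ ≤ a * ‖f v - f w‖ :=
    fun v hv w hw => H (f v) (f w) (v - w) (hNε v hv w hw)
  have hpow : (a : ℝ≥0∞) ^ finrank ℝ U ≤ ENNReal.ofReal c := by
    rw [← ENNReal.ofReal_coe_nnreal, ← ENNReal.ofReal_pow a.coe_nonneg]
    exact ENNReal.ofReal_le_ofReal hac2
  refine ⟨N, hN, ?_, ?_, fun B hB => ⟨?_, ?_⟩⟩
  · intro v hv w hw hvw
    have := (key v hv w hw).2
    rw [hvw, sub_self, norm_zero, mul_zero, norm_le_zero_iff] at this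
    exact sub_eq_zero.1 (h.injective u hu (this.trans (map_zero _).symm))
  · intro v hv w hw
    exact ⟨(key v hv w hw).1.trans (by gcongr), (key v hv w hw).2.trans (by gcongr)⟩
  · rw [ENNReal.ofReal_mul (by linarith), mul_assoc,
      ← LinearMap.euclideanHausdorffMeasure_image_eq_normDet_mul_volume]
    refine (euclideanHausdorffMeasure_image_le_of_dist_le (h := f' u) (a := a)
      (finrank ℝ U) fun v hv w hw => ?_).trans (mul_le_mul_left hpow _)
    rw [dist_eq_norm, dist_eq_norm, ← map_sub]
    exact (key v (hB hv) w (hB hw)).1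
  · rw [← LinearMap.euclideanHausdorffMeasure_image_eq_normDet_mul_volume]
    refine (euclideanHausdorffMeasure_image_le_of_dist_le (g := f' u) (h := f) (a := a)
      (finrank ℝ U) fun v hv w hw => ?_).trans (mul_le_mul_left hpow _)
    rw [dist_eq_norm, dist_eq_norm, ← map_sub]
    exact (key v (hB hv) w (hB hw)).2

end AreaFormula

/-! ### Measures that count the points of the fibres. -/

section FiberMeasure

/-- Second countability leaves countably many of the neighbourhoods, which are then made disjoint.
-/
theorem exists_measurable_partition {X : Type*} [TopologicalSpace X] [SecondCountableTopology X]
    [MeasurableSpace X] [OpensMeasurableSpace X] {s : Set X} (hs : MeasurableSet s)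
    {N : X → Set X} (hN : ∀ x ∈ s, N x ∈ 𝓝[s] x) :
    ∃ P : ℕ → Set X, (∀ j, MeasurableSet (P j)) ∧ Pairwise (Function.onFun Disjoint P) ∧
      ⋃ j, P j = s ∧ ∀ j, (P j).Nonempty → ∃ x ∈ s, P j ⊆ N x := by
  classical
  have h1 : ∀ x ∈ s, ∃ O, IsOpen O ∧ x ∈ O ∧ O ∩ s ⊆ N x := fun x hx =>
    mem_nhdsWithin.1 (hN x hx)
  choose! O hO hxO hON using h1
  obtain ⟨t, hts, htc, hcov⟩ := TopologicalSpace.countable_cover_nhdsWithin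
    (f := O) (s := s) fun x hx => mem_nhdsWithin_of_mem_nhds ((hO x hx).mem_nhds (hxO x hx))
  rcases s.eq_empty_or_nonempty with rfl | hne
  · exact ⟨fun _ => ∅, fun _ => MeasurableSet.empty, fun i j _ => by simp [Function.onFun],
      by simp, by simp⟩
  have htne : t.Nonempty := by
    by_contra h
    rw [not_nonempty_iff_eq_empty] at h
    subst h
    obtain ⟨x, hx⟩ := hne
    simpa using hcov hx
  obtain ⟨e, he⟩ := htc.exists_eq_range htne
  have hes : ∀ j, e j ∈ s := fun j => hts (he ▸ mem_range_self j)
  refine ⟨disjointed fun j => O (e j) ∩ s, fun j => ?_, disjoint_disjointed _, ?_, fun j _ => ?_⟩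
  · exact MeasurableSet.disjointed (fun i => (hO _ (hes i)).measurableSet.inter hs) j
  · rw [iUnion_disjointed]
    refine Subset.antisymm (iUnion_subset fun j => inter_subset_right) fun x hx => ?_
    obtain ⟨u, hu, hxu⟩ := mem_iUnion₂.1 (hcov hx)
    rw [he] at hu
    obtain ⟨j, rfl⟩ := hu
    exact mem_iUnion.2 ⟨j, hxu, hx⟩
  · exact ⟨e j, hes j, (disjointed_subset _ j).trans (hON _ (hes j))⟩

variable {M Y : Type*} [TopologicalSpace M] [PolishSpace M] [MeasurableSpace M] [BorelSpace M]
  [TopologicalSpace Y] [T2Space Y] [SecondCountableTopology Y] [MeasurableSpace Y] [BorelSpace Y]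

/-- The measure on the source of `F` which counts points of the fibres of `F` with respect to a
measure `κ` on the target. -/
noncomputable def fiberMeasure (F : M → Y) (κ : Measure Y) : Measure M :=
  κ.bind fun y => (Measure.count : Measure M).restrict (F ⁻¹' {y})

variable {F : M → Y}

/-- On a piece where F is injective the fibre count is the indicator of the image of the piece, and
that image is Borel because injective continuous images of Borel sets of a Polish space are Borel.
-/
theorem measurable_count_restrict_fiber (hF : Continuous F)
    (hinj : ∀ x, ∃ N ∈ 𝓝 x, InjOn F N) :
    Measurable fun y => (Measure.count : Measure M).restrict (F ⁻¹' {y}) := by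
  choose N hN hNi using hinj
  obtain ⟨P, hPm, hPd, hPu, hPN⟩ := exists_measurable_partition (s := (univ : Set M))
    MeasurableSet.univ (N := N) fun x _ => by simpa using hN x
  refine Measure.measurable_of_measurable_coe _ fun A hA => ?_
  have hfib : ∀ y, MeasurableSet (F ⁻¹' {y}) := fun y =>
    (isClosed_singleton.preimage hF).measurableSet
  have hinjP : ∀ j, InjOn F (A ∩ P j) := by
    intro j
    rcases (P j).eq_empty_or_nonempty with h | h
    · simp [h]
    · obtain ⟨x, -, hx⟩ := hPN j h
      exact (hNi x).mono (inter_subset_right.trans hx)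
  have heq : (fun y => (Measure.count : Measure M).restrict (F ⁻¹' {y}) A) =
      fun y => ∑' j, (F '' (A ∩ P j)).indicator (1 : Y → ℝ≥0∞) y := by
    funext y
    rw [Measure.restrict_apply hA]
    have : A ∩ F ⁻¹' {y} = ⋃ j, A ∩ P j ∩ F ⁻¹' {y} := by
      rw [← iUnion_inter, ← inter_iUnion, hPu, inter_univ]
    rw [this, measure_iUnion]
    · congr 1
      funext j
      by_cases hy : y ∈ F '' (A ∩ P j)
      · rw [indicator_of_mem hy]
        obtain ⟨x, hx, rfl⟩ := hy
        have : A ∩ P j ∩ F ⁻¹' {F x} = {x} := by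
          refine Subset.antisymm (fun z hz => ?_) ?_
          · exact hinjP j hz.1 hx hz.2
          · rintro _ rfl
            exact ⟨hx, rfl⟩
        rw [this]
        simp
      · rw [indicator_of_notMem hy]
        have : A ∩ P j ∩ F ⁻¹' {y} = ∅ := by
          ext z
          simp only [mem_inter_iff, mem_preimage, mem_singleton_iff, mem_empty_iff_false,
            iff_false, not_and]
          intro hz hzy
          exact hy ⟨z, hz, hzy⟩
        rw [this]
        simp
    · intro i j hij
      exact (hPd hij).mono (fun z hz => hz.1.2) fun z hz => hz.1.2
    · exact fun j => (hA.inter (hPm j)).inter (hfib y)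
  rw [heq]
  refine Measurable.tsum fun j => ?_
  exact (measurable_one.indicator
    ((hA.inter (hPm j)).image_of_continuousOn_injOn hF.continuousOn (hinjP j)))

theorem fiberMeasure_apply (hF : Continuous F) (hinj : ∀ x, ∃ N ∈ 𝓝 x, InjOn F N)
    (κ : Measure Y) {A : Set M} (hA : MeasurableSet A) :
    fiberMeasure F κ A = ∫⁻ y, (({x ∈ A | F x = y}.encard : ℕ∞) : ℝ≥0∞) ∂κ := by
  rw [fiberMeasure, Measure.bind_apply hA (measurable_count_restrict_fiber hF hinj).aemeasurable]
  refine lintegral_congr fun y => ?_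
  rw [Measure.restrict_apply hA, Measure.count_apply
    (hA.inter (isClosed_singleton.preimage hF).measurableSet)]
  rfl

theorem fiberMeasure_apply_of_injOn (hF : Continuous F) (hinj : ∀ x, ∃ N ∈ 𝓝 x, InjOn F N)
    (κ : Measure Y) {A : Set M} (hA : MeasurableSet A) (hAi : InjOn F A) :
    fiberMeasure F κ A = κ (F '' A) := by
  rw [fiberMeasure_apply hF hinj κ hA,
    ← lintegral_indicator_one (hA.image_of_continuousOn_injOn hF.continuousOn hAi)]
  refine lintegral_congr fun y => ?_
  by_cases hy : y ∈ F '' A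
  · rw [indicator_of_mem hy]
    obtain ⟨x, hx, rfl⟩ := hy
    have : {z ∈ A | F z = F x} = {x} := by
      refine Subset.antisymm (fun z hz => hAi hz.1 hx hz.2) ?_
      rintro _ rfl
      exact ⟨hx, rfl⟩
    rw [this]
    simp
  · rw [indicator_of_notMem hy]
    have : {z ∈ A | F z = y} = ∅ := by
      ext z
      simp only [mem_ofPred_eq, mem_empty_iff_false, iff_false, not_and]
      intro hz hzy
      exact hy ⟨z, hz, hzy⟩
    rw [this]
    simp

end FiberMeasure

/-! ### The area formula in a parametrisation. -/

section AreaFormula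

theorem ennreal_le_of_forall_one_lt {x y : ℝ≥0∞}
    (h : ∀ c : ℝ, 1 < c → x ≤ ENNReal.ofReal c * y) : x ≤ y := by
  have h1 : Tendsto (fun c : ℝ => ENNReal.ofReal c * y) (𝓝[>] 1) (𝓝 (ENNReal.ofReal 1 * y)) := by
    refine ENNReal.Tendsto.mul_const ?_ (Or.inl (by simp))
    exact (ENNReal.continuous_ofReal.tendsto 1).mono_left nhdsWithin_le_nhds
  rw [ENNReal.ofReal_one, one_mul] at h1
  refine ge_of_tendsto h1 ?_
  filter_upwards [self_mem_nhdsWithin] with c hc using h c hc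

variable {U V : Type*} [NormedAddCommGroup U] [InnerProductSpace ℝ U] [FiniteDimensional ℝ U]
  [NormedAddCommGroup V] [InnerProductSpace ℝ V] [FiniteDimensional ℝ V]
  [MeasurableSpace U] [BorelSpace U] [MeasurableSpace V] [BorelSpace V]
  {M : Type*} [TopologicalSpace M] [PolishSpace M] [MeasurableSpace M] [BorelSpace M]
  {F : M → V} {ψ : U → M} {f' : U → U →L[ℝ] V} {s : Set U}

theorem ImmersedOn.normDet_pos {f : U → V} (h : ImmersedOn f f' s) {u : U} (hu : u ∈ s) :
    0 < (f' u : U →ₗ[ℝ] V).normDet := by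
  refine lt_of_le_of_ne (LinearMap.normDet_nonneg _) (Ne.symm ?_)
  exact ((LinearMap.normDet_ne_zero_tfae _).out 0 4).2 (h.injective u hu)

theorem ImmersedOn.continuousOn_normDet {f : U → V} (h : ImmersedOn f f' s) :
    ContinuousOn (fun u => (f' u : U →ₗ[ℝ] V).normDet) s :=
  continuous_normDet.comp_continuousOn h.continuousOn

/-- Continuity of the Jacobian replaces its value at u by its integral at the cost of a second
factor a, whence the requirement a ^ 2 ≤ c. -/
theorem ImmersedOn.exists_nhds_bounds {f : U → V} (h : ImmersedOn f f' s) {u : U} (hu : u ∈ s)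
    {c : ℝ} (hc : 1 < c) :
    ∃ N ∈ 𝓝[s] u, InjOn f N ∧ ∀ B ⊆ N, MeasurableSet B →
      μHE[finrank ℝ U] (f '' B) ≤
          ENNReal.ofReal c * ∫⁻ v in B, ENNReal.ofReal (f' v : U →ₗ[ℝ] V).normDet ∧
        ∫⁻ v in B, ENNReal.ofReal (f' v : U →ₗ[ℝ] V).normDet ≤
          ENNReal.ofReal c * μHE[finrank ℝ U] (f '' B) := by
  obtain ⟨a, ha, hac⟩ := exists_pow_le_of_one_lt hc 2
  have ha1 : (1 : ℝ) < a := by exact_mod_cast ha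
  have ha0 : (0 : ℝ) < a := by linarith
  obtain ⟨N, hN, hi, -, hB⟩ := h.exists_nhds hu ha1
  set J := fun v => (f' v : U →ₗ[ℝ] V).normDet with hJ
  have hJu : 0 < J u := h.normDet_pos hu
  have hcont : Tendsto J (𝓝[s] u) (𝓝 (J u)) := h.continuousOn_normDet u hu
  have h1 : ∀ᶠ v in 𝓝[s] u, J v ≤ a * J u :=
    hcont.eventually (Iic_mem_nhds (by nlinarith))
  have h2 : ∀ᶠ v in 𝓝[s] u, (a : ℝ)⁻¹ * J u ≤ J v := by
    refine hcont.eventually (Ici_mem_nhds ?_)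
    have := inv_lt_one_of_one_lt₀ ha1
    nlinarith
  have hac' : ENNReal.ofReal ((a : ℝ) * a) ≤ ENNReal.ofReal c :=
    ENNReal.ofReal_le_ofReal (by rw [← sq]; exact hac)
  refine ⟨N ∩ {v | J v ≤ a * J u ∧ (a : ℝ)⁻¹ * J u ≤ J v}, inter_mem hN (h1.and h2),
    hi.mono inter_subset_left, fun B hBN hBm => ?_⟩
  obtain ⟨hB1, hB2⟩ := hB B (hBN.trans inter_subset_left)
  constructor
  · calc μHE[finrank ℝ U] (f '' B) ≤ ENNReal.ofReal (a * J u) * volume B := hB1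
      _ = ∫⁻ v in B, ENNReal.ofReal (a * J u) := by rw [setLIntegral_const]
      _ ≤ ∫⁻ v in B, ENNReal.ofReal ((a : ℝ) * a) * ENNReal.ofReal (J v) := by
          refine setLIntegral_mono' hBm fun v hv => ?_
          rw [← ENNReal.ofReal_mul (by positivity)]
          refine ENNReal.ofReal_le_ofReal ?_
          have := (hBN hv).2.2
          calc (a : ℝ) * J u = a * a * ((a : ℝ)⁻¹ * J u) := by field_simp
            _ ≤ a * a * J v := by gcongr
      _ = ENNReal.ofReal ((a : ℝ) * a) * ∫⁻ v in B, ENNReal.ofReal (J v) :=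
          lintegral_const_mul' _ _ ENNReal.ofReal_ne_top
      _ ≤ _ := by gcongr
  · calc ∫⁻ v in B, ENNReal.ofReal (J v) ≤ ∫⁻ v in B, ENNReal.ofReal (a * J u) := by
          refine setLIntegral_mono' hBm fun v hv => ?_
          exact ENNReal.ofReal_le_ofReal (hBN hv).2.1
      _ = ENNReal.ofReal a * (ENNReal.ofReal (J u) * volume B) := by
          rw [setLIntegral_const, ENNReal.ofReal_mul ha0.le, mul_assoc]
      _ ≤ ENNReal.ofReal a * (ENNReal.ofReal a * μHE[finrank ℝ U] (f '' B)) := by gcongr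
      _ = ENNReal.ofReal ((a : ℝ) * a) * μHE[finrank ℝ U] (f '' B) := by
          rw [ENNReal.ofReal_mul ha0.le, mul_assoc]
      _ ≤ _ := by gcongr

/-- On countably many small pieces F ∘ ψ is injective and both sides agree up to the factor c; sum
over the pieces and let c tend to 1. -/
theorem fiberMeasure_image (hF : Continuous F) (hinj : ∀ x, ∃ N ∈ 𝓝 x, InjOn F N)
    (hs : MeasurableSet s) (hψ : ContinuousOn ψ s) (hψi : InjOn ψ s)
    (h : ImmersedOn (F ∘ ψ) f' s) {B : Set U} (hB : MeasurableSet B) (hBs : B ⊆ s) :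
    fiberMeasure F μHE[finrank ℝ U] (ψ '' B) =
      ∫⁻ v in B, ENNReal.ofReal (f' v : U →ₗ[ℝ] V).normDet := by
  have key : ∀ c : ℝ, 1 < c → fiberMeasure F μHE[finrank ℝ U] (ψ '' B) ≤
        ENNReal.ofReal c * ∫⁻ v in B, ENNReal.ofReal (f' v : U →ₗ[ℝ] V).normDet ∧
      ∫⁻ v in B, ENNReal.ofReal (f' v : U →ₗ[ℝ] V).normDet ≤
        ENNReal.ofReal c * fiberMeasure F μHE[finrank ℝ U] (ψ '' B) := by
    intro c hc
    choose! N hN hNi hNb using fun u (hu : u ∈ s) => h.exists_nhds_bounds hu hc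
    obtain ⟨P, hPm, hPd, hPu, hPN⟩ := exists_measurable_partition hs hN
    have hBP : B = ⋃ j, B ∩ P j := by
      rw [← inter_iUnion, hPu, inter_eq_left.2 hBs]
    have hd : Pairwise (Function.onFun Disjoint fun j => B ∩ P j) := fun i j hij =>
      (hPd hij).mono inter_subset_right inter_subset_right
    have hm : ∀ j, MeasurableSet (B ∩ P j) := fun j => hB.inter (hPm j)
    have him : ∀ j, MeasurableSet (ψ '' (B ∩ P j)) := fun j =>
      (hm j).image_of_continuousOn_injOn (hψ.mono (inter_subset_left.trans hBs))
        (hψi.mono (inter_subset_left.trans hBs))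
    have e1 : fiberMeasure F μHE[finrank ℝ U] (ψ '' B) =
        ∑' j, μHE[finrank ℝ U] ((F ∘ ψ) '' (B ∩ P j)) := by
      conv_lhs => rw [hBP, image_iUnion]
      rw [measure_iUnion _ him]
      · congr 1
        funext j
        rw [fiberMeasure_apply_of_injOn hF hinj _ (him j), image_comp]
        rcases (P j).eq_empty_or_nonempty with hj | hj
        · simp [hj]
        · obtain ⟨u, hu, hPu⟩ := hPN j hj
          rintro _ ⟨v, hv, rfl⟩ _ ⟨w, hw, rfl⟩ hvw
          rw [hNi u hu (hPu hv.2) (hPu hw.2) hvw]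
      · intro i j hij
        rw [Function.onFun, disjoint_iff_inter_eq_empty, ← hψi.image_inter
          (inter_subset_left.trans hBs) (inter_subset_left.trans hBs),
          disjoint_iff_inter_eq_empty.1 (hd hij), image_empty]
    have e2 : ∫⁻ v in B, ENNReal.ofReal (f' v : U →ₗ[ℝ] V).normDet =
        ∑' j, ∫⁻ v in B ∩ P j, ENNReal.ofReal (f' v : U →ₗ[ℝ] V).normDet := by
      conv_lhs => rw [hBP]
      exact lintegral_iUnion hm hd _
    have hj : ∀ j, μHE[finrank ℝ U] ((F ∘ ψ) '' (B ∩ P j)) ≤ ENNReal.ofReal c *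
          ∫⁻ v in B ∩ P j, ENNReal.ofReal (f' v : U →ₗ[ℝ] V).normDet ∧
        ∫⁻ v in B ∩ P j, ENNReal.ofReal (f' v : U →ₗ[ℝ] V).normDet ≤
          ENNReal.ofReal c * μHE[finrank ℝ U] ((F ∘ ψ) '' (B ∩ P j)) := by
      intro j
      rcases (P j).eq_empty_or_nonempty with hj | hj
      · simp [hj]
      · obtain ⟨u, hu, hPu⟩ := hPN j hj
        exact hNb u hu _ (inter_subset_right.trans hPu) (hm j)
    rw [e1, e2, ← ENNReal.tsum_mul_left, ← ENNReal.tsum_mul_left]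
    exact ⟨ENNReal.tsum_le_tsum fun j => (hj j).1, ENNReal.tsum_le_tsum fun j => (hj j).2⟩
  exact le_antisymm (ennreal_le_of_forall_one_lt fun c hc => (key c hc).1)
    (ennreal_le_of_forall_one_lt fun c hc => (key c hc).2)

theorem fiberMeasure_restrict_image (hF : Continuous F) (hinj : ∀ x, ∃ N ∈ 𝓝 x, InjOn F N)
    (hs : MeasurableSet s) (hψ : ContinuousOn ψ s) (hψi : InjOn ψ s)
    (h : ImmersedOn (F ∘ ψ) f' s) :
    (fiberMeasure F μHE[finrank ℝ U]).restrict (ψ '' s) =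
      ((volume.restrict s).withDensity fun v =>
        ENNReal.ofReal (f' v : U →ₗ[ℝ] V).normDet).map ψ := by
  have hψm : AEMeasurable ψ (volume.restrict s) := hψ.aemeasurable hs
  refine Measure.ext fun A hA => ?_
  have hsA : MeasurableSet (s ∩ ψ ⁻¹' A) := by
    have := hs.subtype_image ((continuousOn_iff_continuous_domRestrict.1 hψ).measurable hA)
    rwa [domRestrict_eq, preimage_comp, Subtype.image_preimage_coe] at this
  rw [Measure.restrict_apply hA,
    Measure.map_apply_of_aemeasurable (hψm.mono_ac (withDensity_absolutelyContinuous _ _)) hA]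
  have h1 : A ∩ ψ '' s = ψ '' (s ∩ ψ ⁻¹' A) := by
    rw [image_inter_preimage, inter_comm]
  rw [h1, fiberMeasure_image hF hinj hs hψ hψi h hsA inter_subset_left,
    withDensity_apply', Measure.restrict_restrict' hs, inter_comm]

end AreaFormula

/-! ### Jacobi's formula for the derivative of the determinant. -/

section Det

variable {U : Type*} [NormedAddCommGroup U] [InnerProductSpace ℝ U] [FiniteDimensional ℝ U]

theorem differentiable_det : Differentiable ℝ fun T : U →L[ℝ] U => T.det := by
  have h : ∀ T : U →L[ℝ] U, T.det = ∑ σ : Equiv.Perm (Fin (finrank ℝ U)),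
      (Equiv.Perm.sign σ : ℤ) • ∏ i, inner ℝ (stdOrthonormalBasis ℝ U (σ i))
        (T (stdOrthonormalBasis ℝ U i)) := by
    intro T
    rw [ContinuousLinearMap.det, ← LinearMap.det_toMatrix (stdOrthonormalBasis ℝ U).toBasis,
      Matrix.det_apply]
    refine Finset.sum_congr rfl fun σ _ => ?_
    congr 1
    refine Finset.prod_congr rfl fun i _ => ?_
    rw [LinearMap.toMatrix_apply]
    simp [OrthonormalBasis.repr_apply_apply]
  simp_rw [h]
  refine Differentiable.fun_sum fun σ _ => ?_
  simp only [zsmul_eq_mul]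
  suffices h : Differentiable ℝ fun T : U →L[ℝ] U => ∏ i, inner ℝ (stdOrthonormalBasis ℝ U (σ i))
      (T (stdOrthonormalBasis ℝ U i)) from h.const_mul _
  have hi : ∀ i, Differentiable ℝ fun T : U →L[ℝ] U =>
      inner ℝ (stdOrthonormalBasis ℝ U (σ i)) (T (stdOrthonormalBasis ℝ U i)) := fun i =>
    ((innerSL ℝ (stdOrthonormalBasis ℝ U (σ i))) ∘L
      ContinuousLinearMap.apply ℝ U (stdOrthonormalBasis ℝ U i)).differentiable
  exact fun T => (HasFDerivAt.finsetProd fun i _ =>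
    (hi i T).hasFDerivAt).differentiableAt

theorem fderiv_det_one (T : U →L[ℝ] U) :
    fderiv ℝ (fun T : U →L[ℝ] U => T.det) 1 T = LinearMap.trace ℝ U T := by
  have h1 : HasDerivAt (fun r : ℝ => (1 : U →L[ℝ] U) + r • T) T 0 := by
    simpa using ((hasDerivAt_id (0 : ℝ)).smul_const T).const_add (1 : U →L[ℝ] U)
  have h2 := (differentiable_det (U := U) ((1 : U →L[ℝ] U) + (0 : ℝ) • T)).hasFDerivAt.comp_hasDerivAt
    (0 : ℝ) h1
  simp only [zero_smul, add_zero] at h2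
  refine h2.unique ?_
  let b := (stdOrthonormalBasis ℝ U).toBasis
  -- The part of the polynomial det (1 + r T) beyond first order in r, divided by r ^ 2.
  let P := (Matrix.det (1 + (Polynomial.X : Polynomial ℝ) •
    (LinearMap.toMatrix b b (T : U →ₗ[ℝ] U)).map Polynomial.C)).divX.divX
  have h3 : ∀ r : ℝ, ((1 : U →L[ℝ] U) + r • T).det
      = 1 + LinearMap.trace ℝ U T * r + P.eval r * r ^ 2 := by
    intro r
    have := Matrix.det_one_add_smul r (LinearMap.toMatrix b b (T : U →ₗ[ℝ] U))
    rw [LinearMap.trace_eq_matrix_trace ℝ b, ← this, ContinuousLinearMap.det,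
      ← LinearMap.det_toMatrix b]
    congr 1
    simp [LinearMap.toMatrix_one]
  have h4 : HasDerivAt (fun r : ℝ => 1 + LinearMap.trace ℝ U T * r + P.eval r * r ^ 2)
      (LinearMap.trace ℝ U T) 0 := by
    have := (((hasDerivAt_id (0 : ℝ)).const_mul (LinearMap.trace ℝ U T)).const_add 1).add
      ((P.hasDerivAt 0).mul ((hasDerivAt_id (0 : ℝ)).pow 2))
    refine (this.congr_deriv (by simp)).congr_of_eventuallyEq (Eventually.of_forall fun r => ?_)
    simp
  exact h4.congr_of_eventuallyEq (Eventually.of_forall h3)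

/-- The factorisation det T = det G · det (G⁻¹ T) reduces the claim to the derivative at the
identity. -/
theorem hasFDerivAt_det {G : U →L[ℝ] U} (hG : IsUnit G) :
    ∃ D : (U →L[ℝ] U) →L[ℝ] ℝ, HasFDerivAt (fun T : U →L[ℝ] U => T.det) D G ∧
      ∀ T, D T = G.det * LinearMap.trace ℝ U (Ring.inverse G ∘L T : U →L[ℝ] U) := by
  have h : (fun T : U →L[ℝ] U => T.det) = fun T => G.det * (Ring.inverse G ∘L T).det := by
    funext T
    have : T = G ∘L (Ring.inverse G ∘L T) := by
      have h0 : G * (Ring.inverse G * T) = T := by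
        rw [← mul_assoc, Ring.mul_inverse_cancel _ hG, one_mul]
      exact h0.symm
    conv_lhs => rw [this]
    simp only [ContinuousLinearMap.det, ContinuousLinearMap.toLinearMap_comp, LinearMap.det_comp]
  let c : (U →L[ℝ] U) →L[ℝ] (U →L[ℝ] U) := ContinuousLinearMap.compL ℝ U U U (Ring.inverse G)
  have hc : c G = 1 := Ring.inverse_mul_cancel _ hG
  have h1 : HasFDerivAt (fun T : U →L[ℝ] U => G.det * (c T).det)
      (G.det • (fderiv ℝ (fun T : U →L[ℝ] U => T.det) 1 ∘L c)) G := by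
    refine HasFDerivAt.const_mul ?_ _
    refine HasFDerivAt.comp G (g := fun T : U →L[ℝ] U => T.det) ?_ c.hasFDerivAt
    rw [hc]
    exact (differentiable_det 1).hasFDerivAt
  refine ⟨_, h1.congr_of_eventuallyEq (Eventually.of_forall (congrFun h)), fun T => ?_⟩
  simp only [smul_apply, ContinuousLinearMap.comp_apply, smul_eq_mul,
    fderiv_det_one]
  rfl

end Det

/-! ### The pseudo-inverse and the volume density as functions of the derivative. -/

section PseudoInverse

open ContinuousLinearMap (adjoint)

variable {U V : Type*} [NormedAddCommGroup U] [InnerProductSpace ℝ U] [FiniteDimensional ℝ U]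
  [NormedAddCommGroup V] [InnerProductSpace ℝ V] [FiniteDimensional ℝ V]

/-- The adjoint as a continuous linear map between spaces of real operators. -/
noncomputable def adjointL : (U →L[ℝ] V) →L[ℝ] (V →L[ℝ] U) :=
  LinearMap.toContinuousLinearMap
    { toFun := fun T => adjoint T
      map_add' := fun S T => map_add _ S T
      map_smul' := fun c T => by simp }

@[simp] theorem adjointL_apply (T : U →L[ℝ] V) : adjointL T = adjoint T := rfl

/-- The first fundamental form of `L`, as an operator. -/
noncomputable def gram (L : U →L[ℝ] V) : U →L[ℝ] U := adjoint L ∘L L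

/-- The inverse of the first fundamental form. -/
noncomputable def gramInv (L : U →L[ℝ] V) : U →L[ℝ] U := Ring.inverse (gram L)

/-- The Moore-Penrose inverse of an injective operator. -/
noncomputable def pinv (L : U →L[ℝ] V) : V →L[ℝ] U := gramInv L ∘L adjoint L

theorem inner_gram (L : U →L[ℝ] V) (v w : U) : inner ℝ v (gram L w) = inner ℝ (L v) (L w) := by
  simp [gram, ContinuousLinearMap.adjoint_inner_right]

theorem inner_gram_left (L : U →L[ℝ] V) (v w : U) :
    inner ℝ (gram L v) w = inner ℝ (L v) (L w) := by
  simp [gram, ContinuousLinearMap.adjoint_inner_left]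

variable {L : U →L[ℝ] V}

theorem isUnit_gram (hL : Function.Injective L) : IsUnit (gram L) := by
  have hinj : Function.Injective (gram L) := by
    refine (injective_iff_map_eq_zero _).2 fun v hv => ?_
    have := inner_gram L v v
    rw [hv, inner_zero_right, eq_comm, inner_self_eq_zero] at this
    exact hL (this.trans (map_zero L).symm)
  let e : U ≃L[ℝ] U :=
    (LinearEquiv.ofInjectiveEndo (gram L : U →ₗ[ℝ] U) hinj).toContinuousLinearEquiv
  have : gram L = (ContinuousLinearEquiv.toUnit e : (U →L[ℝ] U)ˣ) := by
    ext v
    rfl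
  rw [this]
  exact Units.isUnit _

theorem gram_gramInv (hL : Function.Injective L) (v : U) : gram L (gramInv L v) = v :=
  DFunLike.congr_fun (Ring.mul_inverse_cancel _ (isUnit_gram hL)) v

theorem gramInv_gram (hL : Function.Injective L) (v : U) : gramInv L (gram L v) = v :=
  DFunLike.congr_fun (Ring.inverse_mul_cancel _ (isUnit_gram hL)) v

theorem inner_gramInv (hL : Function.Injective L) (v w : U) :
    inner ℝ v (gramInv L w) = inner ℝ (gramInv L v) w := by
  conv_lhs => rw [← gram_gramInv hL v, inner_gram_left, ← inner_gram, gram_gramInv hL]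

theorem pinv_apply_self (hL : Function.Injective L) (v : U) : pinv L (L v) = v :=
  gramInv_gram hL v

theorem inner_map_pinv (hL : Function.Injective L) (v : U) (x : V) :
    inner ℝ (L v) (L (pinv L x)) = inner ℝ (L v) x := by
  rw [← inner_gram, pinv, ContinuousLinearMap.comp_apply, gram_gramInv hL,
    ContinuousLinearMap.adjoint_inner_right]

theorem sub_map_pinv_mem_orthogonal (hL : Function.Injective L) (x : V) :
    x - L (pinv L x) ∈ (L : U →ₗ[ℝ] V).rangeᗮ := by
  rw [Submodule.mem_orthogonal]
  rintro _ ⟨v, rfl⟩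
  rw [ContinuousLinearMap.coe_coe, inner_sub_right, inner_map_pinv hL, sub_self]

theorem map_pinv_eq_starProjection (hL : Function.Injective L) (x : V) :
    L (pinv L x) = (L : U →ₗ[ℝ] V).range.starProjection x := by
  symm
  refine Submodule.eq_starProjection_of_mem_orthogonal ⟨_, rfl⟩ (sub_map_pinv_mem_orthogonal hL x)

theorem trace_adjoint (T : U →L[ℝ] U) :
    LinearMap.trace ℝ U (adjoint T : U →L[ℝ] U) = LinearMap.trace ℝ U T := by
  rw [LinearMap.trace_eq_sum_inner _ (stdOrthonormalBasis ℝ U),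
    LinearMap.trace_eq_sum_inner _ (stdOrthonormalBasis ℝ U)]
  refine Finset.sum_congr rfl fun i _ => ?_
  rw [ContinuousLinearMap.coe_coe, ContinuousLinearMap.adjoint_inner_right,
    ContinuousLinearMap.coe_coe, real_inner_comm]

theorem adjoint_gramInv (hL : Function.Injective L) : adjoint (gramInv L) = gramInv L := by
  ext1 v
  refine ext_inner_left ℝ fun w => ?_
  rw [ContinuousLinearMap.adjoint_inner_right, inner_gramInv hL]

/-- The trace, with respect to the first fundamental form of `L`, of the component along `n`
of the bilinear form `β`. -/
noncomputable def hessTrace (L : U →L[ℝ] V) (β : U →L[ℝ] U →L[ℝ] V) (n : V) : ℝ :=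
  LinearMap.trace ℝ U
    (gramInv L ∘L ((ContinuousLinearMap.apply ℝ U n) ∘L adjointL ∘L β) : U →L[ℝ] U)

theorem hasFDerivAt_gram (L : U →L[ℝ] V) :
    ∃ D : (U →L[ℝ] V) →L[ℝ] (U →L[ℝ] U), HasFDerivAt gram D L ∧
      ∀ T, D T = adjoint T ∘L L + adjoint L ∘L T := by
  have := (adjointL (U := U) (V := V)).hasFDerivAt (x := L) |>.clm_comp (hasFDerivAt_id L)
  refine ⟨_, this, fun T => ?_⟩
  simp [add_comm]

theorem hasFDerivAt_gramInv (hL : Function.Injective L) :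
    ∃ D : (U →L[ℝ] V) →L[ℝ] (U →L[ℝ] U), HasFDerivAt gramInv D L ∧
      ∀ T, D T = -(gramInv L ∘L (adjoint T ∘L L + adjoint L ∘L T) ∘L gramInv L) := by
  obtain ⟨D, hD, hDT⟩ := hasFDerivAt_gram L
  obtain ⟨g, hg⟩ := isUnit_gram hL
  have h1 := hasFDerivAt_ringInverse (𝕜 := ℝ) g
  rw [hg] at h1
  refine ⟨_, h1.comp L hD, fun T => ?_⟩
  have h2 : ((g⁻¹ : (U →L[ℝ] U)ˣ) : U →L[ℝ] U) = gramInv L := by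
    rw [gramInv, ← hg, Ring.inverse_unit]
  rw [ContinuousLinearMap.comp_apply, hDT, h2]
  rfl

/-- Product rule for (L*L)⁻¹ L*: the variation of L* acts only on the normal part of x, and the
other term is the usual derivative of an inverse. -/
theorem hasFDerivAt_pinv (hL : Function.Injective L) :
    ∃ D : (U →L[ℝ] V) →L[ℝ] (V →L[ℝ] U), HasFDerivAt pinv D L ∧
      ∀ T x, D T x = gramInv L (adjoint T (x - L (pinv L x))) - pinv L (T (pinv L x)) := by
  obtain ⟨D, hD, hDT⟩ := hasFDerivAt_gramInv hL
  have h := hD.clm_comp ((adjointL (U := U) (V := V)).hasFDerivAt (x := L))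
  refine ⟨_, h, fun T x => ?_⟩
  simp [hDT, pinv]
  abel

/-- The density is the square root of det (L*L). The two terms in the derivative of L*L contribute
equal traces, and this 2 cancels the 1/2 of the square root. -/
theorem hasFDerivAt_normDet (hL : Function.Injective L) :
    ∃ D : (U →L[ℝ] V) →L[ℝ] ℝ, HasFDerivAt (fun L : U →L[ℝ] V => (L : U →ₗ[ℝ] V).normDet) D L ∧
      ∀ T, D T = (L : U →ₗ[ℝ] V).normDet * LinearMap.trace ℝ U (pinv L ∘L T : U →L[ℝ] U) := by
  have h0 : ∀ L : U →L[ℝ] V, (gram L).det = (L : U →ₗ[ℝ] V).normDet ^ 2 := fun L =>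
    L.normDet_sq.symm
  have h : (fun L : U →L[ℝ] V => (L : U →ₗ[ℝ] V).normDet) = fun L => Real.sqrt ((gram L).det) := by
    funext L
    rw [h0]
    exact (Real.sqrt_sq (LinearMap.normDet_nonneg _)).symm
  have hne : (L : U →ₗ[ℝ] V).normDet ≠ 0 := ((LinearMap.normDet_ne_zero_tfae _).out 0 4).2 hL
  obtain ⟨D, hD, hDT⟩ := hasFDerivAt_gram L
  obtain ⟨D', hD', hDT'⟩ := hasFDerivAt_det (isUnit_gram hL)
  have h1 := (hD'.comp L hD).sqrt (by rw [Function.comp_apply, h0]; positivity)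
  refine ⟨_, h1.congr_of_eventuallyEq (Eventually.of_forall (congrFun h)), fun T => ?_⟩
  have h2 : LinearMap.trace ℝ U (Ring.inverse (gram L) ∘L (adjoint T ∘L L + adjoint L ∘L T)
      : U →L[ℝ] U) = 2 * LinearMap.trace ℝ U (pinv L ∘L T : U →L[ℝ] U) := by
    have h3 : LinearMap.trace ℝ U (gramInv L ∘L adjoint T ∘L L : U →L[ℝ] U) =
        LinearMap.trace ℝ U (pinv L ∘L T : U →L[ℝ] U) := by
      rw [← trace_adjoint, ContinuousLinearMap.adjoint_comp, adjoint_gramInv hL,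
        ContinuousLinearMap.adjoint_comp, ContinuousLinearMap.adjoint_adjoint,
        ContinuousLinearMap.toLinearMap_comp, LinearMap.trace_comp_comm',
        ← ContinuousLinearMap.toLinearMap_comp]
      rfl
    rw [ContinuousLinearMap.comp_add, ContinuousLinearMap.toLinearMap_add, map_add, two_mul]
    exact congrArg₂ _ h3 rfl
  simp only [smul_apply, ContinuousLinearMap.comp_apply, Function.comp_apply,
    hDT, hDT', h2, h0, Real.sqrt_sq (LinearMap.normDet_nonneg _), smul_eq_mul]
  field_simp

end PseudoInverse

/-! ### The divergence of the tangential part of an ambient field. -/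

section Divergence

open ContinuousLinearMap (adjoint)

variable {U V : Type*} [NormedAddCommGroup U] [InnerProductSpace ℝ U] [FiniteDimensional ℝ U]
  [NormedAddCommGroup V] [InnerProductSpace ℝ V] [FiniteDimensional ℝ V]

theorem trace_smulRight (c : U →L[ℝ] ℝ) (w : U) :
    LinearMap.trace ℝ U (c.smulRight w : U →L[ℝ] U) = c w := by
  rw [LinearMap.trace_eq_sum_inner _ (stdOrthonormalBasis ℝ U)]
  conv_rhs => rw [← (stdOrthonormalBasis ℝ U).sum_repr' w, map_sum]
  refine Finset.sum_congr rfl fun i _ => ?_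
  simp [inner_smul_right, mul_comm]

/-- The coordinate expression of the tangential part of the field `η X` along `f`, times the volume
density. -/
noncomputable def flux (f : U → V) (A : U → U →L[ℝ] V) (η : U → ℝ) (X : V → V) (u : U) : U :=
  (η u * (A u : U →ₗ[ℝ] V).normDet) • pinv (A u) (X (f u))

/-- Write B for the pseudo-inverse and x for the field. The derivative of the density yields the
trace of B ∘ β (B x), and the derivative of B yields its negative once β is symmetric. There remain
the derivative of the cutoff, the divergence of X along the surface, and the pairing of the mean
curvature with the normal part of x. -/
theorem exists_hasFDerivAt_flux {f : U → V} {A : U → U →L[ℝ] V} {η : U → ℝ} {X : V → V} {u : U}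
    {β : U →L[ℝ] U →L[ℝ] V} {η' : U →L[ℝ] ℝ} {X' : V →L[ℝ] V}
    (hf : HasFDerivAt f (A u) u) (hA : HasFDerivAt A β u) (hβ : ∀ v w, β v w = β w v)
    (hinj : Function.Injective (A u)) (hη : HasFDerivAt η η' u) (hX : HasFDerivAt X X' (f u)) :
    ∃ Y' : U →L[ℝ] U, HasFDerivAt (flux f A η X) Y' u ∧
      LinearMap.trace ℝ U Y' = (A u : U →ₗ[ℝ] V).normDet * (η' (pinv (A u) (X (f u))) +
        η u * LinearMap.trace ℝ U (pinv (A u) ∘L X' ∘L A u : U →L[ℝ] U) +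
        η u * hessTrace (A u) β (X (f u) - A u (pinv (A u) (X (f u))))) := by
  obtain ⟨D, hD, hDT⟩ := hasFDerivAt_normDet hinj
  obtain ⟨P, hP, hPT⟩ := hasFDerivAt_pinv hinj
  have h1 : HasFDerivAt (fun u => η u * (A u : U →ₗ[ℝ] V).normDet) _ u := hη.mul (hD.comp u hA)
  have h2 : HasFDerivAt (fun u => pinv (A u) (X (f u))) _ u :=
    (hP.comp u hA).clm_apply (hX.comp u hf)
  refine ⟨_, h1.smul h2, ?_⟩
  set B := pinv (A u) with hB
  set x := X (f u) with hx
  set J := (A u : U →ₗ[ℝ] V).normDet with hJ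
  have e : ((η u * J) • ((P ∘L β).flip x + B ∘L X' ∘L A u) +
      (η u • (D ∘L β) + J • η').smulRight (B x) : U →L[ℝ] U) =
      (η u * J) • (gramInv (A u) ∘L ((ContinuousLinearMap.apply ℝ U (x - A u (B x))) ∘L
        adjointL ∘L β)) - (η u * J) • (B ∘L β (B x)) + (η u * J) • (B ∘L X' ∘L A u) +
      (η u • (D ∘L β) + J • η').smulRight (B x) := by
    ext1 v
    simp [hPT, hβ v (B x)]
    module
  have e2 : LinearMap.trace ℝ U ((η u * J) • ((P ∘L β).flip x + B ∘L X' ∘L A u) +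
      (η u • (D ∘L β) + J • η').smulRight (B x) : U →L[ℝ] U) =
      J * (η' (B x) + η u * LinearMap.trace ℝ U (B ∘L X' ∘L A u : U →L[ℝ] U) +
        η u * hessTrace (A u) β (x - A u (B x))) := by
    rw [e]
    generalize x - A u (B x) = n
    simp only [ContinuousLinearMap.toLinearMap_add, ContinuousLinearMap.toLinearMap_sub,
      ContinuousLinearMap.toLinearMap_smul, map_add, map_sub, map_smul, trace_smulRight]
    simp only [add_apply, smul_apply, ContinuousLinearMap.comp_apply, hDT,
      smul_eq_mul, hessTrace]
    ring
  rw [← e2]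
  congr 2
  ext1 v
  simp only [add_apply, smul_apply, smul_add]
  exact congrArg₂ _ (add_comm _ _) rfl

/-- The two operators under the trace are conjugate by Φ. Only the components along n are compared
because second derivatives in different charts agree up to tangential terms. -/
theorem hessTrace_comp {U' : Type*} [NormedAddCommGroup U'] [InnerProductSpace ℝ U']
    [FiniteDimensional ℝ U'] {L : U →L[ℝ] V} (hL : Function.Injective L) (Φ : U' ≃L[ℝ] U)
    {β : U →L[ℝ] U →L[ℝ] V} {β' : U' →L[ℝ] U' →L[ℝ] V} {n : V}
    (h : ∀ v w, inner ℝ n (β' v w) = inner ℝ n (β (Φ v) (Φ w))) :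
    hessTrace (L ∘L (Φ : U' →L[ℝ] U)) β' n = hessTrace L β n := by
  have hL' : Function.Injective (L ∘L (Φ : U' →L[ℝ] U)) := hL.comp Φ.injective
  have key : ∀ v, gramInv (L ∘L (Φ : U' →L[ℝ] U)) (adjoint (β' v) n) =
      Φ.symm (gramInv L (adjoint (β (Φ v)) n)) := by
    intro v
    have hinj : Function.Injective (gram (L ∘L (Φ : U' →L[ℝ] U))) := fun a b hab => by
      rw [← gramInv_gram hL' a, hab, gramInv_gram hL' b]
    apply hinj
    rw [gram_gramInv hL']
    refine ext_inner_left ℝ fun w => ?_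
    rw [ContinuousLinearMap.adjoint_inner_right, inner_gram, ContinuousLinearMap.comp_apply,
      ContinuousLinearMap.comp_apply, ContinuousLinearEquiv.coe_coe,
      ContinuousLinearEquiv.apply_symm_apply, ← inner_gram, gram_gramInv hL,
      ContinuousLinearMap.adjoint_inner_right, real_inner_comm, h, real_inner_comm]
  rw [hessTrace, hessTrace, ← LinearMap.trace_conj' _ (Φ.symm : U ≃ₗ[ℝ] U')]
  congr 1
  ext v
  simp [key, LinearEquiv.conj_apply]

theorem inv_gram_matrix {m : ℕ} {L : EuclideanSpace ℝ (Fin m) →L[ℝ] V}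
    (hL : Function.Injective L) :
    (Matrix.of fun i j : Fin m =>
      inner ℝ (L (EuclideanSpace.single i 1)) (L (EuclideanSpace.single j 1)))⁻¹ =
    Matrix.of fun i j => inner ℝ (EuclideanSpace.single i 1)
      (gramInv L (EuclideanSpace.single j 1)) := by
  set e : Fin m → EuclideanSpace ℝ (Fin m) := fun i => EuclideanSpace.single i 1
  let b := EuclideanSpace.basisFun (Fin m) ℝ
  have hb : ∀ i, b i = e i := fun i => by simp [b, e]
  refine Matrix.inv_eq_right_inv ?_
  ext i j
  rw [Matrix.mul_apply]
  have h1 : ∀ k, Matrix.of (fun i j : Fin m => inner ℝ (L (e i)) (L (e j))) i k *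
      Matrix.of (fun i j => inner ℝ (e i) (gramInv L (e j))) k j =
      inner ℝ (gram L (e i)) (b k) * inner ℝ (b k) (gramInv L (e j)) := by
    intro k
    rw [Matrix.of_apply, Matrix.of_apply, hb, inner_gram_left]
  rw [Finset.sum_congr rfl fun k _ => h1 k]
  rw [b.sum_inner_mul_inner, inner_gram_left, ← inner_gram, gram_gramInv hL, ← hb, ← hb,
    b.inner_eq_ite, Matrix.one_apply]

/-- Links the coordinate sum in `meanCurvatureOfParam` to `hessTrace`. Against a normal vector the
self-adjoint projection can be dropped, and the double sum collapses by Parseval's identity. -/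
theorem inner_sum_gram_inv {m : ℕ} {L : EuclideanSpace ℝ (Fin m) →L[ℝ] V}
    (hL : Function.Injective L)
    (β : EuclideanSpace ℝ (Fin m) →L[ℝ] EuclideanSpace ℝ (Fin m) →L[ℝ] V) {n : V}
    (hn : n ∈ (L : EuclideanSpace ℝ (Fin m) →ₗ[ℝ] V).rangeᗮ) :
    inner ℝ n (∑ i, ∑ j, ((Matrix.of fun i j : Fin m =>
        inner ℝ (L (EuclideanSpace.single i 1)) (L (EuclideanSpace.single j 1)))⁻¹ i j) •
      (L : EuclideanSpace ℝ (Fin m) →ₗ[ℝ] V).rangeᗮ.starProjection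
        (β (EuclideanSpace.single i 1) (EuclideanSpace.single j 1))) = hessTrace L β n := by
  set e : Fin m → EuclideanSpace ℝ (Fin m) := fun i => EuclideanSpace.single i 1
  let b := EuclideanSpace.basisFun (Fin m) ℝ
  have hb : ∀ i, b i = e i := fun i => by simp [b, e]
  have hproj : ∀ y, inner ℝ n ((L : EuclideanSpace ℝ (Fin m) →ₗ[ℝ] V).rangeᗮ.starProjection y) =
      inner ℝ n y := by
    intro y
    rw [← Submodule.inner_starProjection_left_eq_right, Submodule.starProjection_eq_self_iff.2 hn]
  rw [hessTrace, LinearMap.trace_eq_sum_inner _ b, inner_sum]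
  refine Finset.sum_congr rfl fun i _ => ?_
  rw [inner_sum]
  simp_rw [inner_smul_right, hproj]
  change ∑ j, (Matrix.of fun i j : Fin m => inner ℝ (L (e i)) (L (e j)))⁻¹ i j *
    inner ℝ n (β (e i) (e j)) = _
  rw [inv_gram_matrix hL]
  have h2 : ∀ j, Matrix.of (fun i j => inner ℝ (e i) (gramInv L (e j))) i j *
      inner ℝ n (β (e i) (e j)) =
      inner ℝ (gramInv L (b i)) (b j) * inner ℝ (b j) (adjoint (β (b i)) n) := by
    intro j
    rw [Matrix.of_apply, inner_gramInv hL, hb, hb, ContinuousLinearMap.adjoint_inner_right,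
      real_inner_comm n]
  rw [Finset.sum_congr rfl fun j _ => h2 j]
  rw [b.sum_inner_mul_inner, ← inner_gramInv hL]
  rfl

end Divergence

/-! ### The half-space: divergence theorem and boundary area element. -/

section HalfSpace

variable {k : ℕ}

/-- The inclusion of the boundary hyperplane of the half-space. -/
noncomputable def boundaryIncl (k : ℕ) :
    EuclideanSpace ℝ (Fin k) →L[ℝ] EuclideanSpace ℝ (Fin (k + 1)) :=
  LinearMap.toContinuousLinearMap
    { toFun := fun w => WithLp.toLp 2 (Fin.cons 0 w : Fin (k + 1) → ℝ)
      map_add' := fun v w => by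
        ext i
        refine Fin.cases ?_ (fun i => ?_) i <;> simp
      map_smul' := fun c w => by
        ext i
        refine Fin.cases ?_ (fun i => ?_) i <;> simp }

@[simp] theorem boundaryIncl_zero (w : EuclideanSpace ℝ (Fin k)) : boundaryIncl k w 0 = 0 := rfl

@[simp] theorem boundaryIncl_succ (w : EuclideanSpace ℝ (Fin k)) (i : Fin k) :
    boundaryIncl k w i.succ = w i := rfl

theorem boundaryIncl_injective : Function.Injective (boundaryIncl k) := fun v w h => by
  ext i
  rw [← boundaryIncl_succ v, h, boundaryIncl_succ]

theorem range_boundaryIncl : range (boundaryIncl k) = {u | u 0 = 0} := by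
  refine Subset.antisymm (by rintro _ ⟨w, rfl⟩; rfl) fun u hu => ?_
  refine ⟨WithLp.toLp 2 fun i => u i.succ, ?_⟩
  ext i
  refine Fin.cases ?_ (fun i => ?_) i
  · exact hu.symm
  · rfl

theorem boundaryIncl_single (i : Fin k) :
    boundaryIncl k (EuclideanSpace.single i 1) = EuclideanSpace.single i.succ 1 := by
  ext j
  refine Fin.cases ?_ (fun j => ?_) j
  · simp
  · simp [PiLp.single_apply]

/-- The closed half-space. -/
def halfSpace (k : ℕ) : Set (EuclideanSpace ℝ (Fin (k + 1))) := {u | 0 ≤ u 0}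

theorem interior_halfSpace' : interior (halfSpace k) = {u | 0 < u 0} :=
  interior_halfSpace _ _ _

theorem isClosed_halfSpace : IsClosed (halfSpace k) :=
  isClosed_le continuous_const (PiLp.continuous_apply 2 _ 0)

theorem convex_halfSpace : Convex ℝ (halfSpace k) := by
  intro u hu v hv a b ha hb _
  simp only [halfSpace, mem_ofPred_eq, PiLp.add_apply, PiLp.smul_apply, smul_eq_mul] at *
  positivity

theorem uniqueDiffOn_halfSpace : UniqueDiffOn ℝ (halfSpace k) := by
  refine uniqueDiffOn_convex convex_halfSpace ?_
  rw [interior_halfSpace']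
  exact ⟨EuclideanSpace.single 0 1, by simp⟩

/-- The divergence theorem for compactly supported fields on a half-space. -/
theorem integral_trace_halfSpace
    {Y : EuclideanSpace ℝ (Fin (k + 1)) → EuclideanSpace ℝ (Fin (k + 1))}
    {Y' : EuclideanSpace ℝ (Fin (k + 1)) →
      EuclideanSpace ℝ (Fin (k + 1)) →L[ℝ] EuclideanSpace ℝ (Fin (k + 1))} {R : ℝ}
    (hR : 0 < R) (hsupp : ∀ u ∈ halfSpace k, ∀ i, R ≤ |u i| → Y u = 0)
    (hYc : ContinuousOn Y (halfSpace k)) (hY : ∀ u, 0 < u 0 → HasFDerivAt Y (Y' u) u)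
    (hint : IntegrableOn (fun u => LinearMap.trace ℝ (EuclideanSpace ℝ (Fin (k + 1))) (Y' u)) (halfSpace k)) :
    ∫ u in halfSpace k, LinearMap.trace ℝ (EuclideanSpace ℝ (Fin (k + 1))) (Y' u) = -∫ w, Y (boundaryIncl k w) 0 := by
  let e := EuclideanSpace.equiv (Fin (k + 1)) ℝ
  -- The box stands on the hyperplane u 0 = 0; on its other faces some coordinate has absolute value
  -- R, so the field vanishes there.
  let a : Fin (k + 1) → ℝ := Fin.cons 0 fun _ => -R
  let b : Fin (k + 1) → ℝ := fun _ => R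
  have hab : a ≤ b := fun i => by
    refine Fin.cases ?_ (fun i => ?_) i
    · exact hR.le
    · simp only [a, b, Fin.cons_succ]
      linarith
  have ha0 : ∀ x ∈ Icc a b, e.symm x ∈ halfSpace k := fun x hx => hx.1 0
  let f : (Fin (k + 1) → ℝ) → Fin (k + 1) → ℝ := fun x => e (Y (e.symm x))
  let f' : (Fin (k + 1) → ℝ) → (Fin (k + 1) → ℝ) →L[ℝ] Fin (k + 1) → ℝ := fun x =>
    (e : _ →L[ℝ] _) ∘L Y' (e.symm x) ∘L (e.symm : _ →L[ℝ] _)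
  have htr : ∀ x, ∑ i, f' x (Pi.single i 1) i = LinearMap.trace ℝ _ (Y' (e.symm x) :
      EuclideanSpace ℝ (Fin (k + 1)) →ₗ[ℝ] EuclideanSpace ℝ (Fin (k + 1))) := by
    intro x
    rw [LinearMap.trace_eq_sum_inner _ (EuclideanSpace.basisFun (Fin (k + 1)) ℝ)]
    refine Finset.sum_congr rfl fun i _ => ?_
    rw [EuclideanSpace.basisFun_apply, EuclideanSpace.inner_single_left]
    simp only [map_one, one_mul]
    rfl
  have hmp : MeasurePreserving e.symm := PiLp.volume_preserving_toLp (Fin (k + 1))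
  have hme : MeasurableEmbedding e.symm := e.symm.toHomeomorph.measurableEmbedding
  have hae : ∀ x : Fin (k + 1) → ℝ, x 0 ≠ 0 → e.symm x ∈ halfSpace k → x ∉ Icc a b →
      LinearMap.trace ℝ _ (Y' (e.symm x) :
      EuclideanSpace ℝ (Fin (k + 1)) →ₗ[ℝ] EuclideanSpace ℝ (Fin (k + 1))) = 0 := by
    intro x hx0 hxH hxI
    have hx0' : 0 < x 0 := lt_of_le_of_ne hxH (Ne.symm hx0)
    have hex : ∃ i, R < |x i| := by
      by_contra! hcon
      refine hxI ⟨fun i => ?_, fun i => (abs_le.1 (hcon i)).2⟩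
      refine Fin.cases ?_ (fun i => ?_) i
      · exact hxH
      · exact (abs_le.1 (hcon i.succ)).1
    obtain ⟨i, hi⟩ := hex
    have hzero : Y =ᶠ[𝓝 (e.symm x)] fun _ => 0 := by
      have h1 : ∀ᶠ u in 𝓝 (e.symm x), 0 < u 0 :=
        (PiLp.continuous_apply 2 (fun _ => ℝ) 0).continuousAt.eventually (lt_mem_nhds hx0')
      have h2 : ∀ᶠ u in 𝓝 (e.symm x), R < |u i| :=
        ((PiLp.continuous_apply 2 (fun _ => ℝ) i).abs).continuousAt.eventually (lt_mem_nhds hi)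
      filter_upwards [h1, h2] with u hu1 hu2 using hsupp u hu1.le i hu2.le
    have : Y' (e.symm x) = 0 := by
      have h3 := (hY (e.symm x) hx0').congr_of_eventuallyEq hzero.symm
      exact h3.unique (hasFDerivAt_const 0 _)
    rw [this]
    simp
  -- Y' is the derivative of Y only where 0 < u 0, so the hyperplane has to be discarded as a null
  -- set.
  have hnull : volume {x : Fin (k + 1) → ℝ | x 0 = 0} = 0 := by
    rw [volume_pi]
    exact Measure.pi_hyperplane _ 0 0
  have hsub : Icc a b ⊆ e.symm ⁻¹' halfSpace k := ha0
  have key := integral_divergence_of_hasFDerivAt_off_countable a b hab f f' ∅ countable_empty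
    (e.continuous.comp_continuousOn (hYc.comp e.symm.continuous.continuousOn ha0))
    (fun x hx => by
      have hx0 : 0 < e.symm x 0 := (hx.1 0 (mem_univ 0)).1
      exact e.hasFDerivAt.comp x ((hY _ hx0).comp x e.symm.hasFDerivAt))
    (by
      simp_rw [htr]
      exact ((hmp.integrableOn_comp_preimage hme).2 hint).mono_set hsub)
  simp_rw [htr] at key
  have hL : ∫ u in halfSpace k, LinearMap.trace ℝ _ (Y' u : EuclideanSpace ℝ (Fin (k + 1)) →ₗ[ℝ]
      EuclideanSpace ℝ (Fin (k + 1))) = ∫ x in Icc a b, LinearMap.trace ℝ _ (Y' (e.symm x) :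
      EuclideanSpace ℝ (Fin (k + 1)) →ₗ[ℝ] EuclideanSpace ℝ (Fin (k + 1))) := by
    rw [← hmp.setIntegral_preimage_emb hme]
    refine setIntegral_eq_of_subset_of_ae_sdiff_eq_zero
      (hme.measurable isClosed_halfSpace.measurableSet).nullMeasurableSet hsub ?_
    filter_upwards [measure_eq_zero_iff_ae_notMem.1 hnull] with x hx hxd
    exact hae x hx hxd.1 hxd.2
  rw [hL, key, Fin.sum_univ_succ]
  have hsuccfront : ∀ i : Fin (k + 1), ∀ x ∈ Icc (a ∘ i.succAbove) (b ∘ i.succAbove),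
      f (i.insertNth (b i) x) i = 0 := by
    intro i x hx
    have h1 : i.insertNth (b i) x ∈ Icc a b := by
      rw [Fin.insertNth_mem_Icc]
      exact ⟨⟨hab i, le_rfl⟩, hx⟩
    have h2 := hsupp _ (ha0 _ h1) i (by simp [e, b, abs_of_pos hR])
    simp only [f, h2]
    simp
  have hsuccback : ∀ i : Fin k, ∀ x ∈ Icc (a ∘ i.succ.succAbove) (b ∘ i.succ.succAbove),
      f (i.succ.insertNth (a i.succ) x) i.succ = 0 := by
    intro i x hx
    have h1 : i.succ.insertNth (a i.succ) x ∈ Icc a b := by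
      rw [Fin.insertNth_mem_Icc]
      exact ⟨⟨le_rfl, hab _⟩, hx⟩
    have h2 := hsupp _ (ha0 _ h1) i.succ (by simp [e, a, abs_of_pos hR])
    simp only [f, h2]
    simp
  have hface : ∀ i : Fin (k + 1), MeasurableSet (Icc (a ∘ i.succAbove) (b ∘ i.succAbove)) :=
    fun i => measurableSet_Icc
  rw [setIntegral_eq_zero_of_forall_eq_zero (hsuccfront 0),
    Finset.sum_eq_zero fun i _ => by
      rw [setIntegral_eq_zero_of_forall_eq_zero (hsuccfront i.succ),
        setIntegral_eq_zero_of_forall_eq_zero (hsuccback i), sub_zero], zero_sub, add_zero,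
    ← (PiLp.volume_preserving_toLp (Fin k)).integral_comp
      (EuclideanSpace.equiv (Fin k) ℝ).symm.toHomeomorph.measurableEmbedding]
  congr 1
  have hins : ∀ x : Fin k → ℝ, f (Fin.insertNth 0 (a 0) x) 0 =
      Y (boundaryIncl k (WithLp.toLp 2 x)) 0 := by
    intro x
    simp only [f, Fin.insertNth_zero]
    rfl
  simp_rw [hins]
  refine setIntegral_eq_integral_of_forall_compl_eq_zero fun x hx => ?_
  have hex : ∃ i, R ≤ |x i| := by
    by_contra! hcon
    refine hx ⟨fun i => ?_, fun i => ?_⟩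
    · simpa [a] using (abs_le.1 (hcon i).le).1
    · exact (abs_le.1 (hcon i).le).2
  obtain ⟨i, hi⟩ := hex
  rw [hsupp _ (le_of_eq (boundaryIncl_zero _).symm) i.succ (by simpa using hi)]
  simp

variable {V : Type*} [NormedAddCommGroup V] [InnerProductSpace ℝ V] [FiniteDimensional ℝ V]
  {L : EuclideanSpace ℝ (Fin (k + 1)) →L[ℝ] V}

/-- The vector tangent to the image of `L` and dual to the first coordinate; it is normal to the
image of the boundary hyperplane. -/
noncomputable def conormal (L : EuclideanSpace ℝ (Fin (k + 1)) →L[ℝ] V) : V :=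
  L (gramInv L (EuclideanSpace.single 0 1))

theorem inner_conormal (hL : Function.Injective L) (v : EuclideanSpace ℝ (Fin (k + 1))) :
    inner ℝ (conormal L) (L v) = v 0 := by
  rw [conormal, ← inner_gram_left, gram_gramInv hL, EuclideanSpace.inner_single_left]
  simp

theorem inner_conormal_eq_pinv (hL : Function.Injective L) (x : V) :
    inner ℝ (conormal L) x = pinv L x 0 := by
  rw [← inner_conormal hL, conormal, inner_map_pinv hL]

/-- Cramer's rule: the Gram determinant of the boundary directions is the (0, 0) cofactor of g, that
is det g times the (0, 0) entry of g⁻¹, and this entry is ‖conormal L‖². -/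
theorem normDet_comp_boundaryIncl (hL : Function.Injective L) :
    (L ∘L boundaryIncl k : EuclideanSpace ℝ (Fin k) →ₗ[ℝ] V).normDet =
      (L : EuclideanSpace ℝ (Fin (k + 1)) →ₗ[ℝ] V).normDet * ‖conormal L‖ := by
  have hne : (L : EuclideanSpace ℝ (Fin (k + 1)) →ₗ[ℝ] V).normDet ≠ 0 :=
    ((LinearMap.normDet_ne_zero_tfae _).out 0 4).2 hL
  rw [← sq_eq_sq₀ (LinearMap.normDet_nonneg _)
    (mul_nonneg (LinearMap.normDet_nonneg _) (norm_nonneg _)), mul_pow]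
  set g : Matrix (Fin (k + 1)) (Fin (k + 1)) ℝ := Matrix.of fun i j =>
    inner ℝ (L (EuclideanSpace.single i 1)) (L (EuclideanSpace.single j 1)) with hg
  have h1 : (L : EuclideanSpace ℝ (Fin (k + 1)) →ₗ[ℝ] V).normDet ^ 2 = g.det := by
    have := LinearMap.normDet_sq_eq_det_gram (L : EuclideanSpace ℝ (Fin (k + 1)) →ₗ[ℝ] V)
      (EuclideanSpace.basisFun (Fin (k + 1)) ℝ)
    simp only [EuclideanSpace.basisFun_apply] at this
    exact this
  have h2 : (L ∘L boundaryIncl k : EuclideanSpace ℝ (Fin k) →ₗ[ℝ] V).normDet ^ 2 =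
      g.adjugate 0 0 := by
    have := LinearMap.normDet_sq_eq_det_gram
      (L ∘L boundaryIncl k : EuclideanSpace ℝ (Fin k) →ₗ[ℝ] V)
      (EuclideanSpace.basisFun (Fin k) ℝ)
    simp only [EuclideanSpace.basisFun_apply] at this
    rw [Matrix.adjugate_fin_succ_eq_det_submatrix]
    simp only [Fin.val_zero, add_zero, pow_zero, one_mul]
    refine this.trans (congrArg Matrix.det ?_)
    ext i j
    simp [Matrix.gram, g, boundaryIncl_single]
  have h3 : ‖conormal L‖ ^ 2 = g⁻¹ 0 0 := by
    rw [hg, inv_gram_matrix hL, Matrix.of_apply, ← real_inner_self_eq_norm_sq, conormal,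
      ← inner_gram, gram_gramInv hL, real_inner_comm]
  rw [h1, h2, h3, Matrix.inv_def, Matrix.smul_apply, smul_eq_mul, Ring.inverse_eq_inv',
    mul_inv_cancel_left₀]
  rw [← h1]
  positivity

end HalfSpace

/-! ### The divergence theorem on a minimal coordinate patch. -/

section Patch

variable {k : ℕ} {V : Type*} [NormedAddCommGroup V] [InnerProductSpace ℝ V]
  [FiniteDimensional ℝ V]

theorem continuousAt_pinv {U : Type*} [NormedAddCommGroup U] [InnerProductSpace ℝ U]
    [FiniteDimensional ℝ U] {L : U →L[ℝ] V} (hL : Function.Injective L) :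
    ContinuousAt pinv L := by
  obtain ⟨D, hD, -⟩ := hasFDerivAt_pinv hL
  exact hD.continuousAt

/-- The volume density of a linear map. -/
noncomputable abbrev jac {U : Type*} [NormedAddCommGroup U] [InnerProductSpace ℝ U]
    [FiniteDimensional ℝ U] (L : U →L[ℝ] V) : ℝ :=
  (L : U →ₗ[ℝ] V).normDet

/-- The derivative of a map on the half-space. -/
noncomputable abbrev halfDeriv {W : Type*} [NormedAddCommGroup W] [NormedSpace ℝ W]
    (f : EuclideanSpace ℝ (Fin (k + 1)) → W) (u : EuclideanSpace ℝ (Fin (k + 1))) :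
    EuclideanSpace ℝ (Fin (k + 1)) →L[ℝ] W :=
  fderivWithin ℝ f (halfSpace k) u

/-- A smooth immersion of a relatively open subset of the half-space. -/
structure ImmersedPatch (f : EuclideanSpace ℝ (Fin (k + 1)) → V)
    (T : Set (EuclideanSpace ℝ (Fin (k + 1)))) : Prop where
  subset : T ⊆ halfSpace k
  mem_nhdsWithin : ∀ u ∈ T, T ∈ 𝓝[halfSpace k] u
  contDiffWithinAt : ∀ u ∈ T, ContDiffWithinAt ℝ ∞ f (halfSpace k) u
  injective : ∀ u ∈ T, Function.Injective (halfDeriv f u)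

/-- The mean curvature of a parametrised surface vanishes in the interior. -/
def HasZeroMeanCurvatureOn (f : EuclideanSpace ℝ (Fin (k + 1)) → V)
    (T : Set (EuclideanSpace ℝ (Fin (k + 1)))) : Prop :=
  ∀ u ∈ T, 0 < u 0 → ∀ n ∈ (halfDeriv f u : EuclideanSpace ℝ (Fin (k + 1)) →ₗ[ℝ] V).rangeᗮ,
    hessTrace (halfDeriv f u) (fderiv ℝ (halfDeriv f) u) n = 0

variable {f : EuclideanSpace ℝ (Fin (k + 1)) → V} {T : Set (EuclideanSpace ℝ (Fin (k + 1)))}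

theorem halfSpace_mem_nhds {u : EuclideanSpace ℝ (Fin (k + 1))} (hu : 0 < u 0) :
    halfSpace k ∈ 𝓝 u := by
  rw [mem_nhds_iff]
  refine ⟨{u | 0 < u 0}, fun v hv => le_of_lt (b := v 0) hv, ?_, hu⟩
  exact isOpen_lt continuous_const (PiLp.continuous_apply 2 _ 0)

theorem halfDeriv_eventuallyEq {W : Type*} [NormedAddCommGroup W] [NormedSpace ℝ W]
    (g : EuclideanSpace ℝ (Fin (k + 1)) → W) {u : EuclideanSpace ℝ (Fin (k + 1))}
    (hu : 0 < u 0) : halfDeriv g =ᶠ[𝓝 u] fderiv ℝ g := by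
  have : ∀ᶠ v in 𝓝 u, 0 < v 0 :=
    (PiLp.continuous_apply 2 (fun _ => ℝ) 0).continuousAt.eventually (lt_mem_nhds hu)
  filter_upwards [this] with v hv using fderivWithin_of_mem_nhds (halfSpace_mem_nhds hv)

theorem continuousWithinAt_halfDeriv {W : Type*} [NormedAddCommGroup W] [NormedSpace ℝ W]
    {g : EuclideanSpace ℝ (Fin (k + 1)) → W} {u : EuclideanSpace ℝ (Fin (k + 1))}
    (hu : u ∈ halfSpace k) (hg : ContDiffWithinAt ℝ ∞ g (halfSpace k) u) :
    ContinuousWithinAt (halfDeriv g) (halfSpace k) u :=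
  (hg.fderivWithin_right (m := 0) uniqueDiffOn_halfSpace (by simp) hu).continuousWithinAt

namespace ImmersedPatch

theorem continuousWithinAt (h : ImmersedPatch f T) {u : EuclideanSpace ℝ (Fin (k + 1))}
    (hu : u ∈ T) : ContinuousWithinAt f (halfSpace k) u :=
  (h.contDiffWithinAt u hu).continuousWithinAt

theorem continuousWithinAt_deriv (h : ImmersedPatch f T) {u : EuclideanSpace ℝ (Fin (k + 1))}
    (hu : u ∈ T) : ContinuousWithinAt (halfDeriv f) (halfSpace k) u :=
  continuousWithinAt_halfDeriv (h.subset hu) (h.contDiffWithinAt u hu)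

theorem continuousWithinAt_pinv (h : ImmersedPatch f T) {u : EuclideanSpace ℝ (Fin (k + 1))}
    (hu : u ∈ T) : ContinuousWithinAt (fun u => pinv (halfDeriv f u)) (halfSpace k) u :=
  (continuousAt_pinv (h.injective u hu)).comp_continuousWithinAt (h.continuousWithinAt_deriv hu)

theorem hasFDerivWithinAt (h : ImmersedPatch f T) {u : EuclideanSpace ℝ (Fin (k + 1))}
    (hu : u ∈ T) : HasFDerivWithinAt f (halfDeriv f u) (halfSpace k) u :=
  ((h.contDiffWithinAt u hu).differentiableWithinAt (by simp)).hasFDerivWithinAt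

end ImmersedPatch

theorem continuousOn_halfSpace_of_support {W : Type*} [TopologicalSpace W] [Zero W]
    {g : EuclideanSpace ℝ (Fin (k + 1)) → W} {K : Set (EuclideanSpace ℝ (Fin (k + 1)))}
    (hK : IsClosed K) (hKT : K ⊆ T) (hg0 : ∀ u ∈ halfSpace k, u ∉ K → g u = 0)
    (hg : ∀ u ∈ T, ContinuousWithinAt g (halfSpace k) u) : ContinuousOn g (halfSpace k) := by
  intro u hu
  by_cases huK : u ∈ K
  · exact hg u (hKT huK)
  · have : g =ᶠ[𝓝[halfSpace k] u] fun _ => 0 := by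
      filter_upwards [mem_nhdsWithin_of_mem_nhds (hK.isOpen_compl.mem_nhds huK),
        self_mem_nhdsWithin] with v hv hvH using hg0 v hvH hv
    exact (continuousWithinAt_const (b := (0 : W))).congr_of_eventuallyEq this (hg0 u hu huK)

theorem integrableOn_halfSpace_of_support
    {g : EuclideanSpace ℝ (Fin (k + 1)) → ℝ} {K : Set (EuclideanSpace ℝ (Fin (k + 1)))}
    (hK : IsCompact K) (hKH : K ⊆ halfSpace k) (hg0 : ∀ u ∈ halfSpace k, u ∉ K → g u = 0)
    (hg : ContinuousOn g (halfSpace k)) : IntegrableOn g (halfSpace k) :=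
  ((hg.mono hKH).integrableOn_compact hK).of_forall_sdiff_eq_zero isClosed_halfSpace.measurableSet
    fun u hu => hg0 u hu.1 hu.2

theorem exists_bound_of_isCompact {K : Set (EuclideanSpace ℝ (Fin (k + 1)))} (hK : IsCompact K) :
    ∃ R : ℝ, 0 < R ∧ ∀ u, ∀ i, R ≤ |u i| → u ∉ K := by
  obtain ⟨R, hR⟩ := hK.isBounded.exists_norm_le
  refine ⟨max R 0 + 1, by positivity, fun u i hi huK => ?_⟩
  have h1 := PiLp.norm_apply_le u i
  have h2 := hR u huK
  rw [Real.norm_eq_abs] at h1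
  have h3 := le_max_left R 0
  linarith

theorem ae_halfSpace_pos :
    ∀ᵐ u ∂(volume.restrict (halfSpace k)), (0 : ℝ) < u 0 := by
  have h1 : volume {u : EuclideanSpace ℝ (Fin (k + 1)) | u 0 = 0} = 0 := by
    rw [← (PiLp.volume_preserving_toLp (Fin (k + 1))).measure_preimage_emb
      (EuclideanSpace.equiv (Fin (k + 1)) ℝ).symm.toHomeomorph.measurableEmbedding]
    exact (congrFun (congrArg _ volume_pi) _).trans
      (Measure.pi_hyperplane (fun _ : Fin (k + 1) => (volume : Measure ℝ)) 0 0)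
  rw [ae_restrict_iff' isClosed_halfSpace.measurableSet]
  filter_upwards [measure_eq_zero_iff_ae_notMem.1 h1] with u hu huH
  exact lt_of_le_of_ne huH (Ne.symm hu)

/-- The divergence theorem for the tangential part of an ambient field along a minimal patch. -/
theorem ImmersedPatch.integral_divergence (h : ImmersedPatch f T)
    (hH : HasZeroMeanCurvatureOn f T) {η : EuclideanSpace ℝ (Fin (k + 1)) → ℝ}
    (hη : ∀ u ∈ T, ContDiffWithinAt ℝ ∞ η (halfSpace k) u)
    {K : Set (EuclideanSpace ℝ (Fin (k + 1)))} (hK : IsCompact K) (hKT : K ⊆ T)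
    (hηK : ∀ u ∈ halfSpace k, u ∉ K → η u = 0) {X : V → V} (hX : ContDiff ℝ ∞ X) :
    ∫ u in halfSpace k, jac (halfDeriv f u) *
        (halfDeriv η u (pinv (halfDeriv f u) (X (f u))) + η u *
          LinearMap.trace ℝ V (halfDeriv f u ∘L pinv (halfDeriv f u) ∘L fderiv ℝ X (f u) :
            V →L[ℝ] V)) =
      -∫ w, η (boundaryIncl k w) * (jac (halfDeriv f (boundaryIncl k w)) *
        inner ℝ (conormal (halfDeriv f (boundaryIncl k w))) (X (f (boundaryIncl k w)))) := by
  set Y := flux f (halfDeriv f) η X with hY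
  have hY0 : ∀ u ∈ halfSpace k, u ∉ K → Y u = 0 := fun u hu huK => by
    simp [hY, flux, hηK u hu huK]
  have hη'0 : ∀ u ∈ halfSpace k, u ∉ K → halfDeriv η u = 0 := by
    intro u hu huK
    have : η =ᶠ[𝓝[halfSpace k] u] fun _ => 0 := by
      filter_upwards [mem_nhdsWithin_of_mem_nhds (hK.isClosed.isOpen_compl.mem_nhds huK),
        self_mem_nhdsWithin] with v hv hvH using hηK v hvH hv
    rw [halfDeriv, this.fderivWithin_eq (hηK u hu huK)]
    simp
  have hJc : ∀ u ∈ T, ContinuousWithinAt (fun u => jac (halfDeriv f u))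
      (halfSpace k) u := fun u hu =>
    continuous_normDet.continuousAt.comp_continuousWithinAt (h.continuousWithinAt_deriv hu)
  have hXc : ∀ u ∈ T, ContinuousWithinAt (fun u => X (f u)) (halfSpace k) u := fun u hu =>
    hX.continuous.continuousAt.comp_continuousWithinAt (h.continuousWithinAt hu)
  have hpc : ∀ u ∈ T, ContinuousWithinAt (fun u => pinv (halfDeriv f u) (X (f u)))
      (halfSpace k) u := fun u hu => (h.continuousWithinAt_pinv hu).clm_apply (hXc u hu)
  have hηc : ∀ u ∈ T, ContinuousWithinAt η (halfSpace k) u := fun u hu =>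
    (hη u hu).continuousWithinAt
  have hYc : ContinuousOn Y (halfSpace k) :=
    continuousOn_halfSpace_of_support hK.isClosed hKT hY0 fun u hu =>
      ((hηc u hu).mul (hJc u hu)).smul (hpc u hu)
  set G : EuclideanSpace ℝ (Fin (k + 1)) → ℝ := fun u =>
    jac (halfDeriv f u) * (halfDeriv η u (pinv (halfDeriv f u) (X (f u))) + η u *
      LinearMap.trace ℝ V (halfDeriv f u ∘L pinv (halfDeriv f u) ∘L fderiv ℝ X (f u) :
        V →L[ℝ] V)) with hG
  have hG0 : ∀ u ∈ halfSpace k, u ∉ K → G u = 0 := fun u hu huK => by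
    simp [hG, hηK u hu huK, hη'0 u hu huK]
  have htr : Continuous fun S : V →L[ℝ] V => LinearMap.trace ℝ V (S : V →ₗ[ℝ] V) :=
    ((LinearMap.trace ℝ V) ∘ₗ (ContinuousLinearMap.coeLM ℝ)).continuous_of_finiteDimensional
  have hGc : ContinuousOn G (halfSpace k) := by
    refine continuousOn_halfSpace_of_support hK.isClosed hKT hG0 fun u hu => ?_
    refine (hJc u hu).mul (ContinuousWithinAt.add ?_ ((hηc u hu).mul ?_))
    · exact (continuousWithinAt_halfDeriv (h.subset hu) (hη u hu)).clm_apply (hpc u hu)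
    · refine htr.continuousAt.comp_continuousWithinAt ?_
      refine (h.continuousWithinAt_deriv hu).clm_comp
        ((h.continuousWithinAt_pinv hu).clm_comp ?_)
      exact (hX.continuous_fderiv (by simp)).continuousAt.comp_continuousWithinAt
        (h.continuousWithinAt hu)
  have hYd : ∀ u, 0 < u 0 → ∃ Y' : EuclideanSpace ℝ (Fin (k + 1)) →L[ℝ]
      EuclideanSpace ℝ (Fin (k + 1)), HasFDerivAt Y Y' u ∧
        LinearMap.trace ℝ (EuclideanSpace ℝ (Fin (k + 1))) Y' = G u := by
    intro u hu
    have huH : u ∈ halfSpace k := le_of_lt hu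
    have hHu := halfSpace_mem_nhds hu
    by_cases huK : u ∈ K
    · have huT := hKT huK
      have hfu : ContDiffAt ℝ ∞ f u := (h.contDiffWithinAt u huT).contDiffAt hHu
      have hfd : HasFDerivAt f (halfDeriv f u) u := (h.hasFDerivWithinAt huT).hasFDerivAt hHu
      have hA : HasFDerivAt (halfDeriv f) (fderiv ℝ (halfDeriv f) u) u := by
        have h1 : ContDiffAt ℝ 1 (fderiv ℝ f) u := hfu.fderiv_right (by norm_cast)
        exact ((h1.differentiableAt (by simp)).congr_of_eventuallyEq
          (halfDeriv_eventuallyEq f hu)).hasFDerivAt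
      have hsymm : ∀ v w, fderiv ℝ (halfDeriv f) u v w = fderiv ℝ (halfDeriv f) u w v := by
        intro v w
        rw [(halfDeriv_eventuallyEq f hu).fderiv_eq]
        exact hfu.isSymmSndFDerivAt (by simp; exact WithTop.coe_le_coe.2 (le_top (a := (2 : ℕ∞)))) v w
      have hηd : HasFDerivAt η (halfDeriv η u) u :=
        (((hη u huT).differentiableWithinAt (by simp)).hasFDerivWithinAt).hasFDerivAt hHu
      obtain ⟨Y', hY', htrY⟩ := exists_hasFDerivAt_flux hfd hA hsymm (h.injective u huT) hηd
        (hX.differentiable (by simp) (f u)).hasFDerivAt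
      refine ⟨Y', hY', ?_⟩
      -- What is left of X after tangential projection is normal, so minimality removes the mean
      -- curvature term. Cyclicity then moves the trace from the parameter space to V.
      rw [htrY, hH u huT hu _ (sub_map_pinv_mem_orthogonal (h.injective u huT) _), mul_zero,
        add_zero, hG]
      congr 3
      rw [ContinuousLinearMap.toLinearMap_comp, LinearMap.trace_comp_comm',
        ContinuousLinearMap.toLinearMap_comp, ContinuousLinearMap.toLinearMap_comp,
        ContinuousLinearMap.toLinearMap_comp, LinearMap.comp_assoc]
      rw [LinearMap.trace_comp_comm', LinearMap.comp_assoc, LinearMap.trace_comp_comm',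
        LinearMap.comp_assoc]
    · refine ⟨0, ?_, by rw [hG0 u huH huK]; simp⟩
      have : Y =ᶠ[𝓝 u] fun _ => 0 := by
        filter_upwards [hK.isClosed.isOpen_compl.mem_nhds huK, hHu] with v hv hvH
          using hY0 v hvH hv
      exact (hasFDerivAt_const 0 u).congr_of_eventuallyEq this
  have hYd' : ∀ u, 0 < u 0 → HasFDerivAt Y (fderiv ℝ Y u) u ∧
      LinearMap.trace ℝ (EuclideanSpace ℝ (Fin (k + 1))) (fderiv ℝ Y u) = G u := by
    intro u hu
    obtain ⟨Y', h1, h2⟩ := hYd u hu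
    rw [h1.fderiv]
    exact ⟨h1, h2⟩
  have hae : (fun u => LinearMap.trace ℝ (EuclideanSpace ℝ (Fin (k + 1))) (fderiv ℝ Y u))
      =ᵐ[volume.restrict (halfSpace k)] G := by
    filter_upwards [ae_halfSpace_pos] with u hu using (hYd' u hu).2
  have hGi : IntegrableOn G (halfSpace k) :=
    integrableOn_halfSpace_of_support hK (hKT.trans h.subset) hG0 hGc
  obtain ⟨R, hR, hRK⟩ := exists_bound_of_isCompact hK
  have key := integral_trace_halfSpace hR (fun u hu i hi => hY0 u hu (hRK u i hi)) hYc
    (fun u hu => (hYd' u hu).1) (hGi.congr hae.symm)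
  rw [← integral_congr_ae hae, key]
  congr 2
  funext w
  by_cases hwK : boundaryIncl k w ∈ K
  · rw [inner_conormal_eq_pinv (h.injective _ (hKT hwK))]
    simp [hY, flux, mul_assoc]
  · have hw : boundaryIncl k w ∈ halfSpace k := le_of_eq (boundaryIncl_zero w).symm
    rw [hY0 _ hw hwK, hηK _ hw hwK]
    simp

end Patch

/-! ### Charts of the manifold and changes of charts. -/

section Charts

variable {k n : ℕ} {M : Type*} [TopologicalSpace M]
  [ChartedSpace (EuclideanHalfSpace (k + 1)) M]

theorem range_model : range (𝓡∂ (k + 1)) = halfSpace k :=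
  range_modelWithCornersEuclideanHalfSpace _

/-- The domain in the half-space of the preferred chart at a point. -/
def chartDom (x : M) : Set (EuclideanSpace ℝ (Fin (k + 1))) := (extChartAt (𝓡∂ (k + 1)) x).target

/-- The inverse of the preferred chart at a point. -/
noncomputable def chartInv (k : ℕ) {M : Type*} [TopologicalSpace M]
    [ChartedSpace (EuclideanHalfSpace (k + 1)) M] (x : M) : EuclideanSpace ℝ (Fin (k + 1)) → M :=
  (extChartAt (𝓡∂ (k + 1)) x).symm

/-- The change of charts. -/
noncomputable def chartTrans (k : ℕ) {M : Type*} [TopologicalSpace M]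
    [ChartedSpace (EuclideanHalfSpace (k + 1)) M] (x y : M) :
    EuclideanSpace ℝ (Fin (k + 1)) → EuclideanSpace ℝ (Fin (k + 1)) :=
  extChartAt (𝓡∂ (k + 1)) y ∘ chartInv k x

theorem chartDom_subset (x : M) : chartDom (k := k) x ⊆ halfSpace k := by
  rw [← range_model]
  exact extChartAt_target_subset_range x

theorem chartDom_mem_nhdsWithin (x : M) {u : EuclideanSpace ℝ (Fin (k + 1))}
    (hu : u ∈ chartDom x) : chartDom x ∈ 𝓝[halfSpace k] u := by
  rw [← range_model]
  exact extChartAt_target_mem_nhdsWithin_of_mem hu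

theorem continuousOn_chartInv (x : M) : ContinuousOn (chartInv k x) (chartDom x) :=
  continuousOn_extChartAt_symm x

theorem injOn_chartInv (x : M) : InjOn (chartInv k x) (chartDom x) :=
  (extChartAt (𝓡∂ (k + 1)) x).symm.injOn

theorem chartInv_mem_source {x : M} {u : EuclideanSpace ℝ (Fin (k + 1))} (hu : u ∈ chartDom x) :
    chartInv k x u ∈ (chartAt (EuclideanHalfSpace (k + 1)) x).source := by
  rw [← extChartAt_source (𝓡∂ (k + 1))]
  exact (extChartAt (𝓡∂ (k + 1)) x).map_target hu

theorem image_chartInv (x : M) :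
    chartInv k x '' chartDom x = (chartAt (EuclideanHalfSpace (k + 1)) x).source := by
  rw [← extChartAt_source (𝓡∂ (k + 1))]
  exact (extChartAt (𝓡∂ (k + 1)) x).symm.image_source_eq_target

theorem extChartAt_mem_chartDom {x z : M}
    (hz : z ∈ (chartAt (EuclideanHalfSpace (k + 1)) x).source) :
    extChartAt (𝓡∂ (k + 1)) x z ∈ chartDom x := by
  rw [← extChartAt_source (𝓡∂ (k + 1))] at hz
  exact (extChartAt (𝓡∂ (k + 1)) x).map_source hz

theorem chartInv_extChartAt {x z : M}
    (hz : z ∈ (chartAt (EuclideanHalfSpace (k + 1)) x).source) :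
    chartInv k x (extChartAt (𝓡∂ (k + 1)) x z) = z := by
  rw [← extChartAt_source (𝓡∂ (k + 1))] at hz
  exact (extChartAt (𝓡∂ (k + 1)) x).left_inv hz

theorem extChartAt_chartInv {x : M} {u : EuclideanSpace ℝ (Fin (k + 1))} (hu : u ∈ chartDom x) :
    extChartAt (𝓡∂ (k + 1)) x (chartInv k x u) = u :=
  (extChartAt (𝓡∂ (k + 1)) x).right_inv hu

theorem chartTrans_mem_halfSpace (x y : M) (u : EuclideanSpace ℝ (Fin (k + 1))) :
    chartTrans k x y u ∈ halfSpace k := by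
  rw [← range_model]
  exact mem_range_self _

theorem continuousWithinAt_chartInv {x : M} {u : EuclideanSpace ℝ (Fin (k + 1))}
    (hu : u ∈ chartDom x) : ContinuousWithinAt (chartInv k x) (halfSpace k) u :=
  ((continuousOn_chartInv x) u hu).mono_of_mem_nhdsWithin (chartDom_mem_nhdsWithin x hu)

theorem eventually_chartInv_mem {x : M} {u : EuclideanSpace ℝ (Fin (k + 1))}
    (hu : u ∈ chartDom x) {s : Set M} (hs : s ∈ 𝓝 (chartInv k x u)) :
    ∀ᶠ v in 𝓝[halfSpace k] u, v ∈ chartDom x ∧ chartInv k x v ∈ s := by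
  filter_upwards [chartDom_mem_nhdsWithin x hu, (continuousWithinAt_chartInv hu) hs] with v h1 h2
    using ⟨h1, h2⟩

theorem comp_chartInv_eventuallyEq {W : Type*} (g : M → W) {x y : M}
    {u : EuclideanSpace ℝ (Fin (k + 1))} (hu : u ∈ chartDom x)
    (hy : chartInv k x u ∈ (chartAt (EuclideanHalfSpace (k + 1)) y).source) :
    g ∘ chartInv k x =ᶠ[𝓝[halfSpace k] u] (g ∘ chartInv k y) ∘ chartTrans k x y := by
  filter_upwards [eventually_chartInv_mem hu ((chartAt _ y).open_source.mem_nhds hy)] with v hv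
  simp only [Function.comp_apply, chartTrans]
  rw [chartInv_extChartAt hv.2]

variable [IsManifold (𝓡∂ (k + 1)) ∞ M]

theorem contDiffWithinAt_chartTrans {x y : M} {u : EuclideanSpace ℝ (Fin (k + 1))}
    (hu : u ∈ chartDom x)
    (hy : chartInv k x u ∈ (chartAt (EuclideanHalfSpace (k + 1)) y).source) :
    ContDiffWithinAt ℝ ∞ (chartTrans k x y) (halfSpace k) u := by
  rw [← contMDiffWithinAt_iff_contDiffWithinAt]
  have h1 : ContMDiffWithinAt 𝓘(ℝ, EuclideanSpace ℝ (Fin (k + 1))) (𝓡∂ (k + 1)) ∞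
      (chartInv k x) (halfSpace k) u :=
    (contMDiffOn_extChartAt_symm x u hu).mono_of_mem_nhdsWithin (chartDom_mem_nhdsWithin x hu)
  exact (contMDiffAt_extChartAt' hy).comp_contMDiffWithinAt u h1

theorem contDiffWithinAt_comp_chartInv {W : Type*} [NormedAddCommGroup W] [NormedSpace ℝ W]
    {g : M → W} (hg : ContMDiff (𝓡∂ (k + 1)) 𝓘(ℝ, W) ∞ g) {x : M}
    {u : EuclideanSpace ℝ (Fin (k + 1))} (hu : u ∈ chartDom x) :
    ContDiffWithinAt ℝ ∞ (g ∘ chartInv k x) (halfSpace k) u := by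
  rw [← contMDiffWithinAt_iff_contDiffWithinAt]
  have h1 : ContMDiffWithinAt 𝓘(ℝ, EuclideanSpace ℝ (Fin (k + 1))) (𝓡∂ (k + 1)) ∞
      (chartInv k x) (halfSpace k) u :=
    (contMDiffOn_extChartAt_symm x u hu).mono_of_mem_nhdsWithin (chartDom_mem_nhdsWithin x hu)
  exact (hg _).comp_contMDiffWithinAt u h1

theorem halfDeriv_comp_chartTrans {W : Type*} [NormedAddCommGroup W] [NormedSpace ℝ W]
    {g : M → W} (hg : ContMDiff (𝓡∂ (k + 1)) 𝓘(ℝ, W) ∞ g) {x y : M}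
    {u : EuclideanSpace ℝ (Fin (k + 1))} (hu : u ∈ chartDom x)
    (hy : chartInv k x u ∈ (chartAt (EuclideanHalfSpace (k + 1)) y).source) :
    halfDeriv (g ∘ chartInv k x) u =
      halfDeriv (g ∘ chartInv k y) (chartTrans k x y u) ∘L halfDeriv (chartTrans k x y) u := by
  have hv : chartTrans k x y u ∈ chartDom y := extChartAt_mem_chartDom hy
  rw [halfDeriv, (comp_chartInv_eventuallyEq g hu hy).fderivWithin_eq
    ((comp_chartInv_eventuallyEq g hu hy).self_of_nhdsWithin (chartDom_subset x hu))]
  exact fderivWithin_comp u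
    ((contDiffWithinAt_comp_chartInv hg hv).differentiableWithinAt (by simp))
    ((contDiffWithinAt_chartTrans hu hy).differentiableWithinAt (by simp))
    (fun v _ => chartTrans_mem_halfSpace x y v) (uniqueDiffOn_halfSpace u (chartDom_subset x hu))

theorem halfDeriv_chartTrans_comp {x y : M} {u : EuclideanSpace ℝ (Fin (k + 1))}
    (hu : u ∈ chartDom x)
    (hy : chartInv k x u ∈ (chartAt (EuclideanHalfSpace (k + 1)) y).source) :
    halfDeriv (chartTrans k y x) (chartTrans k x y u) ∘L halfDeriv (chartTrans k x y) u =
      ContinuousLinearMap.id ℝ _ := by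
  have hv : chartTrans k x y u ∈ chartDom y := extChartAt_mem_chartDom hy
  have hx : chartInv k y (chartTrans k x y u) ∈
      (chartAt (EuclideanHalfSpace (k + 1)) x).source := by
    simp only [chartTrans, Function.comp_apply]
    rw [chartInv_extChartAt hy]
    exact chartInv_mem_source hu
  have hud := uniqueDiffOn_halfSpace u (chartDom_subset x hu)
  rw [← fderivWithin_id (𝕜 := ℝ) hud]
  have h1 := fderivWithin_comp u
    ((contDiffWithinAt_chartTrans hv hx).differentiableWithinAt (by simp))
    ((contDiffWithinAt_chartTrans hu hy).differentiableWithinAt (by simp))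
    (fun v _ => chartTrans_mem_halfSpace x y v) hud
  rw [halfDeriv, halfDeriv, ← h1]
  have h2 : chartTrans k y x ∘ chartTrans k x y =ᶠ[𝓝[halfSpace k] u] id := by
    filter_upwards [eventually_chartInv_mem hu ((chartAt _ y).open_source.mem_nhds hy)] with v hv
    simp only [Function.comp_apply, chartTrans, id]
    rw [chartInv_extChartAt hv.2, extChartAt_chartInv hv.1]
  exact h2.fderivWithin_eq (h2.self_of_nhdsWithin (chartDom_subset x hu))

/-- The derivative of a change of charts, as an isomorphism. -/
theorem exists_equiv_halfDeriv_chartTrans {x y : M} {u : EuclideanSpace ℝ (Fin (k + 1))}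
    (hu : u ∈ chartDom x)
    (hy : chartInv k x u ∈ (chartAt (EuclideanHalfSpace (k + 1)) y).source) :
    ∃ Φ : EuclideanSpace ℝ (Fin (k + 1)) ≃L[ℝ] EuclideanSpace ℝ (Fin (k + 1)),
      (Φ : EuclideanSpace ℝ (Fin (k + 1)) →L[ℝ] EuclideanSpace ℝ (Fin (k + 1))) =
        halfDeriv (chartTrans k x y) u := by
  have h1 := halfDeriv_chartTrans_comp hu hy
  have hinj : Function.Injective (halfDeriv (chartTrans k x y) u) := fun v w hvw => by
    have := DFunLike.congr_fun h1 v
    have h2 := DFunLike.congr_fun h1 w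
    simp only [ContinuousLinearMap.comp_apply, ContinuousLinearMap.id_apply] at this h2
    rw [← this, hvw, h2]
  refine ⟨(LinearEquiv.ofInjectiveEndo
    (halfDeriv (chartTrans k x y) u : EuclideanSpace ℝ (Fin (k + 1)) →ₗ[ℝ]
      EuclideanSpace ℝ (Fin (k + 1))) hinj).toContinuousLinearEquiv, ?_⟩
  ext v
  rfl

theorem isInteriorPoint_chartInv_iff {x : M} {u : EuclideanSpace ℝ (Fin (k + 1))}
    (hu : u ∈ chartDom x) : (𝓡∂ (k + 1)).IsInteriorPoint (chartInv k x u) ↔ 0 < u 0 := by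
  have h1 := (𝓡∂ (k + 1)).isInteriorPoint_iff_of_mem_atlas (n := ∞) (by simp)
    (chart_mem_atlas (EuclideanHalfSpace (k + 1)) x) (chartInv_mem_source hu)
  have h2 : (chartAt (EuclideanHalfSpace (k + 1)) x).extend (𝓡∂ (k + 1)) (chartInv k x u) = u :=
    extChartAt_chartInv hu
  rw [h1, h2]
  change u ∈ interior (chartDom x) ↔ _
  constructor
  · intro h
    have := interior_mono (chartDom_subset x) h
    rwa [interior_halfSpace'] at this
  · intro h
    rw [mem_interior_iff_mem_nhds]
    have := chartDom_mem_nhdsWithin x hu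
    rwa [nhdsWithin_eq_nhds.2 (halfSpace_mem_nhds h)] at this

theorem mem_boundary_chartInv_iff {x : M} {u : EuclideanSpace ℝ (Fin (k + 1))}
    (hu : u ∈ chartDom x) : chartInv k x u ∈ (𝓡∂ (k + 1)).boundary M ↔ u 0 = 0 := by
  have h1 : chartInv k x u ∈ (𝓡∂ (k + 1)).boundary M ↔
      ¬ (𝓡∂ (k + 1)).IsInteriorPoint (chartInv k x u) :=
    (𝓡∂ (k + 1)).isBoundaryPoint_iff_not_isInteriorPoint _
  have h2 : 0 ≤ u 0 := chartDom_subset x hu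
  rw [h1, isInteriorPoint_chartInv_iff hu, not_lt]
  exact ⟨fun h => le_antisymm h h2, fun h => h.le⟩

variable {F : M → EuclideanSpace ℝ (Fin n)}

/-- The manifold derivative is taken in the chart preferred at the point itself; the invertible
derivative of the change of charts carries injectivity to every chart around the point. -/
theorem _root_.IsMinimalImmersion.immersedPatch (hF : IsMinimalImmersion (k + 1) F) (x : M) :
    ImmersedPatch (F ∘ chartInv k x) (chartDom x) where
  subset := chartDom_subset x
  mem_nhdsWithin := fun _ hu => chartDom_mem_nhdsWithin x hu
  contDiffWithinAt := fun _ hu => contDiffWithinAt_comp_chartInv hF.contMDiff hu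
  injective := fun u hu => by
    set z := chartInv k x u with hz
    have hzs : z ∈ (chartAt (EuclideanHalfSpace (k + 1)) z).source := mem_chart_source _ _
    obtain ⟨Φ, hΦ⟩ := exists_equiv_halfDeriv_chartTrans hu hzs
    rw [halfDeriv_comp_chartTrans hF.contMDiff hu hzs, ← hΦ]
    have h1 := hF.injective_mfderiv z
    rw [((hF.contMDiff z).mdifferentiableAt (by simp)).mfderiv, range_model] at h1
    exact fun a b hab => Φ.injective (h1 hab)

/-- The hypothesis speaks only of the chart preferred at each point. Under a change of charts the
second derivative of the transition map is composed with the first derivative of F, so it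
contributes a tangential vector that ν does not see. -/
theorem _root_.IsMinimalImmersion.hasZeroMeanCurvatureOn
    (hF : IsMinimalImmersion (k + 1) F) (x : M) :
    HasZeroMeanCurvatureOn (F ∘ chartInv k x) (chartDom x) := by
  intro u hu hu0 ν hν
  set z := chartInv k x u with hz
  have hzs : z ∈ (chartAt (EuclideanHalfSpace (k + 1)) z).source := mem_chart_source _ _
  set v := chartTrans k x z u with hv
  have hvz : v = extChartAt (𝓡∂ (k + 1)) z z := rfl
  have hvd : v ∈ chartDom z := extChartAt_mem_chartDom hzs
  have hv0 : 0 < v 0 := by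
    rw [← isInteriorPoint_chartInv_iff hvd, hvz, chartInv_extChartAt hzs, hz,
      isInteriorPoint_chartInv_iff hu]
    exact hu0
  obtain ⟨Φ, hΦ⟩ := exists_equiv_halfDeriv_chartTrans hu hzs
  have hinj := (hF.immersedPatch z).injective v hvd
  have hL := halfDeriv_comp_chartTrans hF.contMDiff hu hzs
  set f₁ := F ∘ chartInv k z with hf₁
  have hdiff : ∀ {W : Type} [NormedAddCommGroup W] [NormedSpace ℝ W]
      {g : EuclideanSpace ℝ (Fin (k + 1)) → W} {w : EuclideanSpace ℝ (Fin (k + 1))}, 0 < w 0 →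
      ContDiffWithinAt ℝ ∞ g (halfSpace k) w →
      HasFDerivAt (halfDeriv g) (fderiv ℝ (halfDeriv g) w) w := by
    intro W _ _ g w hw hg
    have h1 : ContDiffAt ℝ 1 (fderiv ℝ g) w :=
      (hg.contDiffAt (halfSpace_mem_nhds hw)).fderiv_right (by norm_cast)
    exact ((h1.differentiableAt (by simp)).congr_of_eventuallyEq
      (halfDeriv_eventuallyEq g hw)).hasFDerivAt
  have hτd : HasFDerivAt (chartTrans k x z) (halfDeriv (chartTrans k x z) u) u :=
    (((contDiffWithinAt_chartTrans hu hzs).differentiableWithinAt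
      (by simp)).hasFDerivWithinAt).hasFDerivAt (halfSpace_mem_nhds hu0)
  have h1 : HasFDerivAt (halfDeriv f₁) (fderiv ℝ (halfDeriv f₁) v) v :=
    hdiff hv0 ((hF.immersedPatch z).contDiffWithinAt v hvd)
  have h2 : HasFDerivAt (halfDeriv (chartTrans k x z)) _ u :=
    hdiff hu0 (contDiffWithinAt_chartTrans hu hzs)
  have h3 := (h1.comp u hτd).clm_comp h2
  have h4 : halfDeriv (F ∘ chartInv k x) =ᶠ[𝓝 u] fun w =>
      (halfDeriv f₁ ∘ chartTrans k x z) w ∘L halfDeriv (chartTrans k x z) w := by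
    have h5 := eventually_chartInv_mem hu ((chartAt _ z).open_source.mem_nhds hzs)
    rw [nhdsWithin_eq_nhds.2 (halfSpace_mem_nhds hu0)] at h5
    filter_upwards [h5] with w hw
    exact halfDeriv_comp_chartTrans hF.contMDiff hw.1 hw.2
  have h6 := (h3.congr_of_eventuallyEq h4).fderiv
  have hν' : ν ∈ (halfDeriv f₁ v : EuclideanSpace ℝ (Fin (k + 1)) →ₗ[ℝ] _).rangeᗮ := by
    refine (Submodule.mem_orthogonal _ _).2 ?_
    rintro _ ⟨w, rfl⟩
    refine (Submodule.mem_orthogonal _ _).1 hν _ ⟨Φ.symm w, ?_⟩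
    rw [hL, ← hΦ]
    simp only [ContinuousLinearMap.coe_coe, ContinuousLinearMap.comp_apply,
      ContinuousLinearEquiv.coe_coe, ContinuousLinearEquiv.apply_symm_apply]
    rfl
  rw [hL, ← hΦ, hessTrace_comp hinj Φ (β := fderiv ℝ (halfDeriv f₁) v)]
  · rw [← inner_sum_gram_inv hinj _ hν']
    have h7 := hF.meanCurvature_eq_zero z
    have h8 : fderivWithin ℝ (fun y => fderivWithin ℝ f₁ (range (𝓡∂ (k + 1))) y)
        (range (𝓡∂ (k + 1))) v = fderiv ℝ (halfDeriv f₁) v := by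
      rw [range_model]
      exact fderivWithin_of_mem_nhds (halfSpace_mem_nhds hv0)
    have h9 : meanCurvatureVector (k + 1) F z = meanCurvatureOfParam f₁ (range (𝓡∂ (k + 1))) v :=
      rfl
    rw [h9, meanCurvatureOfParam, h8, range_model] at h7
    rw [show (_ : EuclideanSpace ℝ (Fin n)) = _ from h7, inner_zero_right]
  · intro a b
    rw [h6]
    have h10 : ∀ w, inner ℝ ν (halfDeriv f₁ v w) = 0 := fun w => by
      rw [real_inner_comm]
      exact (Submodule.mem_orthogonal _ _).1 hν' _ ⟨w, rfl⟩
    have hΦ' : ∀ w, halfDeriv (chartTrans k x z) u w = Φ w := fun w => by rw [← hΦ]; rfl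
    simp [inner_add_right, h10, hΦ', ← hv]

end Charts

/-! ### Patches up to the boundary as parametrisations with controlled first order error. -/

section Measures

variable {k : ℕ} {V : Type*} [NormedAddCommGroup V] [InnerProductSpace ℝ V]
  [FiniteDimensional ℝ V] {f : EuclideanSpace ℝ (Fin (k + 1)) → V}
  {T : Set (EuclideanSpace ℝ (Fin (k + 1)))}

/-- The intersection of a ball with the half-space is convex, so the mean value inequality gives
strict differentiability up to the boundary. -/
theorem ImmersedPatch.exists_approx (h : ImmersedPatch f T) {u : EuclideanSpace ℝ (Fin (k + 1))}
    (hu : u ∈ T) {ε : ℝ} (hε : 0 < ε) : ∃ r > 0, Metric.ball u r ∩ halfSpace k ⊆ T ∧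
      ∀ v ∈ Metric.ball u r ∩ halfSpace k, ∀ w ∈ Metric.ball u r ∩ halfSpace k,
        ‖f v - f w - halfDeriv f u (v - w)‖ ≤ ε * ‖v - w‖ := by
  have h1 : ∀ᶠ v in 𝓝[halfSpace k] u, v ∈ T ∧ ‖halfDeriv f v - halfDeriv f u‖ ≤ ε := by
    have h2 := (h.continuousWithinAt_deriv hu).eventually
      (Metric.closedBall_mem_nhds (halfDeriv f u) hε)
    filter_upwards [h.mem_nhdsWithin u hu, h2] with v hv hv2
    exact ⟨hv, by simpa [dist_eq_norm] using hv2⟩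
  obtain ⟨r, hr, hr'⟩ := Metric.mem_nhdsWithin_iff.1 h1
  refine ⟨r, hr, fun v hv => (hr' hv).1, fun v hv w hw => ?_⟩
  refine Convex.norm_image_sub_le_of_norm_hasFDerivWithin_le'
    (s := Metric.ball u r ∩ halfSpace k) (f' := halfDeriv f)
    (fun x hx => (h.hasFDerivWithinAt (hr' hx).1).mono inter_subset_right)
    (fun x hx => (hr' hx).2) ((convex_ball u r).inter convex_halfSpace) hw hv

theorem ImmersedPatch.immersedOn (h : ImmersedPatch f T) : ImmersedOn f (halfDeriv f) T where
  approx := fun u hu ε hε => by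
    obtain ⟨r, hr, -, hr'⟩ := h.exists_approx hu hε
    refine ⟨Metric.ball u r ∩ halfSpace k, ?_, hr'⟩
    exact nhdsWithin_mono _ h.subset (inter_comm _ _ ▸
      inter_mem self_mem_nhdsWithin (mem_nhdsWithin_of_mem_nhds (Metric.ball_mem_nhds u hr)))
  continuousOn := fun u hu => (h.continuousWithinAt_deriv hu).mono h.subset
  injective := h.injective

theorem boundaryIncl_mem_halfSpace (w : EuclideanSpace ℝ (Fin k)) :
    boundaryIncl k w ∈ halfSpace k :=
  le_of_eq (boundaryIncl_zero w).symm

theorem ImmersedPatch.immersedOn_boundary (h : ImmersedPatch f T) :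
    ImmersedOn (f ∘ boundaryIncl k) (fun w => halfDeriv f (boundaryIncl k w) ∘L boundaryIncl k)
      (boundaryIncl k ⁻¹' T) where
  approx := fun w hw ε hε => by
    obtain ⟨C, hC, hC'⟩ := (boundaryIncl k).bound
    obtain ⟨r, hr, -, hr'⟩ := h.exists_approx hw (ε := ε / C) (by positivity)
    refine ⟨boundaryIncl k ⁻¹' Metric.ball (boundaryIncl k w) r, mem_nhdsWithin_of_mem_nhds
      ((boundaryIncl k).continuous.continuousAt (Metric.ball_mem_nhds _ hr)), fun a ha b hb => ?_⟩
    have h1 := hr' _ ⟨ha, boundaryIncl_mem_halfSpace a⟩ _ ⟨hb, boundaryIncl_mem_halfSpace b⟩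
    rw [← map_sub] at h1
    refine h1.trans ?_
    calc ε / C * ‖boundaryIncl k (a - b)‖ ≤ ε / C * (C * ‖a - b‖) := by gcongr; exact hC' _
      _ = _ := by field_simp
  continuousOn := fun w hw => by
    have h1 : ContinuousWithinAt (fun w => halfDeriv f (boundaryIncl k w))
        (boundaryIncl k ⁻¹' T) w :=
      (h.continuousWithinAt_deriv hw).comp (boundaryIncl k).continuous.continuousWithinAt
        fun a _ => boundaryIncl_mem_halfSpace a
    exact h1.clm_comp continuousWithinAt_const
  injective := fun w hw => (h.injective _ hw).comp boundaryIncl_injective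

section General

variable {U : Type*} [NormedAddCommGroup U] [InnerProductSpace ℝ U] [FiniteDimensional ℝ U]
  [MeasurableSpace U] [BorelSpace U] [MeasurableSpace V] [BorelSpace V]
  {M : Type*} [TopologicalSpace M] [PolishSpace M] [MeasurableSpace M] [BorelSpace M]
  {F : M → V} {ψ : U → M} {f' : U → U →L[ℝ] V} {s : Set U}

theorem fiberMeasure_image_lt_top (hF : Continuous F) (hinj : ∀ x, ∃ N ∈ 𝓝 x, InjOn F N)
    (hs : MeasurableSet s) (hψ : ContinuousOn ψ s) (hψi : InjOn ψ s)
    (h : ImmersedOn (F ∘ ψ) f' s) {B : Set U} (hB : IsCompact B) (hBs : B ⊆ s) :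
    fiberMeasure F μHE[finrank ℝ U] (ψ '' B) < (⊤ : ℝ≥0∞) := by
  rw [fiberMeasure_image hF hinj hs hψ hψi h hB.measurableSet hBs]
  exact ((h.continuousOn_normDet.mono hBs).integrableOn_compact hB).lintegral_lt_top

theorem fiberMeasure_image_pos (hF : Continuous F) (hinj : ∀ x, ∃ N ∈ 𝓝 x, InjOn F N)
    (hs : MeasurableSet s) (hψ : ContinuousOn ψ s) (hψi : InjOn ψ s)
    (h : ImmersedOn (F ∘ ψ) f' s) {B : Set U} (hBo : IsOpen B) (hBne : B.Nonempty) (hBs : B ⊆ s) :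
    0 < fiberMeasure F μHE[finrank ℝ U] (ψ '' B) := by
  rw [fiberMeasure_image hF hinj hs hψ hψi h hBo.measurableSet hBs]
  refine pos_iff_ne_zero.2 fun h0 => ?_
  have hae : AEMeasurable (fun v => ENNReal.ofReal (f' v : U →ₗ[ℝ] V).normDet)
      (volume.restrict B) := (ENNReal.continuous_ofReal.comp_continuousOn
    (h.continuousOn_normDet.mono hBs)).aemeasurable hBo.measurableSet
  rw [lintegral_eq_zero_iff' hae, EventuallyEq,
    ae_restrict_iff' hBo.measurableSet] at h0
  refine (hBo.measure_pos volume hBne).ne' ?_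
  rw [measure_eq_zero_iff_ae_notMem]
  filter_upwards [h0] with u hu huB
  have h1 := hu huB
  rw [Pi.zero_apply, ENNReal.ofReal_eq_zero] at h1
  exact (h.normDet_pos (hBs huB)).not_ge h1

theorem setIntegral_fiberMeasure_image (hF : Continuous F)
    (hinj : ∀ x, ∃ N ∈ 𝓝 x, InjOn F N)
    (hs : MeasurableSet s) (hψ : ContinuousOn ψ s) (hψi : InjOn ψ s)
    (h : ImmersedOn (F ∘ ψ) f' s) {g : M → ℝ} (hg : Continuous g) :
    ∫ z in ψ '' s, g z ∂(fiberMeasure F μHE[finrank ℝ U]) =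
      ∫ u in s, (f' u : U →ₗ[ℝ] V).normDet * g (ψ u) := by
  have hψm : AEMeasurable ψ (volume.restrict s) := hψ.aemeasurable hs
  rw [fiberMeasure_restrict_image hF hinj hs hψ hψi h,
    integral_map (hψm.mono_ac (withDensity_absolutelyContinuous _ _)) hg.aestronglyMeasurable,
    integral_withDensity_eq_integral_toReal_smul₀]
  · refine integral_congr_ae (Eventually.of_forall fun u => ?_)
    simp [ENNReal.toReal_ofReal (LinearMap.normDet_nonneg _)]
  · exact (ENNReal.continuous_ofReal.comp_continuousOn h.continuousOn_normDet).aemeasurable hs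
  · exact Eventually.of_forall fun u => ENNReal.ofReal_lt_top

end General

end Measures

/-! ### Volume and boundary measure on the manifold. -/

section ManifoldMeasures

variable {k n : ℕ} {M : Type*} [TopologicalSpace M]
  [ChartedSpace (EuclideanHalfSpace (k + 1)) M] [IsManifold (𝓡∂ (k + 1)) ∞ M]
  {F : M → EuclideanSpace ℝ (Fin n)}

theorem measurableSet_chartDom (x : M) : MeasurableSet (chartDom (k := k) x) := by
  rw [chartDom, extChartAt_target]
  exact (((𝓡∂ (k + 1)).continuous_symm.isOpen_preimage _ (chartAt _ x).open_target).measurableSet).inter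
    (range_model (k := k) ▸ isClosed_halfSpace.measurableSet)

theorem _root_.IsMinimalImmersion.exists_injOn_nhds (hF : IsMinimalImmersion (k + 1) F) (z : M) :
    ∃ N ∈ 𝓝 z, InjOn F N := by
  have hzs := mem_chart_source (EuclideanHalfSpace (k + 1)) z
  have hu : extChartAt (𝓡∂ (k + 1)) z z ∈ chartDom z := extChartAt_mem_chartDom hzs
  obtain ⟨N, hN, hi, -⟩ := (hF.immersedPatch z).immersedOn.exists_nhds hu one_lt_two
  have hN' : N ∈ 𝓝[halfSpace k] (extChartAt (𝓡∂ (k + 1)) z z) :=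
    nhdsWithin_le_of_mem (chartDom_mem_nhdsWithin z hu) hN
  rw [← range_model, ← map_extChartAt_nhds z] at hN'
  refine ⟨_, inter_mem hN' ((chartAt (EuclideanHalfSpace (k + 1)) z).open_source.mem_nhds hzs),
    fun a ha b hb hab => ?_⟩
  have h1 := hi ha.1 hb.1 (by
    simp only [Function.comp_apply]
    rw [chartInv_extChartAt ha.2, chartInv_extChartAt hb.2, hab])
  rw [← chartInv_extChartAt (k := k) ha.2, h1, chartInv_extChartAt hb.2]

variable [PolishSpace M] [MeasurableSpace M] [BorelSpace M]

/-- The volume measure of an immersion. -/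
noncomputable def volMeasure (k : ℕ) (F : M → EuclideanSpace ℝ (Fin n)) : Measure M :=
  fiberMeasure F μHE[k + 1]

/-- The boundary measure of an immersion. -/
noncomputable def bdMeasure (k : ℕ) [ChartedSpace (EuclideanHalfSpace (k + 1)) M]
    (F : M → EuclideanSpace ℝ (Fin n)) : Measure M :=
  (fiberMeasure F μHE[k]).restrict ((𝓡∂ (k + 1)).boundary M)

theorem isClosed_boundary : IsClosed ((𝓡∂ (k + 1)).boundary M) :=
  (𝓡∂ (k + 1)).isClosed_boundary (n := ∞) (by simp)

/-- Turns |∂M| into the total mass of a measure on M, against which functions on M can be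
integrated. -/
theorem _root_.IsMinimalImmersion.boundaryMeasure_eq (hF : IsMinimalImmersion (k + 1) F) :
    boundaryMeasure (k + 1) F = bdMeasure k F univ := by
  rw [bdMeasure, Measure.restrict_apply_univ,
    fiberMeasure_apply hF.contMDiff.continuous hF.exists_injOn_nhds _
      isClosed_boundary.measurableSet]
  rfl

theorem chartInv_boundaryIncl_image_inter (x : M) (s : Set M) :
    (chartInv k x ∘ boundaryIncl k) '' (boundaryIncl k ⁻¹' (chartDom x ∩ chartInv k x ⁻¹' s)) =
      s ∩ (chartAt (EuclideanHalfSpace (k + 1)) x).source ∩ (𝓡∂ (k + 1)).boundary M := by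
  refine Subset.antisymm ?_ fun z hz => ?_
  · rintro _ ⟨w, hw, rfl⟩
    exact ⟨⟨hw.2, chartInv_mem_source hw.1⟩,
      (mem_boundary_chartInv_iff hw.1).2 (boundaryIncl_zero w)⟩
  · have hu := extChartAt_mem_chartDom hz.1.2
    have h0 := chartInv_extChartAt hz.1.2
    have h1 := hz.2
    rw [← h0, mem_boundary_chartInv_iff hu] at h1
    have h2 : extChartAt (𝓡∂ (k + 1)) x z ∈ range (boundaryIncl k) := range_boundaryIncl ▸ h1
    obtain ⟨w, hw⟩ := h2
    refine ⟨w, ⟨hw ▸ hu, ?_⟩, ?_⟩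
    · simp only [mem_preimage, hw, h0, hz.1.1]
    · simp only [Function.comp_apply, hw, h0]

theorem integral_volMeasure_of_support (hF : IsMinimalImmersion (k + 1) F) (x : M) {g : M → ℝ}
    (hg : Continuous g)
    (hg0 : ∀ z, z ∉ (chartAt (EuclideanHalfSpace (k + 1)) x).source → g z = 0) :
    ∫ z, g z ∂(volMeasure k F) = ∫ u in chartDom x,
      jac (halfDeriv (F ∘ chartInv k x) u) * g (chartInv k x u) := by
  have h := setIntegral_fiberMeasure_image hF.contMDiff.continuous hF.exists_injOn_nhds
    (measurableSet_chartDom x) (continuousOn_chartInv x) (injOn_chartInv x)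
    (hF.immersedPatch x).immersedOn hg
  rw [← h, image_chartInv, finrank_euclideanSpace_fin]
  exact (setIntegral_eq_integral_of_forall_compl_eq_zero hg0).symm

theorem measurableSet_preimage_boundaryIncl {s : Set (EuclideanSpace ℝ (Fin (k + 1)))}
    (hs : MeasurableSet s) : MeasurableSet (boundaryIncl k ⁻¹' s) :=
  (boundaryIncl k).continuous.measurable hs

theorem integral_bdMeasure_of_support (hF : IsMinimalImmersion (k + 1) F) (x : M) {g : M → ℝ}
    (hg : Continuous g)
    (hg0 : ∀ z, z ∉ (chartAt (EuclideanHalfSpace (k + 1)) x).source → g z = 0) :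
    ∫ z, g z ∂(bdMeasure k F) = ∫ w in boundaryIncl k ⁻¹' chartDom x,
      jac (halfDeriv (F ∘ chartInv k x) (boundaryIncl k w) ∘L boundaryIncl k) *
        g (chartInv k x (boundaryIncl k w)) := by
  have h := setIntegral_fiberMeasure_image (ψ := chartInv k x ∘ boundaryIncl k)
    hF.contMDiff.continuous hF.exists_injOn_nhds
    (measurableSet_preimage_boundaryIncl (measurableSet_chartDom x))
    ((continuousOn_chartInv x).comp (boundaryIncl k).continuous.continuousOn fun w hw => hw)
    ((injOn_chartInv x).comp boundaryIncl_injective.injOn fun w hw => hw)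
    (hF.immersedPatch x).immersedOn_boundary hg
  have h1 := chartInv_boundaryIncl_image_inter (k := k) x univ
  simp only [preimage_univ, inter_univ, univ_inter] at h1
  have h2 : ∫ z, g z ∂(bdMeasure k F) =
      ∫ z in (chartAt (EuclideanHalfSpace (k + 1)) x).source, g z ∂(bdMeasure k F) :=
    (setIntegral_eq_integral_of_forall_compl_eq_zero hg0).symm
  rw [h2, bdMeasure, Measure.restrict_restrict
    (chartAt (EuclideanHalfSpace (k + 1)) x).open_source.measurableSet, ← h1]
  rw [finrank_euclideanSpace_fin] at h
  exact h

theorem exists_compact_nhds_chartDom (z : M) :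
    ∃ B ⊆ chartDom (k := k) z, IsCompact B ∧ chartInv k z '' B ∈ 𝓝 z := by
  have hzs := mem_chart_source (EuclideanHalfSpace (k + 1)) z
  have hu : extChartAt (𝓡∂ (k + 1)) z z ∈ chartDom z := extChartAt_mem_chartDom hzs
  obtain ⟨r, hr, hrT⟩ := Metric.mem_nhdsWithin_iff.1 (chartDom_mem_nhdsWithin z hu)
  refine ⟨Metric.closedBall (extChartAt (𝓡∂ (k + 1)) z z) (r / 2) ∩ halfSpace k,
    fun v hv => hrT ⟨Metric.closedBall_subset_ball (by linarith) hv.1, hv.2⟩,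
    (isCompact_closedBall _ _).inter_right isClosed_halfSpace, ?_⟩
  rw [← map_extChartAt_symm_nhdsWithin_range (I := 𝓡∂ (k + 1)) z, range_model]
  refine image_mem_map ?_
  exact inter_mem (mem_nhdsWithin_of_mem_nhds (Metric.closedBall_mem_nhds _ (by linarith)))
    self_mem_nhdsWithin

theorem isFiniteMeasure_volMeasure [CompactSpace M] (hF : IsMinimalImmersion (k + 1) F) :
    IsFiniteMeasure (volMeasure k F) := by
  have : IsLocallyFiniteMeasure (volMeasure k F) := by
    refine ⟨fun z => ?_⟩
    obtain ⟨B, hB, hBc, hBn⟩ := exists_compact_nhds_chartDom (k := k) z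
    refine ⟨_, hBn, ?_⟩
    have := fiberMeasure_image_lt_top hF.contMDiff.continuous hF.exists_injOn_nhds
      (measurableSet_chartDom z) (continuousOn_chartInv z) (injOn_chartInv z)
      (hF.immersedPatch z).immersedOn hBc hB
    rwa [finrank_euclideanSpace_fin] at this
  infer_instance

theorem isFiniteMeasure_bdMeasure [CompactSpace M] (hF : IsMinimalImmersion (k + 1) F) :
    IsFiniteMeasure (bdMeasure k F) := by
  have : IsLocallyFiniteMeasure (bdMeasure k F) := by
    refine ⟨fun z => ?_⟩
    obtain ⟨B, hB, hBc, hBn⟩ := exists_compact_nhds_chartDom (k := k) z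
    refine ⟨_, hBn, ?_⟩
    have hcomp : IsCompact (boundaryIncl k ⁻¹' B) :=
      ((boundaryIncl k).toLinearMap.isClosedEmbedding_of_injective
        (LinearMap.ker_eq_bot.2 boundaryIncl_injective)).isCompact_preimage hBc
    have := fiberMeasure_image_lt_top (ψ := chartInv k z ∘ boundaryIncl k)
      hF.contMDiff.continuous hF.exists_injOn_nhds
      (measurableSet_preimage_boundaryIncl (measurableSet_chartDom z))
      ((continuousOn_chartInv z).comp (boundaryIncl k).continuous.continuousOn fun w hw => hw)
      ((injOn_chartInv z).comp boundaryIncl_injective.injOn fun w hw => hw)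
      (hF.immersedPatch z).immersedOn_boundary hcomp (preimage_mono hB)
    rw [finrank_euclideanSpace_fin] at this
    rw [bdMeasure, Measure.restrict_apply' isClosed_boundary.measurableSet]
    refine lt_of_le_of_lt (measure_mono ?_) this
    rintro _ ⟨⟨u, hu, rfl⟩, hb⟩
    rw [mem_boundary_chartInv_iff (hB hu)] at hb
    obtain ⟨w, rfl⟩ : u ∈ range (boundaryIncl k) := range_boundaryIncl ▸ hb
    exact ⟨w, hu, rfl⟩
  infer_instance

theorem isOpenPosMeasure_volMeasure (hF : IsMinimalImmersion (k + 1) F) :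
    (volMeasure k F).IsOpenPosMeasure := by
  refine ⟨fun O hO ⟨z, hz⟩ => ne_of_gt ?_⟩
  have hzs := mem_chart_source (EuclideanHalfSpace (k + 1)) z
  set u := extChartAt (𝓡∂ (k + 1)) z z with hu'
  have hu : u ∈ chartDom z := extChartAt_mem_chartDom hzs
  have hzu : chartInv k z u = z := chartInv_extChartAt hzs
  obtain ⟨r, hr, hrT⟩ := Metric.mem_nhdsWithin_iff.1
    (eventually_chartInv_mem hu (hO.mem_nhds (by rwa [hzu])))
  have hBT : Metric.ball u r ∩ {v | 0 < v 0} ⊆ Metric.ball u r ∩ halfSpace k :=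
    inter_subset_inter_right _ fun v hv => le_of_lt (b := v 0) hv
  have hBo : IsOpen (Metric.ball u r ∩ {v : EuclideanSpace ℝ (Fin (k + 1)) | 0 < v 0}) :=
    Metric.isOpen_ball.inter (isOpen_lt continuous_const (PiLp.continuous_apply 2 _ 0))
  have hBne : (Metric.ball u r ∩ {v : EuclideanSpace ℝ (Fin (k + 1)) | 0 < v 0}).Nonempty := by
    -- The point u may lie on the boundary hyperplane; half a radius inward it no longer does.
    refine ⟨u + (r / 2) • EuclideanSpace.single 0 1, ?_, ?_⟩
    · simp [norm_smul, abs_of_pos hr]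
      linarith
    · have : 0 ≤ u 0 := chartDom_subset z hu
      simp
      linarith
  have := fiberMeasure_image_pos hF.contMDiff.continuous hF.exists_injOn_nhds
    (measurableSet_chartDom z) (continuousOn_chartInv z) (injOn_chartInv z)
    (hF.immersedPatch z).immersedOn hBo hBne fun v hv => (hrT (hBT hv)).1
  rw [finrank_euclideanSpace_fin] at this
  refine this.trans_le (measure_mono ?_)
  rintro _ ⟨v, hv, rfl⟩
  exact (hrT (hBT hv)).2

/-- Serves to promote an almost everywhere identity on the boundary to one at every boundary point.
-/
theorem bdMeasure_pos_of_isOpen (hF : IsMinimalImmersion (k + 1) F) {O : Set M} (hO : IsOpen O)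
    {z : M} (hzO : z ∈ O) (hz : z ∈ (𝓡∂ (k + 1)).boundary M) : 0 < bdMeasure k F O := by
  have hzs := mem_chart_source (EuclideanHalfSpace (k + 1)) z
  set u := extChartAt (𝓡∂ (k + 1)) z z with hu'
  have hu : u ∈ chartDom z := extChartAt_mem_chartDom hzs
  have hzu : chartInv k z u = z := chartInv_extChartAt hzs
  obtain ⟨r, hr, hrT⟩ := Metric.mem_nhdsWithin_iff.1
    (eventually_chartInv_mem hu (hO.mem_nhds (by rwa [hzu])))
  rw [← hzu, mem_boundary_chartInv_iff hu] at hz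
  obtain ⟨w, hw⟩ : u ∈ range (boundaryIncl k) := range_boundaryIncl ▸ hz
  have hsub : ∀ v ∈ boundaryIncl k ⁻¹' Metric.ball u r, boundaryIncl k v ∈ chartDom z ∧
      chartInv k z (boundaryIncl k v) ∈ O :=
    fun v hv => hrT ⟨hv, boundaryIncl_mem_halfSpace v⟩
  have := fiberMeasure_image_pos (ψ := chartInv k z ∘ boundaryIncl k)
    hF.contMDiff.continuous hF.exists_injOn_nhds
    (measurableSet_preimage_boundaryIncl (measurableSet_chartDom z))
    ((continuousOn_chartInv z).comp (boundaryIncl k).continuous.continuousOn fun w hw => hw)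
    ((injOn_chartInv z).comp boundaryIncl_injective.injOn fun w hw => hw)
    (hF.immersedPatch z).immersedOn_boundary
    (Metric.isOpen_ball.preimage (boundaryIncl k).continuous)
    ⟨w, by simp [hw, hr]⟩ fun v hv => (hsub v hv).1
  rw [finrank_euclideanSpace_fin] at this
  rw [bdMeasure, Measure.restrict_apply' isClosed_boundary.measurableSet]
  refine this.trans_le (measure_mono ?_)
  rintro _ ⟨v, hv, rfl⟩
  exact ⟨(hsub v hv).2, (mem_boundary_chartInv_iff (hsub v hv).1).2 (boundaryIncl_zero v)⟩

end ManifoldMeasures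

/-! ### Pseudo-inverses under reparametrisation. -/

section Pinv

variable {U V : Type*} [NormedAddCommGroup U] [InnerProductSpace ℝ U] [FiniteDimensional ℝ U]
  [NormedAddCommGroup V] [InnerProductSpace ℝ V] [FiniteDimensional ℝ V] {L : U →L[ℝ] V}

theorem range_comp_equiv (L : U →L[ℝ] V) (Φ : U ≃L[ℝ] U) :
    ((L ∘L (Φ : U →L[ℝ] U) : U →L[ℝ] V) : U →ₗ[ℝ] V).range = (L : U →ₗ[ℝ] V).range := by
  ext y
  constructor
  · rintro ⟨v, rfl⟩
    exact ⟨Φ v, rfl⟩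
  · rintro ⟨v, rfl⟩
    exact ⟨Φ.symm v, by simp⟩

/-- Applied to either side, L gives the orthogonal projection of x to its range, and Φ does not
change the range. -/
theorem apply_pinv_comp_equiv (hL : Function.Injective L) (Φ : U ≃L[ℝ] U) (x : V) :
    Φ (pinv (L ∘L (Φ : U →L[ℝ] U)) x) = pinv L x := by
  have hL' : Function.Injective (L ∘L (Φ : U →L[ℝ] U)) := hL.comp Φ.injective
  apply hL
  have h1 := sub_map_pinv_mem_orthogonal hL' x
  rw [range_comp_equiv] at h1
  rw [map_pinv_eq_starProjection hL]
  exact (Submodule.eq_starProjection_of_mem_orthogonal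
    (LinearMap.mem_range_self (L : U →ₗ[ℝ] V) _) h1).symm

theorem comp_pinv_comp_equiv (hL : Function.Injective L) (Φ : U ≃L[ℝ] U) :
    (L ∘L (Φ : U →L[ℝ] U)) ∘L pinv (L ∘L (Φ : U →L[ℝ] U)) = L ∘L pinv L := by
  ext1 x
  simp only [ContinuousLinearMap.comp_apply, ContinuousLinearEquiv.coe_coe]
  rw [apply_pinv_comp_equiv hL]

end Pinv

/-! ### Chart independent quantities and the divergence inequality on a compact manifold. -/

section Global

variable {k n : ℕ} {M : Type*} [TopologicalSpace M]
  [ChartedSpace (EuclideanHalfSpace (k + 1)) M]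
  {F : M → EuclideanSpace ℝ (Fin n)}

theorem continuous_of_comp_chartInv {W : Type*} [TopologicalSpace W] {g : M → W}
    (hg : ∀ x, ∀ u ∈ chartDom (k := k) x, ContinuousWithinAt (g ∘ chartInv k x) (halfSpace k) u) :
    Continuous g := by
  refine continuous_iff_continuousAt.2 fun z => ?_
  have hzs := mem_chart_source (EuclideanHalfSpace (k + 1)) z
  have h1 := hg z _ (extChartAt_mem_chartDom hzs)
  have h2 : Tendsto (extChartAt (𝓡∂ (k + 1)) z) (𝓝 z)
      (𝓝[halfSpace k] (extChartAt (𝓡∂ (k + 1)) z z)) := by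
    rw [← range_model, ← map_extChartAt_nhds z]
    exact tendsto_map
  have h3 := h1.tendsto.comp h2
  rw [Function.comp_apply, chartInv_extChartAt hzs] at h3
  refine h3.congr' ?_
  filter_upwards [(chartAt (EuclideanHalfSpace (k + 1)) z).open_source.mem_nhds hzs] with y hy
  simp only [Function.comp_apply, chartInv_extChartAt hy]

/-- The derivative of a map on a manifold, in the preferred chart at the point. -/
noncomputable def chartDeriv (k : ℕ) {M : Type*} [TopologicalSpace M]
    [ChartedSpace (EuclideanHalfSpace (k + 1)) M] {W : Type*} [NormedAddCommGroup W]
    [NormedSpace ℝ W] (g : M → W) (z : M) : EuclideanSpace ℝ (Fin (k + 1)) →L[ℝ] W :=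
  halfDeriv (g ∘ chartInv k z) (extChartAt (𝓡∂ (k + 1)) z z)

/-- The orthogonal projection to the tangent space of an immersion. -/
noncomputable def tangentProj (k : ℕ) {M : Type*} [TopologicalSpace M]
    [ChartedSpace (EuclideanHalfSpace (k + 1)) M] (F : M → EuclideanSpace ℝ (Fin n)) (z : M) :
    EuclideanSpace ℝ (Fin n) →L[ℝ] EuclideanSpace ℝ (Fin n) :=
  chartDeriv k F z ∘L pinv (chartDeriv k F z)

/-- The derivative of a function along the tangential part of an ambient field. -/
noncomputable def tangentialDeriv (k : ℕ) {M : Type*} [TopologicalSpace M]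
    [ChartedSpace (EuclideanHalfSpace (k + 1)) M] (F : M → EuclideanSpace ℝ (Fin n))
    (g : M → ℝ) (X : EuclideanSpace ℝ (Fin n) → EuclideanSpace ℝ (Fin n)) (z : M) : ℝ :=
  chartDeriv k g z (pinv (chartDeriv k F z) (X (F z)))

/-- The divergence of an ambient field along an immersion. -/
noncomputable def tangentialDiv (k : ℕ) {M : Type*} [TopologicalSpace M]
    [ChartedSpace (EuclideanHalfSpace (k + 1)) M] (F : M → EuclideanSpace ℝ (Fin n))
    (X : EuclideanSpace ℝ (Fin n) → EuclideanSpace ℝ (Fin n)) (z : M) : ℝ :=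
  LinearMap.trace ℝ (EuclideanSpace ℝ (Fin n))
    (tangentProj k F z ∘L fderiv ℝ X (F z) :
      EuclideanSpace ℝ (Fin n) →L[ℝ] EuclideanSpace ℝ (Fin n))

variable [IsManifold (𝓡∂ (k + 1)) ∞ M]

theorem _root_.IsMinimalImmersion.injective_chartDeriv (hF : IsMinimalImmersion (k + 1) F)
    (z : M) : Function.Injective (chartDeriv k F z) :=
  (hF.immersedPatch z).injective _ (extChartAt_mem_chartDom (mem_chart_source _ z))

/-- One Φ serves all maps g at once, in particular F and the cutoffs, so it cancels in expressions
such as the derivative of g along the tangential part of a field. -/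
theorem exists_halfDeriv_eq_chartDeriv_comp {x : M} {u : EuclideanSpace ℝ (Fin (k + 1))}
    (hu : u ∈ chartDom x) :
    ∃ Φ : EuclideanSpace ℝ (Fin (k + 1)) ≃L[ℝ] EuclideanSpace ℝ (Fin (k + 1)),
      ∀ {W : Type} [NormedAddCommGroup W] [NormedSpace ℝ W] {g : M → W},
        ContMDiff (𝓡∂ (k + 1)) 𝓘(ℝ, W) ∞ g →
        halfDeriv (g ∘ chartInv k x) u = chartDeriv k g (chartInv k x u) ∘L
          (Φ : EuclideanSpace ℝ (Fin (k + 1)) →L[ℝ] EuclideanSpace ℝ (Fin (k + 1))) := by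
  have hzs := mem_chart_source (EuclideanHalfSpace (k + 1)) (chartInv k x u)
  obtain ⟨Φ, hΦ⟩ := exists_equiv_halfDeriv_chartTrans hu hzs
  refine ⟨Φ, fun {W} _ _ g hg => ?_⟩
  rw [hΦ, halfDeriv_comp_chartTrans hg hu hzs]
  rfl

theorem _root_.IsMinimalImmersion.tangentProj_chartInv (hF : IsMinimalImmersion (k + 1) F)
    {x : M} {u : EuclideanSpace ℝ (Fin (k + 1))} (hu : u ∈ chartDom x) :
    tangentProj k F (chartInv k x u) =
      halfDeriv (F ∘ chartInv k x) u ∘L pinv (halfDeriv (F ∘ chartInv k x) u) := by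
  obtain ⟨Φ, hΦ⟩ := exists_halfDeriv_eq_chartDeriv_comp (k := k) hu
  rw [hΦ hF.contMDiff, comp_pinv_comp_equiv (hF.injective_chartDeriv _), tangentProj]

theorem _root_.IsMinimalImmersion.range_chartDeriv_chartInv (hF : IsMinimalImmersion (k + 1) F)
    {x : M} {u : EuclideanSpace ℝ (Fin (k + 1))} (hu : u ∈ chartDom x) :
    (halfDeriv (F ∘ chartInv k x) u :
      EuclideanSpace ℝ (Fin (k + 1)) →ₗ[ℝ] EuclideanSpace ℝ (Fin n)).range =
      (chartDeriv k F (chartInv k x u) :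
        EuclideanSpace ℝ (Fin (k + 1)) →ₗ[ℝ] EuclideanSpace ℝ (Fin n)).range := by
  obtain ⟨Φ, hΦ⟩ := exists_halfDeriv_eq_chartDeriv_comp (k := k) hu
  rw [hΦ hF.contMDiff, range_comp_equiv]

theorem _root_.IsMinimalImmersion.tangentialDeriv_chartInv (hF : IsMinimalImmersion (k + 1) F)
    {g : M → ℝ} (hg : ContMDiff (𝓡∂ (k + 1)) 𝓘(ℝ, ℝ) ∞ g)
    (X : EuclideanSpace ℝ (Fin n) → EuclideanSpace ℝ (Fin n))
    {x : M} {u : EuclideanSpace ℝ (Fin (k + 1))} (hu : u ∈ chartDom x) :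
    tangentialDeriv k F g X (chartInv k x u) =
      halfDeriv (g ∘ chartInv k x) u
        (pinv (halfDeriv (F ∘ chartInv k x) u) (X (F (chartInv k x u)))) := by
  obtain ⟨Φ, hΦ⟩ := exists_halfDeriv_eq_chartDeriv_comp (k := k) hu
  rw [hΦ hF.contMDiff, hΦ hg, ContinuousLinearMap.comp_apply, ContinuousLinearEquiv.coe_coe,
    apply_pinv_comp_equiv (hF.injective_chartDeriv _), tangentialDeriv]

/-- The definition uses a chart that varies with the point; by invariance it agrees with the
expression in a single chart throughout the domain of that chart. -/
theorem _root_.IsMinimalImmersion.continuous_tangentProj (hF : IsMinimalImmersion (k + 1) F) :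
    Continuous (tangentProj k F) := by
  refine continuous_of_comp_chartInv (k := k) fun x u hu => ?_
  have h := hF.immersedPatch x
  refine ((h.continuousWithinAt_deriv hu).clm_comp (h.continuousWithinAt_pinv hu)).congr_of_eventuallyEq
    ?_ (hF.tangentProj_chartInv hu)
  filter_upwards [chartDom_mem_nhdsWithin x hu] with v hv using hF.tangentProj_chartInv hv

theorem continuous_trace {V : Type*} [NormedAddCommGroup V] [InnerProductSpace ℝ V]
    [FiniteDimensional ℝ V] :
    Continuous fun S : V →L[ℝ] V => LinearMap.trace ℝ V (S : V →ₗ[ℝ] V) :=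
  ((LinearMap.trace ℝ V) ∘ₗ (ContinuousLinearMap.coeLM ℝ)).continuous_of_finiteDimensional

variable {X : EuclideanSpace ℝ (Fin n) → EuclideanSpace ℝ (Fin n)}

theorem _root_.IsMinimalImmersion.continuous_tangentialDiv (hF : IsMinimalImmersion (k + 1) F)
    (hX : ContDiff ℝ ∞ X) : Continuous (tangentialDiv k F X) :=
  continuous_trace.comp (hF.continuous_tangentProj.clm_comp
    ((hX.continuous_fderiv (by simp)).comp hF.contMDiff.continuous))

theorem _root_.IsMinimalImmersion.continuous_tangentialDeriv (hF : IsMinimalImmersion (k + 1) F)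
    {g : M → ℝ} (hg : ContMDiff (𝓡∂ (k + 1)) 𝓘(ℝ, ℝ) ∞ g) (hX : Continuous X) :
    Continuous (tangentialDeriv k F g X) := by
  refine continuous_of_comp_chartInv (k := k) fun x u hu => ?_
  have h := hF.immersedPatch x
  have h1 : ContinuousWithinAt (fun v => halfDeriv (g ∘ chartInv k x) v
      (pinv (halfDeriv (F ∘ chartInv k x) v) (X (F (chartInv k x v))))) (halfSpace k) u :=
    (continuousWithinAt_halfDeriv (chartDom_subset x hu)
      (contDiffWithinAt_comp_chartInv hg hu)).clm_apply ((h.continuousWithinAt_pinv hu).clm_apply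
        (hX.continuousAt.comp_continuousWithinAt (h.continuousWithinAt hu)))
  refine h1.congr_of_eventuallyEq ?_ (hF.tangentialDeriv_chartInv hg X hu)
  filter_upwards [chartDom_mem_nhdsWithin x hu] with v hv using hF.tangentialDeriv_chartInv hg X hv

theorem continuousAt_conormal {L : EuclideanSpace ℝ (Fin (k + 1)) →L[ℝ] EuclideanSpace ℝ (Fin n)}
    (hL : Function.Injective L) : ContinuousAt conormal L := by
  obtain ⟨D, hD, -⟩ := hasFDerivAt_gramInv hL
  exact continuousAt_id.clm_apply (hD.continuousAt.clm_apply continuousAt_const)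

variable [PolishSpace M] [MeasurableSpace M] [BorelSpace M] [CompactSpace M]

/-- The local form of the divergence inequality. -/
theorem _root_.IsMinimalImmersion.integral_mul_tangentialDiv_le
    (hF : IsMinimalImmersion (k + 1) F) (hX : ContDiff ℝ ∞ X) {h : M → ℝ} (hh : Continuous h)
    (hb : ∀ x, ∀ u ∈ chartDom (k := k) x, u 0 = 0 →
      -inner ℝ (conormal (halfDeriv (F ∘ chartInv k x) u)) (X (F (chartInv k x u))) ≤
        h (chartInv k x u) * ‖conormal (halfDeriv (F ∘ chartInv k x) u)‖)
    {ρ : M → ℝ} (hρ : ContMDiff (𝓡∂ (k + 1)) 𝓘(ℝ, ℝ) ∞ ρ) (hρ0 : ∀ z, 0 ≤ ρ z) (x : M)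
    (hρx : tsupport ρ ⊆ (chartAt (EuclideanHalfSpace (k + 1)) x).source) :
    ∫ z, (tangentialDeriv k F ρ X z + ρ z * tangentialDiv k F X z) ∂(volMeasure k F) ≤
      ∫ z, ρ z * h z ∂(bdMeasure k F) := by
  classical
  set f := F ∘ chartInv k x with hf
  set T := chartDom (k := k) x with hT
  have hP := hF.immersedPatch x
  set K := extChartAt (𝓡∂ (k + 1)) x '' tsupport ρ with hK'
  have hK : IsCompact K := (isClosed_tsupport ρ).isCompact.image_of_continuousOn
    ((continuousOn_extChartAt x).mono (by rwa [extChartAt_source]))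
  have hKT : K ⊆ T := by
    rintro _ ⟨z, hz, rfl⟩
    exact extChartAt_mem_chartDom (hρx hz)
  -- The inverse chart is meaningful only on T, so the cutoff is extended by zero; its support lies
  -- in the compact set K inside T.
  set η : EuclideanSpace ℝ (Fin (k + 1)) → ℝ := T.indicator (ρ ∘ chartInv k x) with hη'
  have hηT : ∀ u ∈ T, η u = ρ (chartInv k x u) := fun u hu => indicator_of_mem hu _
  have hηK : ∀ u, u ∉ K → η u = 0 := by
    intro u hu
    by_cases huT : u ∈ T
    · rw [hηT u huT]
      by_contra h0
      exact hu ⟨_, subset_tsupport ρ h0, extChartAt_chartInv huT⟩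
    · exact indicator_of_notMem huT _
  have hηeq : ∀ u ∈ T, η =ᶠ[𝓝[halfSpace k] u] ρ ∘ chartInv k x := fun u hu => by
    filter_upwards [chartDom_mem_nhdsWithin x hu] with v hv using hηT v hv
  have hη : ∀ u ∈ T, ContDiffWithinAt ℝ ∞ η (halfSpace k) u := fun u hu =>
    (contDiffWithinAt_comp_chartInv hρ hu).congr_of_eventuallyEq (hηeq u hu) (hηT u hu)
  have hη'0 : ∀ u ∈ halfSpace k, u ∉ K → halfDeriv η u = 0 := by
    intro u hu huK
    have : η =ᶠ[𝓝[halfSpace k] u] fun _ => 0 := by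
      filter_upwards [mem_nhdsWithin_of_mem_nhds (hK.isClosed.isOpen_compl.mem_nhds huK)] with v hv
        using hηK v hv
    rw [halfDeriv, this.fderivWithin_eq (hηK u huK)]
    simp
  have key := hP.integral_divergence (hF.hasZeroMeanCurvatureOn x) hη hK hKT
    (fun u _ => hηK u) hX
  have hρz : ∀ z, z ∉ (chartAt (EuclideanHalfSpace (k + 1)) x).source → ρ =ᶠ[𝓝 z] 0 :=
    fun z hz => notMem_tsupport_iff_eventuallyEq.1 fun h1 => hz (hρx h1)
  have hderiv0 : ∀ z, z ∉ (chartAt (EuclideanHalfSpace (k + 1)) x).source →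
      tangentialDeriv k F ρ X z + ρ z * tangentialDiv k F X z = 0 := by
    intro z hz
    have h1 := hρz z hz
    have hzs := mem_chart_source (EuclideanHalfSpace (k + 1)) z
    have hu := extChartAt_mem_chartDom (k := k) hzs
    have h2 : ρ ∘ chartInv k z =ᶠ[𝓝[halfSpace k] (extChartAt (𝓡∂ (k + 1)) z z)] fun _ => 0 := by
      have := continuousWithinAt_chartInv hu
      rw [ContinuousWithinAt, chartInv_extChartAt hzs] at this
      exact this.eventually h1
    rw [tangentialDeriv, chartDeriv, halfDeriv, h2.fderivWithin_eq
      (h2.self_of_nhdsWithin (chartDom_subset z hu)), h1.eq_of_nhds]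
    simp
  have hLHS : ∫ z, (tangentialDeriv k F ρ X z + ρ z * tangentialDiv k F X z) ∂(volMeasure k F) =
      ∫ u in halfSpace k, jac (halfDeriv f u) *
        (halfDeriv η u (pinv (halfDeriv f u) (X (f u))) + η u *
          LinearMap.trace ℝ (EuclideanSpace ℝ (Fin n)) (halfDeriv f u ∘L pinv (halfDeriv f u) ∘L fderiv ℝ X (f u) :
            EuclideanSpace ℝ (Fin n) →L[ℝ] EuclideanSpace ℝ (Fin n))) := by
    rw [integral_volMeasure_of_support hF x
      (g := fun z => tangentialDeriv k F ρ X z + ρ z * tangentialDiv k F X z) ((hF.continuous_tangentialDeriv hρ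
      hX.continuous).add (hρ.continuous.mul (hF.continuous_tangentialDiv hX))) hderiv0]
    refine Eq.trans ?_ (setIntegral_eq_of_subset_of_forall_sdiff_eq_zero
      isClosed_halfSpace.measurableSet (chartDom_subset x) ?_).symm
    · refine setIntegral_congr_fun (measurableSet_chartDom x) fun u hu => ?_
      simp only
      rw [hF.tangentialDeriv_chartInv hρ X hu, tangentialDiv, hF.tangentProj_chartInv hu, hηT u hu,
        show halfDeriv η u = halfDeriv (ρ ∘ chartInv k x) u from
          (hηeq u hu).fderivWithin_eq (hηT u hu)]
      rfl
    · intro u hu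
      have huK : u ∉ K := fun h1 => hu.2 (hKT h1)
      rw [hη'0 u hu.1 huK, hηK u huK]
      simp
  rw [hLHS.trans key, ← integral_neg,
    integral_bdMeasure_of_support hF x (g := fun z => ρ z * h z) (hρ.continuous.mul hh)
    fun z hz => by rw [(hρz z hz).eq_of_nhds]; simp]
  set K' := boundaryIncl k ⁻¹' K with hK''
  have hK'c : IsCompact K' :=
    ((boundaryIncl k).toLinearMap.isClosedEmbedding_of_injective
      (LinearMap.ker_eq_bot.2 boundaryIncl_injective)).isCompact_preimage hK
  have hιc : ∀ {w} {W : Type} [TopologicalSpace W] {g : EuclideanSpace ℝ (Fin (k + 1)) → W},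
      ContinuousWithinAt g (halfSpace k) (boundaryIncl k w) →
      ContinuousAt (fun w => g (boundaryIncl k w)) w := fun {w} W _ g hg => by
    rw [← continuousWithinAt_univ]
    exact hg.comp (boundaryIncl k).continuous.continuousWithinAt
        fun a _ => boundaryIncl_mem_halfSpace a
  have hint : ∀ {g : EuclideanSpace ℝ (Fin k) → ℝ}, (∀ w ∈ K', ContinuousAt g w) →
      (∀ w ∉ K', g w = 0) → Integrable g := by
    intro g hg hg0
    have h0 : ContinuousOn g K' := fun w hw => (hg w hw).continuousWithinAt
    have h1 : IntegrableOn g K' := h0.integrableOn_compact hK'c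
    rw [← integrableOn_univ]
    exact h1.of_forall_sdiff_eq_zero MeasurableSet.univ fun w hw => hg0 w hw.2
  have hAc : ∀ w ∈ K', ContinuousAt (fun w => halfDeriv f (boundaryIncl k w)) w := fun w hw =>
    hιc (hP.continuousWithinAt_deriv (hKT hw))
  have hηc : ∀ w ∈ K', ContinuousAt (fun w => η (boundaryIncl k w)) w := fun w hw =>
    hιc (hη _ (hKT hw)).continuousWithinAt
  have hψc : ∀ w ∈ K', ContinuousAt (fun w => chartInv k x (boundaryIncl k w)) w := fun w hw => by
    rw [← continuousWithinAt_univ]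
    exact (continuousWithinAt_chartInv (hKT hw)).comp
      (boundaryIncl k).continuous.continuousWithinAt fun a _ => boundaryIncl_mem_halfSpace a
  have hcc : ∀ w ∈ K', ContinuousAt (fun w => conormal (halfDeriv f (boundaryIncl k w))) w :=
    fun w hw => ContinuousAt.comp (g := conormal)
      (f := fun w => halfDeriv f (boundaryIncl k w))
      (continuousAt_conormal (hP.injective _ (hKT hw))) (hAc w hw)
  have hJc : ∀ w ∈ K', ContinuousAt (fun w => jac (halfDeriv f (boundaryIncl k w))) w :=
    fun w hw => continuous_normDet.continuousAt.comp (hAc w hw)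
  -- The boundary area density is the volume density times the length of the conormal, which is the
  -- factor appearing in hb. Thus hb bounds the boundary flux without choosing a unit normal on the
  -- whole boundary.
  have hRHS : ∫ w in boundaryIncl k ⁻¹' T, jac (halfDeriv f (boundaryIncl k w) ∘L boundaryIncl k) *
        (ρ (chartInv k x (boundaryIncl k w)) * h (chartInv k x (boundaryIncl k w))) =
      ∫ w, η (boundaryIncl k w) * (jac (halfDeriv f (boundaryIncl k w)) *
        (h (chartInv k x (boundaryIncl k w)) * ‖conormal (halfDeriv f (boundaryIncl k w))‖)) := by
    refine Eq.trans ?_ (setIntegral_eq_integral_of_forall_compl_eq_zero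
      (s := boundaryIncl k ⁻¹' T) ?_)
    · refine setIntegral_congr_fun (measurableSet_preimage_boundaryIncl (measurableSet_chartDom x))
        fun w hw => ?_
      simp only
      rw [hηT _ hw, jac, normDet_comp_boundaryIncl (hP.injective _ hw)]
      ring
    · intro w hw
      rw [hηK _ fun h1 => hw (hKT h1), zero_mul]
  rw [hRHS]
  refine integral_mono (hint ?_ ?_) (hint ?_ ?_) fun w => ?_
  · exact fun w hw => ((hηc w hw).mul ((hJc w hw).mul ((hcc w hw).inner (𝕜 := ℝ)
      (hX.continuous.continuousAt.comp (hF.contMDiff.continuous.continuousAt.comp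
        (hψc w hw)))))).neg
  · intro w hw
    rw [hηK _ hw, zero_mul, neg_zero]
  · exact fun w hw => (hηc w hw).mul ((hJc w hw).mul
      ((hh.continuousAt.comp (hψc w hw)).mul (hcc w hw).norm))
  · intro w hw
    rw [hηK _ hw, zero_mul]
  · by_cases hw : boundaryIncl k w ∈ T
    · simp only
      rw [← mul_neg, ← mul_neg]
      refine mul_le_mul_of_nonneg_left (mul_le_mul_of_nonneg_left
        (hb x _ hw (boundaryIncl_zero w)) (LinearMap.normDet_nonneg _)) ?_
      rw [hηT _ hw]
      exact hρ0 _
    · simp only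
      rw [hηK _ fun h1 => hw (hKT h1)]
      simp

/-- The divergence inequality for an ambient field along a compact minimal immersion. -/
theorem _root_.IsMinimalImmersion.integral_tangentialDiv_le
    (hF : IsMinimalImmersion (k + 1) F) (hX : ContDiff ℝ ∞ X) {h : M → ℝ} (hh : Continuous h)
    (hb : ∀ x, ∀ u ∈ chartDom (k := k) x, u 0 = 0 →
      -inner ℝ (conormal (halfDeriv (F ∘ chartInv k x) u)) (X (F (chartInv k x u))) ≤
        h (chartInv k x u) * ‖conormal (halfDeriv (F ∘ chartInv k x) u)‖) :
    ∫ z, tangentialDiv k F X z ∂(volMeasure k F) ≤ ∫ z, h z ∂(bdMeasure k F) := by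
  classical
  have := isFiniteMeasure_volMeasure hF
  have := isFiniteMeasure_bdMeasure hF
  obtain ⟨ρ, hρ⟩ := SmoothPartitionOfUnity.exists_isSubordinate_chartAt_source (𝓡∂ (k + 1)) M
  have hfin : {i | (Function.support (ρ i)).Nonempty}.Finite :=
    ρ.locallyFinite.finite_nonempty_of_compact
  set S := hfin.toFinset with hS
  have hsum : ∀ z, ∑ i ∈ S, ρ i z = 1 := by
    intro z
    rw [← ρ.sum_eq_one (mem_univ z)]
    refine (finsum_eq_sum_of_support_subset _ fun i hi => ?_).symm
    simp only [hS, Finite.coe_toFinset, Set.mem_ofPred_eq]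
    exact ⟨z, hi⟩
  have hρs : ∀ i, ContMDiff (𝓡∂ (k + 1)) 𝓘(ℝ, ℝ) ∞ (ρ i) := fun i => (ρ i).contMDiff
  have hint : ∀ {g : M → ℝ} {μ : Measure M} [IsFiniteMeasure μ], Continuous g → Integrable g μ :=
    fun hg => hg.integrable_of_hasCompactSupport (HasCompactSupport.of_compactSpace _)
  have h1 : ∀ z, tangentialDiv k F X z =
      ∑ i ∈ S, (tangentialDeriv k F (ρ i) X z + ρ i z * tangentialDiv k F X z) := by
    intro z
    rw [Finset.sum_add_distrib, ← Finset.sum_mul, hsum, one_mul]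
    have hu := extChartAt_mem_chartDom (k := k) (mem_chart_source (EuclideanHalfSpace (k + 1)) z)
    have hud := uniqueDiffOn_halfSpace _ (chartDom_subset z hu)
    -- The cutoffs sum to the constant 1, so the terms in which a cutoff is differentiated cancel.
    have h2 : ∑ i ∈ S, chartDeriv k (ρ i) z = 0 := by
      simp only [chartDeriv, halfDeriv]
      rw [← fderivWithin_fun_sum hud fun i _ =>
        (contDiffWithinAt_comp_chartInv (hρs i) hu).differentiableWithinAt (by simp)]
      simp only [Function.comp_apply, hsum]
      simp
    simp only [tangentialDeriv]
    rw [← sum_apply, h2, _root_.zero_apply, zero_add]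
  have h3 : ∀ z, h z = ∑ i ∈ S, ρ i z * h z := fun z => by rw [← Finset.sum_mul, hsum, one_mul]
  have h4 : ∀ i ∈ S, Integrable (fun z => tangentialDeriv k F (ρ i) X z +
      ρ i z * tangentialDiv k F X z) (volMeasure k F) := fun i _ =>
    hint ((hF.continuous_tangentialDeriv (hρs i) hX.continuous).add
      ((hρs i).continuous.mul (hF.continuous_tangentialDiv hX)))
  have h5 : ∀ i ∈ S, Integrable (fun z => ρ i z * h z) (bdMeasure k F) := fun i _ =>
    hint ((hρs i).continuous.mul hh)
  rw [integral_congr_ae (Eventually.of_forall h1), integral_congr_ae (Eventually.of_forall h3),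
    integral_finsetSum _ h4, integral_finsetSum _ h5]
  exact Finset.sum_le_sum fun i _ => hF.integral_mul_tangentialDiv_le hX hh hb (hρs i)
    (fun z => ρ.nonneg i z) i (hρ i)

end Global

/-! ### The regularised point mass in flat space. -/

section Kernel

variable {k : ℕ}

/-- The regularised point mass in dimension `k + 1`. -/
noncomputable def massKernel (k : ℕ) (ε t : ℝ) : ℝ :=
  ε ^ 2 / (t ^ 2 + ε ^ 2) ^ (((k : ℝ) + 1) / 2 + 1)

theorem massKernel_nonneg (ε t : ℝ) : 0 ≤ massKernel k ε t := by
  unfold massKernel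
  positivity

theorem massKernel_anti (ε : ℝ) (hε : 0 < ε) {s t : ℝ} (hs : 0 ≤ s) (hst : s ≤ t) :
    massKernel k ε t ≤ massKernel k ε s := by
  unfold massKernel
  gcongr

theorem continuous_massKernel {ε : ℝ} (hε : 0 < ε) : Continuous (massKernel k ε) := by
  unfold massKernel
  refine continuous_const.div (Continuous.rpow_const (by fun_prop) fun t => Or.inl ?_) fun t => ?_
  · positivity
  · positivity

/-- With s = t² + ε², the two terms of the product rule combine to (k + 1) t^k (s - t²) s^(-((k+1)/2
+ 1)), and s - t² = ε². This is the primitive needed to integrate the kernel in polar coordinates.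
-/
theorem hasDerivAt_massKernel {ε : ℝ} (hε : 0 < ε) (t : ℝ) :
    HasDerivAt (fun t => t ^ (k + 1) * (t ^ 2 + ε ^ 2) ^ (-(((k : ℝ) + 1) / 2)))
      (((k : ℝ) + 1) * (t ^ k * massKernel k ε t)) t := by
  have hs : 0 < t ^ 2 + ε ^ 2 := by positivity
  have h1 : HasDerivAt (fun t : ℝ => t ^ 2 + ε ^ 2) (2 * t) t := by
    simpa using (hasDerivAt_pow 2 t).add_const (ε ^ 2)
  have h2 := (hasDerivAt_pow (k + 1) t).mul
    (h1.rpow_const (p := -(((k : ℝ) + 1) / 2)) (Or.inl hs.ne'))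
  refine h2.congr_deriv ?_
  have h3 : (t ^ 2 + ε ^ 2) ^ (-(((k : ℝ) + 1) / 2)) =
      (t ^ 2 + ε ^ 2) * ((t ^ 2 + ε ^ 2) ^ (((k : ℝ) + 1) / 2 + 1))⁻¹ := by
    rw [← Real.rpow_neg hs.le]
    nth_rewrite 2 [← Real.rpow_one (t ^ 2 + ε ^ 2)]
    rw [← Real.rpow_add hs]
    congr 1
    ring
  have h4 : (t ^ 2 + ε ^ 2) ^ (-(((k : ℝ) + 1) / 2) - 1) =
      ((t ^ 2 + ε ^ 2) ^ (((k : ℝ) + 1) / 2 + 1))⁻¹ := by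
    rw [← Real.rpow_neg hs.le]
    congr 1
    ring
  rw [h3, h4, massKernel]
  simp only [Nat.add_sub_cancel]
  push_cast
  field_simp
  ring

theorem integral_massKernel {ε R : ℝ} (hε : 0 < ε) (hR : 0 < R) :
    ∫ w in Metric.ball (0 : EuclideanSpace ℝ (Fin (k + 1))) R, massKernel k ε ‖w‖ =
      volume.real (Metric.ball (0 : EuclideanSpace ℝ (Fin (k + 1))) 1) *
        (R ^ (k + 1) * (R ^ 2 + ε ^ 2) ^ (-(((k : ℝ) + 1) / 2))) := by
  have h1 : ∫ w in Metric.ball (0 : EuclideanSpace ℝ (Fin (k + 1))) R, massKernel k ε ‖w‖ =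
      ∫ w : EuclideanSpace ℝ (Fin (k + 1)), (Iio R).indicator (massKernel k ε) ‖w‖ := by
    rw [← integral_indicator Metric.isOpen_ball.measurableSet]
    refine integral_congr_ae (Eventually.of_forall fun w => ?_)
    by_cases hw : ‖w‖ < R
    · simp [indicator, hw]
    · simp [indicator, hw]
  have h2 : ∀ y : ℝ, y ^ k * (Iio R).indicator (massKernel k ε) y =
      (Iio R).indicator (fun y => y ^ k * massKernel k ε y) y := fun y => by
    by_cases hy : y < R <;> simp [indicator, hy]
  rw [h1, integral_fun_norm_addHaar, finrank_euclideanSpace_fin]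
  simp only [Nat.add_sub_cancel, smul_eq_mul, nsmul_eq_mul, h2]
  rw [setIntegral_indicator measurableSet_Iio, Ioi_inter_Iio,
    ← integral_Ioc_eq_integral_Ioo, ← intervalIntegral.integral_of_le hR.le]
  have h3 := intervalIntegral.integral_eq_sub_of_hasDerivAt (a := 0) (b := R)
    (fun t _ => hasDerivAt_massKernel (k := k) hε t)
    ((continuous_const.mul ((continuous_pow k).mul
      (continuous_massKernel hε))).intervalIntegrable _ _)
  rw [intervalIntegral.integral_const_mul] at h3
  rw [mul_left_comm]
  push_cast
  rw [h3]
  simp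

/-- As ε tends to 0 the full mass concentrates in every fixed ball around the origin. -/
theorem tendsto_mass {R : ℝ} (hR : 0 < R) :
    Tendsto (fun ε : ℝ => R ^ (k + 1) * (R ^ 2 + ε ^ 2) ^ (-(((k : ℝ) + 1) / 2))) (𝓝 0) (𝓝 1) := by
  have h1 : ContinuousAt (fun ε : ℝ => R ^ (k + 1) * (R ^ 2 + ε ^ 2) ^ (-(((k : ℝ) + 1) / 2))) 0 :=
    continuousAt_const.mul (ContinuousAt.rpow_const (by fun_prop) (Or.inl (by positivity)))
  have h2 : R ^ (k + 1) * (R ^ 2 + (0 : ℝ) ^ 2) ^ (-(((k : ℝ) + 1) / 2)) = 1 := by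
    rw [zero_pow two_ne_zero, add_zero, ← Real.rpow_natCast, ← Real.rpow_natCast,
      ← Real.rpow_mul hR.le, ← Real.rpow_add hR]
    push_cast
    ring_nf
    simp
  exact (congrArg 𝓝 h2) ▸ h1.tendsto

/-- An injective linear map factors isometrically through an automorphism of its domain. -/
theorem exists_equiv_norm_eq {U V : Type*} [NormedAddCommGroup U] [InnerProductSpace ℝ U]
    [FiniteDimensional ℝ U] [NormedAddCommGroup V] [InnerProductSpace ℝ V] [FiniteDimensional ℝ V]
    {L : U →L[ℝ] V} (hL : Function.Injective L) :
    ∃ S : U ≃L[ℝ] U, (∀ v, ‖S v‖ = ‖L v‖) ∧ |(S : U →L[ℝ] U).det| = jac L := by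
  have hfr : finrank ℝ (L : U →ₗ[ℝ] V).range = finrank ℝ U :=
    LinearMap.finrank_range_of_inj hL
  let e : (L : U →ₗ[ℝ] V).range ≃ₗᵢ[ℝ] U := ((stdOrthonormalBasis ℝ _).reindex (finCongr hfr)).equiv
    (stdOrthonormalBasis ℝ U) (Equiv.refl _)
  -- S is L followed by an isometry from the range of L to U, so S and L have the same first
  -- fundamental form.
  let S : U ≃ₗ[ℝ] U := (LinearEquiv.ofInjective (L : U →ₗ[ℝ] V) hL).trans e.toLinearEquiv
  have hS : ∀ v, ‖S v‖ = ‖L v‖ := fun v => by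
    change ‖e (LinearEquiv.ofInjective (L : U →ₗ[ℝ] V) hL v)‖ = _
    rw [LinearIsometryEquiv.norm_map]
    rfl
  have hSi : ∀ v w, inner ℝ (S v) (S w) = inner ℝ (L v) (L w) := fun v w => by
    rw [real_inner_eq_norm_add_mul_self_sub_norm_mul_self_sub_norm_mul_self_div_two,
      real_inner_eq_norm_add_mul_self_sub_norm_mul_self_sub_norm_mul_self_div_two,
      ← map_add, ← map_add, hS, hS, hS]
  refine ⟨S.toContinuousLinearEquiv, hS, ?_⟩
  have h1 : gram (S.toContinuousLinearEquiv : U →L[ℝ] U) = gram L := by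
    ext1 v
    refine ext_inner_left ℝ fun w => ?_
    rw [inner_gram, inner_gram]
    exact hSi w v
  have h2 : jac (S.toContinuousLinearEquiv : U →L[ℝ] U) = jac L := by
    rw [← sq_eq_sq₀ (LinearMap.normDet_nonneg _) (LinearMap.normDet_nonneg _)]
    have h3 := (S.toContinuousLinearEquiv : U →L[ℝ] U).normDet_sq
    have h4 := L.normDet_sq
    exact h3.trans ((congrArg ContinuousLinearMap.det h1).trans h4.symm)
  rw [← h2]
  exact (LinearMap.normDet_eq_abs_det _).symm

end Kernel

/-! ### The mass carried by an interior preimage. -/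

section LowerBound

variable {k n : ℕ} {M : Type*} [TopologicalSpace M]
  [ChartedSpace (EuclideanHalfSpace (k + 1)) M] [IsManifold (𝓡∂ (k + 1)) ∞ M]
  {F : M → EuclideanSpace ℝ (Fin n)}
  [PolishSpace M] [MeasurableSpace M] [BorelSpace M] [CompactSpace M]

theorem ImmersedOn.mono {U V : Type*} [NormedAddCommGroup U] [InnerProductSpace ℝ U]
    [FiniteDimensional ℝ U] [MeasurableSpace U] [BorelSpace U] [NormedAddCommGroup V]
    [InnerProductSpace ℝ V] [FiniteDimensional ℝ V] [MeasurableSpace V] [BorelSpace V]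
    {f : U → V} {f' : U → U →L[ℝ] V} {s t : Set U} (h : ImmersedOn f f' s) (hts : t ⊆ s) :
    ImmersedOn f f' t where
  approx := fun u hu ε hε => by
    obtain ⟨N, hN, h1⟩ := h.approx u (hts hu) ε hε
    exact ⟨N, nhdsWithin_mono _ hts hN, h1⟩
  continuousOn := h.continuousOn.mono hts
  injective := fun u hu => h.injective u (hts hu)

/-- Near an interior point the regularised point mass is asymptotically at least that of a
`(k + 1)`-plane. -/
theorem _root_.IsMinimalImmersion.eventually_le_integral_massKernel
    (hF : IsMinimalImmersion (k + 1) F) {q : M} (hq : (𝓡∂ (k + 1)).IsInteriorPoint q) {O : Set M}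
    (hO : IsOpen O) (hqO : q ∈ O) {c : ℝ} (hc : c < 1) :
    ∀ᶠ ε in 𝓝[>] (0 : ℝ),
      c * volume.real (Metric.ball (0 : EuclideanSpace ℝ (Fin (k + 1))) 1) ≤
        ∫ z in O, massKernel k ε ‖F z - F q‖ ∂(volMeasure k F) := by
  have hfin := isFiniteMeasure_volMeasure hF
  set θ := volume.real (Metric.ball (0 : EuclideanSpace ℝ (Fin (k + 1))) 1) with hθ
  have hθ0 : 0 ≤ θ := measureReal_nonneg
  -- Of the k + 2 factors a, the determinant of Θ accounts for k + 1 and the comparison of Jacobians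
  -- for one.
  obtain ⟨a, ha1, hac⟩ : ∃ a : ℝ, 1 < a ∧ c < (a ^ (k + 2))⁻¹ := by
    have : Tendsto (fun a : ℝ => (a ^ (k + 2))⁻¹) (𝓝[>] 1) (𝓝 1) := by
      have : ContinuousAt (fun a : ℝ => (a ^ (k + 2))⁻¹) 1 :=
        (continuousAt_id.pow _).inv₀ (by simp)
      have h2 := this.tendsto
      simp only [one_pow, inv_one] at h2
      exact h2.mono_left nhdsWithin_le_nhds
    obtain ⟨a, ha, ha'⟩ := ((this.eventually (lt_mem_nhds hc)).and self_mem_nhdsWithin).exists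
    exact ⟨a, ha', ha⟩
  have ha0 : 0 < a := by linarith
  have hqs := mem_chart_source (EuclideanHalfSpace (k + 1)) q
  set u := extChartAt (𝓡∂ (k + 1)) q q with hu'
  have hu : u ∈ chartDom q := extChartAt_mem_chartDom hqs
  have hqu : chartInv k q u = q := chartInv_extChartAt hqs
  have hu0 : 0 < u 0 := by rwa [← isInteriorPoint_chartInv_iff hu, hqu]
  have hP := hF.immersedPatch q
  set f := F ∘ chartInv k q with hf
  set A := halfDeriv f u with hA'
  have hA : Function.Injective A := hP.injective u hu
  have hJ : 0 < jac A := hP.immersedOn.normDet_pos hu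
  obtain ⟨N, hN, -, hNb, -⟩ := hP.immersedOn.exists_nhds hu ha1
  have hN' : N ∈ 𝓝 u := by
    rw [← nhdsWithin_eq_nhds.2 (halfSpace_mem_nhds hu0)]
    exact nhdsWithin_le_of_mem (chartDom_mem_nhdsWithin q hu) hN
  have hJN : ∀ᶠ v in 𝓝 u, a⁻¹ * jac A ≤ jac (halfDeriv f v) := by
    have h1 : ContinuousAt (fun v => jac (halfDeriv f v)) u := by
      have := continuous_normDet.continuousAt.comp_continuousWithinAt (hP.continuousWithinAt_deriv hu)
      rw [← continuousWithinAt_iff_continuousAt (halfSpace_mem_nhds hu0)]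
      exact this
    have h2 : a⁻¹ * jac A < jac A := by
      rw [inv_mul_lt_iff₀ ha0]
      nlinarith
    filter_upwards [h1.eventually (lt_mem_nhds h2)] with v hv using hv.le
  have hTO : ∀ᶠ v in 𝓝 u, v ∈ chartDom q ∧ chartInv k q v ∈ O := by
    have := eventually_chartInv_mem hu (hO.mem_nhds (by rwa [hqu]))
    rwa [nhdsWithin_eq_nhds.2 (halfSpace_mem_nhds hu0)] at this
  obtain ⟨δ, hδ, hδ'⟩ := Metric.nhds_basis_closedBall.mem_iff.1
    (inter_mem hN' (inter_mem hJN hTO))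
  set B := Metric.closedBall u δ with hB
  have hBc : IsCompact B := isCompact_closedBall _ _
  have hBT : B ⊆ chartDom q := fun v hv => (hδ' hv).2.2.1
  obtain ⟨S, hS, hSdet⟩ := exists_equiv_norm_eq hA
  -- On B the norm of Θ v dominates ‖F - F q‖ at the corresponding point, and the kernel decreases
  -- with distance. Hence the flat kernel pulled back by Θ bounds the kernel on the surface from
  -- below.
  let Θ : EuclideanSpace ℝ (Fin (k + 1)) → EuclideanSpace ℝ (Fin (k + 1)) :=
    fun v => (a • (S : EuclideanSpace ℝ (Fin (k + 1)) →L[ℝ] EuclideanSpace ℝ (Fin (k + 1)))) (v - u)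
  have hΘd : ∀ v, HasFDerivAt Θ
      (a • (S : EuclideanSpace ℝ (Fin (k + 1)) →L[ℝ] EuclideanSpace ℝ (Fin (k + 1)))) v :=
    fun v => (ContinuousLinearMap.hasFDerivAt _).comp v ((hasFDerivAt_id v).sub_const u)
  have hΘi : InjOn Θ B := fun v _ w _ hvw => by
    have h1 : a • S (v - u) = a • S (w - u) := hvw
    have h2 := S.injective (smul_right_injective _ ha0.ne' h1)
    simpa using h2
  have hΘn : ∀ v, ‖Θ v‖ = a * ‖A (v - u)‖ := fun v => by
    change ‖a • S (v - u)‖ = _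
    rw [norm_smul, hS, Real.norm_of_nonneg ha0.le]
  obtain ⟨R, hR, hRB⟩ : ∃ R > 0, Metric.ball 0 R ⊆ Θ '' B := by
    have h1 : ContinuousAt (fun w => u + a⁻¹ • S.symm w) 0 := by fun_prop
    have h2 : (fun w => u + a⁻¹ • S.symm w) ⁻¹' B ∈
        𝓝 (0 : EuclideanSpace ℝ (Fin (k + 1))) := by
      refine h1 ?_
      simp only [map_zero, smul_zero, add_zero]
      exact Metric.closedBall_mem_nhds _ hδ
    obtain ⟨R, hR, hR'⟩ := Metric.mem_nhds_iff.1 h2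
    refine ⟨R, hR, fun w hw => ⟨_, hR' hw, ?_⟩⟩
    change a • S (u + a⁻¹ • S.symm w - u) = w
    rw [add_sub_cancel_left, map_smul, S.apply_symm_apply, smul_inv_smul₀ ha0.ne']
  have hlim : ∀ᶠ ε in 𝓝[>] (0 : ℝ), c * a ^ (k + 2) ≤
      R ^ (k + 1) * (R ^ 2 + ε ^ 2) ^ (-(((k : ℝ) + 1) / 2)) := by
    have h1 : c * a ^ (k + 2) < 1 := by
      rw [← lt_inv_mul_iff₀' (by positivity), mul_one]
      exact hac
    filter_upwards [((tendsto_mass (k := k) hR).mono_left nhdsWithin_le_nhds).eventually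
      (lt_mem_nhds h1)] with ε hε using hε.le
  filter_upwards [hlim, self_mem_nhdsWithin] with ε hε hε0
  have hε0 : 0 < ε := hε0
  have hgc : Continuous fun z => massKernel k ε ‖F z - F q‖ :=
    (continuous_massKernel hε0).comp (hF.contMDiff.continuous.sub continuous_const).norm
  have hgi : Integrable (fun z => massKernel k ε ‖F z - F q‖) (volMeasure k F) :=
    hgc.integrable_of_hasCompactSupport (HasCompactSupport.of_compactSpace _)
  have h1 : ∫ z in chartInv k q '' B, massKernel k ε ‖F z - F q‖ ∂(volMeasure k F) ≤
      ∫ z in O, massKernel k ε ‖F z - F q‖ ∂(volMeasure k F) := by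
    refine setIntegral_mono_set hgi.integrableOn
      (Eventually.of_forall fun z => massKernel_nonneg _ _) (Eventually.of_forall ?_)
    rintro _ ⟨v, hv, rfl⟩
    exact (hδ' hv).2.2.2
  have h2 := setIntegral_fiberMeasure_image hF.contMDiff.continuous hF.exists_injOn_nhds
    hBc.measurableSet ((continuousOn_chartInv q).mono hBT) ((injOn_chartInv q).mono hBT)
    (hP.immersedOn.mono hBT) hgc
  rw [finrank_euclideanSpace_fin] at h2
  have h3 : ∫ v in B, (a ^ (k + 2))⁻¹ * (|(a • (S : EuclideanSpace ℝ (Fin (k + 1)) →L[ℝ]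
      EuclideanSpace ℝ (Fin (k + 1)))).det| • massKernel k ε ‖Θ v‖) ≤
      ∫ v in B, jac (halfDeriv f v) * massKernel k ε ‖F (chartInv k q v) - F q‖ := by
    have hfB : ContinuousOn f B := fun v hv =>
      (hP.continuousWithinAt (hBT hv)).mono (hBT.trans (chartDom_subset q))
    have hJB : ContinuousOn (fun v => jac (halfDeriv f v)) B :=
      hP.immersedOn.continuousOn_normDet.mono hBT
    have hΘc : Continuous Θ := by fun_prop
    refine setIntegral_mono_on ?_ ?_ hBc.measurableSet fun v hv => ?_
    · refine ContinuousOn.integrableOn_compact hBc ?_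
      have hk : Continuous fun v => massKernel k ε ‖Θ v‖ :=
        (continuous_massKernel hε0).comp hΘc.norm
      simp only [smul_eq_mul]
      exact (continuous_const.mul (continuous_const.mul hk)).continuousOn
    · refine ContinuousOn.integrableOn_compact hBc ?_
      exact hJB.mul ((continuous_massKernel hε0).comp_continuousOn
        ((hfB.sub continuousOn_const).norm))
    · have hdet : |(a • (S : EuclideanSpace ℝ (Fin (k + 1)) →L[ℝ]
          EuclideanSpace ℝ (Fin (k + 1)))).det| = a ^ (k + 1) * jac A := by
        rw [← hSdet, ContinuousLinearMap.det, ContinuousLinearMap.toLinearMap_smul,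
          LinearMap.det_smul, abs_mul, finrank_euclideanSpace_fin, abs_of_pos (by positivity)]
      have h4 : ‖F (chartInv k q v) - F q‖ ≤ ‖Θ v‖ := by
        have h5 := (hNb v (hδ' hv).1 u (mem_of_mem_nhds hN')).1
        rw [hΘn]
        simpa only [hf, Function.comp_apply, hqu] using h5
      have h6 := massKernel_anti (k := k) ε hε0 (norm_nonneg _) h4
      rw [hdet, smul_eq_mul]
      calc (a ^ (k + 2))⁻¹ * (a ^ (k + 1) * jac A * massKernel k ε ‖Θ v‖)
          = a⁻¹ * jac A * massKernel k ε ‖Θ v‖ := by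
            rw [pow_succ a (k + 1)]
            field_simp
        _ ≤ _ := mul_le_mul (hδ' hv).2.1 h6 (massKernel_nonneg _ _) (LinearMap.normDet_nonneg _)
  rw [integral_const_mul, ← integral_image_eq_integral_abs_det_fderiv_smul volume hBc.measurableSet
    (fun v _ => (hΘd v).hasFDerivWithinAt) hΘi (fun w => massKernel k ε ‖w‖)] at h3
  have h7 : ∫ w in Metric.ball (0 : EuclideanSpace ℝ (Fin (k + 1))) R, massKernel k ε ‖w‖ ≤
      ∫ w in Θ '' B, massKernel k ε ‖w‖ := by
    refine setIntegral_mono_set ?_ (Eventually.of_forall fun z => massKernel_nonneg _ _)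
      (Eventually.of_forall hRB)
    have hΘc : Continuous Θ := by fun_prop
    exact ((continuous_massKernel hε0).comp continuous_norm).continuousOn.integrableOn_compact
      (hBc.image hΘc)
  rw [integral_massKernel hε0 hR] at h7
  have h8 : c * θ ≤ (a ^ (k + 2))⁻¹ * ∫ w in Θ '' B, massKernel k ε ‖w‖ := by
    rw [le_inv_mul_iff₀ (by positivity)]
    refine le_trans ?_ h7
    have := mul_le_mul_of_nonneg_left hε hθ0
    linarith
  exact h8.trans (h3.trans (h2.symm.le.trans h1))

end LowerBound

/-! ### The regularised radial field. -/

section Field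

variable {k n : ℕ}

/-- The regularisation of the radial field `(y - p) / |y - p| ^ (k + 1)`. -/
noncomputable def regField (k : ℕ) (ε : ℝ) (p y : EuclideanSpace ℝ (Fin n)) :
    EuclideanSpace ℝ (Fin n) :=
  ((‖y - p‖ ^ 2 + ε ^ 2) ^ (-(((k : ℝ) + 1) / 2))) • (y - p)

theorem contDiff_regField {ε : ℝ} (hε : 0 < ε) (p : EuclideanSpace ℝ (Fin n)) :
    ContDiff ℝ ∞ (regField k ε p) := by
  have h1 : ContDiff ℝ ∞ fun y : EuclideanSpace ℝ (Fin n) => y - p := contDiff_id.sub contDiff_const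
  have h2 : ContDiff ℝ ∞ fun y : EuclideanSpace ℝ (Fin n) =>
      (‖y - p‖ ^ 2 + ε ^ 2) ^ (-(((k : ℝ) + 1) / 2)) :=
    ContDiff.rpow_const_of_ne ((h1.norm_sq ℝ).add contDiff_const) fun y => by positivity
  exact h2.smul h1

theorem hasFDerivAt_regField {ε : ℝ} (hε : 0 < ε) (p y : EuclideanSpace ℝ (Fin n)) :
    HasFDerivAt (regField k ε p)
      ((‖y - p‖ ^ 2 + ε ^ 2) ^ (-(((k : ℝ) + 1) / 2)) • ContinuousLinearMap.id ℝ _ -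
        (((k : ℝ) + 1) * (‖y - p‖ ^ 2 + ε ^ 2) ^ (-(((k : ℝ) + 1) / 2 + 1))) •
          (innerSL ℝ (y - p)).smulRight (y - p)) y := by
  have hs : 0 < ‖y - p‖ ^ 2 + ε ^ 2 := by positivity
  have h1 : HasFDerivAt (fun y : EuclideanSpace ℝ (Fin n) => y - p)
      (ContinuousLinearMap.id ℝ _) y := (hasFDerivAt_id y).sub_const p
  have h2 := (h1.norm_sq.add_const (ε ^ 2)).rpow_const (p := -(((k : ℝ) + 1) / 2)) (Or.inl hs.ne')
  refine (h2.smul h1).congr_fderiv ?_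
  ext1 v
  have h3 : -(((k : ℝ) + 1) / 2) - 1 = -(((k : ℝ) + 1) / 2 + 1) := by ring
  simp only [h3, _root_.add_apply, _root_.sub_apply,
    _root_.smul_apply, ContinuousLinearMap.smulRight_apply,
    ContinuousLinearMap.id_apply, innerSL_apply_apply, ContinuousLinearMap.comp_apply, smul_eq_mul,
    sub_eq_add_neg (_ • v)]
  rw [smul_smul, ← neg_smul]
  congr 2
  simp
  ring

/-- The base |y - p|² + ε² is at least |y - p|². The bound is independent of ε, which is what the
boundary term requires. -/
theorem norm_regField_le {ε : ℝ} (hε : 0 < ε) (p y : EuclideanSpace ℝ (Fin n)) :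
    ‖regField k ε p y‖ ≤ (‖y - p‖ ^ k)⁻¹ := by
  rcases eq_or_ne (y - p) 0 with h | h
  · simp [regField, h]
  · have h0 : 0 < ‖y - p‖ := norm_pos_iff.2 h
    have hs : 0 < ‖y - p‖ ^ 2 + ε ^ 2 := by positivity
    have h1 : ‖y - p‖ ^ (k + 1) ≤ (‖y - p‖ ^ 2 + ε ^ 2) ^ (((k : ℝ) + 1) / 2) := by
      calc ‖y - p‖ ^ (k + 1) = (‖y - p‖ ^ 2) ^ (((k : ℝ) + 1) / 2) := by
            rw [← Real.rpow_natCast, ← Real.rpow_natCast, ← Real.rpow_mul h0.le]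
            congr 1
            push_cast
            ring
        _ ≤ _ := by
            gcongr
            nlinarith
    rw [regField, norm_smul, Real.norm_of_nonneg (by positivity), Real.rpow_neg hs.le,
      inv_mul_le_iff₀ (by positivity)]
    calc ‖y - p‖ = ‖y - p‖ ^ (k + 1) * (‖y - p‖ ^ k)⁻¹ := by
          rw [pow_succ]
          field_simp
      _ ≤ _ := by gcongr

end Field

/-! ### The density inequality and what equality forces. -/

section Mass

variable {k n : ℕ} {M : Type*} [TopologicalSpace M]
  [ChartedSpace (EuclideanHalfSpace (k + 1)) M] [IsManifold (𝓡∂ (k + 1)) ∞ M]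
  {F : M → EuclideanSpace ℝ (Fin n)}

/-- The normal component of the position vector with respect to `p`. -/
noncomputable def normalPart (k : ℕ) {M : Type*} [TopologicalSpace M]
    [ChartedSpace (EuclideanHalfSpace (k + 1)) M] (F : M → EuclideanSpace ℝ (Fin n))
    (p : EuclideanSpace ℝ (Fin n)) (z : M) : EuclideanSpace ℝ (Fin n) :=
  F z - p - tangentProj k F z (F z - p)

theorem _root_.IsMinimalImmersion.continuous_normalPart (hF : IsMinimalImmersion (k + 1) F)
    (p : EuclideanSpace ℝ (Fin n)) : Continuous (normalPart k F p) :=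
  (hF.contMDiff.continuous.sub continuous_const).sub
    (hF.continuous_tangentProj.clm_apply (hF.contMDiff.continuous.sub continuous_const))

theorem _root_.IsMinimalImmersion.trace_tangentProj (hF : IsMinimalImmersion (k + 1) F) (z : M) :
    LinearMap.trace ℝ _ (tangentProj k F z : EuclideanSpace ℝ (Fin n) →ₗ[ℝ]
      EuclideanSpace ℝ (Fin n)) = k + 1 := by
  rw [tangentProj, ContinuousLinearMap.toLinearMap_comp, LinearMap.trace_comp_comm']
  have : (pinv (chartDeriv k F z) : EuclideanSpace ℝ (Fin n) →ₗ[ℝ] _) ∘ₗ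
      (chartDeriv k F z : EuclideanSpace ℝ (Fin (k + 1)) →ₗ[ℝ] EuclideanSpace ℝ (Fin n)) = LinearMap.id := by
    ext1 v
    exact pinv_apply_self (hF.injective_chartDeriv z) v
  rw [this, LinearMap.trace_id, finrank_euclideanSpace_fin]
  push_cast
  ring

theorem _root_.IsMinimalImmersion.norm_sq_normalPart (hF : IsMinimalImmersion (k + 1) F)
    (p : EuclideanSpace ℝ (Fin n)) (z : M) :
    ‖normalPart k F p z‖ ^ 2 =
      ‖F z - p‖ ^ 2 - inner ℝ (F z - p) (tangentProj k F z (F z - p)) := by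
  have h1 := inner_map_pinv (hF.injective_chartDeriv z) (pinv (chartDeriv k F z) (F z - p))
    (F z - p)
  have h2 : inner ℝ (tangentProj k F z (F z - p)) (tangentProj k F z (F z - p)) =
    inner ℝ (tangentProj k F z (F z - p)) (F z - p) := h1
  rw [normalPart]
  generalize F z - p = x at *
  rw [@norm_sub_sq_real, ← real_inner_self_eq_norm_sq (tangentProj k F z x), h2,
    real_inner_comm x]
  ring

/-- Let s = |x|² + ε² and let P be the tangential projection, of trace k + 1. The divergence is (k +
1) s^(-((k+1)/2 + 1)) (s - ⟨x, P x⟩), and s - ⟨x, P x⟩ = ε² + |x^⊥|². Both resulting terms are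
nonnegative. -/
theorem _root_.IsMinimalImmersion.tangentialDiv_regField (hF : IsMinimalImmersion (k + 1) F)
    {ε : ℝ} (hε : 0 < ε) (p : EuclideanSpace ℝ (Fin n)) (z : M) :
    tangentialDiv k F (regField k ε p) z = ((k : ℝ) + 1) * (massKernel k ε ‖F z - p‖ +
      ‖normalPart k F p z‖ ^ 2 / (‖F z - p‖ ^ 2 + ε ^ 2) ^ (((k : ℝ) + 1) / 2 + 1)) := by
  have hs : 0 < ‖F z - p‖ ^ 2 + ε ^ 2 := by positivity
  rw [tangentialDiv, (hasFDerivAt_regField hε p (F z)).fderiv]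
  have h1 : ∀ (P : EuclideanSpace ℝ (Fin n) →L[ℝ] EuclideanSpace ℝ (Fin n)) (a b : ℝ)
      (x : EuclideanSpace ℝ (Fin n)),
      ((P ∘L (a • ContinuousLinearMap.id ℝ _ - b • (innerSL ℝ x).smulRight x) :
        EuclideanSpace ℝ (Fin n) →L[ℝ] EuclideanSpace ℝ (Fin n)) :
        EuclideanSpace ℝ (Fin n) →ₗ[ℝ] EuclideanSpace ℝ (Fin n)) =
      a • (P : EuclideanSpace ℝ (Fin n) →ₗ[ℝ] EuclideanSpace ℝ (Fin n)) -
        b • (((innerSL ℝ x).smulRight (P x) :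
          EuclideanSpace ℝ (Fin n) →L[ℝ] EuclideanSpace ℝ (Fin n)) :
          EuclideanSpace ℝ (Fin n) →ₗ[ℝ] EuclideanSpace ℝ (Fin n)) := by
    intro P a b x
    ext1 v
    simp
  rw [h1, map_sub, map_smul, map_smul, hF.trace_tangentProj, trace_smulRight, hF.norm_sq_normalPart]
  have h3 : (‖F z - p‖ ^ 2 + ε ^ 2) ^ (-(((k : ℝ) + 1) / 2)) =
      (‖F z - p‖ ^ 2 + ε ^ 2) * ((‖F z - p‖ ^ 2 + ε ^ 2) ^ (((k : ℝ) + 1) / 2 + 1))⁻¹ := by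
    rw [← Real.rpow_neg hs.le]
    nth_rewrite 2 [← Real.rpow_one (‖F z - p‖ ^ 2 + ε ^ 2)]
    rw [← Real.rpow_add hs]
    congr 1
    ring
  rw [h3, Real.rpow_neg hs.le, massKernel, innerSL_apply_apply]
  simp only [smul_eq_mul]
  field_simp
  ring

/-- Interior points are dense. -/
theorem exists_isInteriorPoint_mem {O : Set M} (hO : IsOpen O) {z : M} (hz : z ∈ O) :
    ∃ y ∈ O, (𝓡∂ (k + 1)).IsInteriorPoint y := by
  have hzs := mem_chart_source (EuclideanHalfSpace (k + 1)) z
  set u := extChartAt (𝓡∂ (k + 1)) z z with hu'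
  have hu : u ∈ chartDom z := extChartAt_mem_chartDom hzs
  have hzu : chartInv k z u = z := chartInv_extChartAt hzs
  obtain ⟨r, hr, hrT⟩ := Metric.mem_nhdsWithin_iff.1
    (eventually_chartInv_mem hu (hO.mem_nhds (by rwa [hzu])))
  have h0 : 0 ≤ u 0 := chartDom_subset z hu
  have hv0 : 0 < (u + (r / 2) • EuclideanSpace.single (0 : Fin (k + 1)) (1 : ℝ)) 0 := by
    simp
    linarith
  have hv : u + (r / 2) • EuclideanSpace.single (0 : Fin (k + 1)) (1 : ℝ) ∈
      Metric.ball u r ∩ halfSpace k := by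
    refine ⟨?_, le_of_lt hv0⟩
    simp [norm_smul, abs_of_pos hr]
    linarith
  exact ⟨_, (hrT hv).2, (isInteriorPoint_chartInv_iff (hrT hv).1).2 hv0⟩

variable [PolishSpace M] [MeasurableSpace M] [BorelSpace M] [CompactSpace M]

/-- The divergence inequality for `regField`, with the boundary flux bounded by Cauchy–Schwarz. The
majorant h is left free: a constant gives the inequality, a variable one the rigidity on the
boundary. -/
theorem _root_.IsMinimalImmersion.integral_massKernel_le (hF : IsMinimalImmersion (k + 1) F)
    {ε : ℝ} (hε : 0 < ε) (p : EuclideanSpace ℝ (Fin n)) {h : M → ℝ} (hh : Continuous h)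
    (hb : ∀ z ∈ (𝓡∂ (k + 1)).boundary M, (‖F z - p‖ ^ k)⁻¹ ≤ h z) :
    ((k : ℝ) + 1) * (∫ z, massKernel k ε ‖F z - p‖ ∂(volMeasure k F) +
      ∫ z, ‖normalPart k F p z‖ ^ 2 / (‖F z - p‖ ^ 2 + ε ^ 2) ^ (((k : ℝ) + 1) / 2 + 1)
        ∂(volMeasure k F)) ≤ ∫ z, h z ∂(bdMeasure k F) := by
  have := isFiniteMeasure_volMeasure hF
  have hint : ∀ {g : M → ℝ} {μ : Measure M} [IsFiniteMeasure μ], Continuous g → Integrable g μ :=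
    fun hg => hg.integrable_of_hasCompactSupport (HasCompactSupport.of_compactSpace _)
  have hx : Continuous fun z => ‖F z - p‖ := (hF.contMDiff.continuous.sub continuous_const).norm
  rw [← integral_add, ← integral_const_mul]
  · refine le_trans (le_of_eq ?_) (hF.integral_tangentialDiv_le (contDiff_regField (k := k) hε p) hh
      fun x u hu hu0 => ?_)
    · exact integral_congr_ae (Eventually.of_forall fun z =>
        (hF.tangentialDiv_regField hε p z).symm)
    · rw [← inner_neg_right]
      refine (real_inner_le_norm _ _).trans ?_
      rw [mul_comm, norm_neg]
      exact mul_le_mul_of_nonneg_right ((norm_regField_le hε p _).trans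
        (hb _ ((mem_boundary_chartInv_iff hu).2 hu0))) (norm_nonneg _)
  · exact hint ((continuous_massKernel hε).comp hx)
  · refine hint (((hF.continuous_normalPart p).norm.pow 2).div
      (Continuous.rpow_const (by fun_prop) fun z => Or.inl ?_) fun z => ?_)
    · positivity
    · positivity

/-- The density inequality. -/
theorem _root_.IsMinimalImmersion.mul_volume_ball_le (hF : IsMinimalImmersion (k + 1) F)
    {q : M} (hq : (𝓡∂ (k + 1)).IsInteriorPoint q) {h : M → ℝ} (hh : Continuous h)
    (hb : ∀ z ∈ (𝓡∂ (k + 1)).boundary M, (‖F z - F q‖ ^ k)⁻¹ ≤ h z) {g : M → ℝ}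
    (hg : Continuous g)
    (hgb : ∀ z, g z ≤
      ‖normalPart k F (F q) z‖ ^ 2 / (‖F z - F q‖ ^ 2 + 1) ^ (((k : ℝ) + 1) / 2 + 1)) :
    ((k : ℝ) + 1) * (volume.real (Metric.ball (0 : EuclideanSpace ℝ (Fin (k + 1))) 1) +
      ∫ z, g z ∂(volMeasure k F)) ≤ ∫ z, h z ∂(bdMeasure k F) := by
  have := isFiniteMeasure_volMeasure hF
  have hint : ∀ {g : M → ℝ} {μ : Measure M} [IsFiniteMeasure μ], Continuous g → Integrable g μ :=
    fun hg => hg.integrable_of_hasCompactSupport (HasCompactSupport.of_compactSpace _)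
  have key : ∀ c < (1 : ℝ), ((k : ℝ) + 1) *
      (c * volume.real (Metric.ball (0 : EuclideanSpace ℝ (Fin (k + 1))) 1) +
      ∫ z, g z ∂(volMeasure k F)) ≤ ∫ z, h z ∂(bdMeasure k F) := by
    intro c hc
    obtain ⟨ε, hε, hε0, hε1⟩ := ((hF.eventually_le_integral_massKernel hq isOpen_univ
      (mem_univ q) hc).and (Ioo_mem_nhdsGT (zero_lt_one (α := ℝ)))).exists
    refine le_trans ?_ (hF.integral_massKernel_le hε0 (F q) hh hb)
    rw [setIntegral_univ] at hε
    refine mul_le_mul_of_nonneg_left (add_le_add hε (integral_mono (hint hg) ?_ fun z =>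
      (hgb z).trans ?_)) (by positivity)
    · have hx : Continuous fun z => ‖F z - F q‖ :=
        (hF.contMDiff.continuous.sub continuous_const).norm
      refine hint (((hF.continuous_normalPart _).norm.pow 2).div
        (Continuous.rpow_const (by fun_prop) fun z => Or.inl ?_) fun z => ?_)
      · positivity
      · positivity
    -- For ε ≤ 1 the normal term is at least its value at ε = 1, so g is a minorant that survives
    -- the limit ε → 0.
    · have : ε ^ 2 ≤ 1 := pow_le_one₀ hε0.le hε1.le
      gcongr
  have hlim : Tendsto (fun c : ℝ => ((k : ℝ) + 1) *
      (c * volume.real (Metric.ball (0 : EuclideanSpace ℝ (Fin (k + 1))) 1) +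
      ∫ z, g z ∂(volMeasure k F))) (𝓝[<] 1) (𝓝 (((k : ℝ) + 1) *
      (1 * volume.real (Metric.ball (0 : EuclideanSpace ℝ (Fin (k + 1))) 1) +
      ∫ z, g z ∂(volMeasure k F)))) := by
    refine Tendsto.mono_left (Continuous.tendsto ?_ 1) nhdsWithin_le_nhds
    fun_prop
  rw [one_mul] at hlim
  exact le_of_tendsto hlim (by filter_upwards [self_mem_nhdsWithin] with c hc using key c hc)

theorem volume_real_ball_pos :
    0 < volume.real (Metric.ball (0 : EuclideanSpace ℝ (Fin (k + 1))) 1) :=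
  ENNReal.toReal_pos (Metric.measure_ball_pos _ _ one_pos).ne' measure_ball_lt_top.ne

theorem _root_.IsMinimalImmersion.mul_volume_ball_le' (hF : IsMinimalImmersion (k + 1) F)
    {q : M} (hq : (𝓡∂ (k + 1)).IsInteriorPoint q) {h : M → ℝ} (hh : Continuous h)
    (hb : ∀ z ∈ (𝓡∂ (k + 1)).boundary M, (‖F z - F q‖ ^ k)⁻¹ ≤ h z) :
    ((k : ℝ) + 1) * volume.real (Metric.ball (0 : EuclideanSpace ℝ (Fin (k + 1))) 1) ≤
      ∫ z, h z ∂(bdMeasure k F) := by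
  have := hF.mul_volume_ball_le hq hh hb (g := fun _ => 0) continuous_const
    fun z => by positivity
  simpa using this

variable {d : ℝ} {q : M}

/-- In the equality case the position vector is tangent. -/
theorem _root_.IsMinimalImmersion.normalPart_eq_zero (hF : IsMinimalImmersion (k + 1) F)
    (hq : (𝓡∂ (k + 1)).IsInteriorPoint q) (hd : 0 < d)
    (hdb : ∀ z ∈ (𝓡∂ (k + 1)).boundary M, d ≤ ‖F z - F q‖)
    (heq : (bdMeasure k F).real univ ≤
      d ^ k * (((k : ℝ) + 1) * volume.real (Metric.ball (0 : EuclideanSpace ℝ (Fin (k + 1))) 1)))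
    (z : M) : normalPart k F (F q) z = 0 := by
  have := isFiniteMeasure_volMeasure hF
  have := isOpenPosMeasure_volMeasure hF
  by_contra hz
  set g : M → ℝ := fun z =>
    ‖normalPart k F (F q) z‖ ^ 2 / (‖F z - F q‖ ^ 2 + 1) ^ (((k : ℝ) + 1) / 2 + 1) with hg'
  have hx : Continuous fun z => ‖F z - F q‖ :=
    (hF.contMDiff.continuous.sub continuous_const).norm
  have hg : Continuous g := by
    refine ((hF.continuous_normalPart _).norm.pow 2).div
      (Continuous.rpow_const (by fun_prop) fun z => Or.inl ?_) fun z => ?_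
    · positivity
    · positivity
  -- A continuous nonnegative g that is nonzero at one point has positive integral, because nonempty
  -- open sets have positive volume. This would make the density inequality strict.
  have hpos : 0 < ∫ z, g z ∂(volMeasure k F) := by
    refine hg.integral_pos_of_hasCompactSupport_nonneg_nonzero (HasCompactSupport.of_compactSpace _)
      (fun z => by positivity) (x := z) ?_
    have : ‖normalPart k F (F q) z‖ ≠ 0 := norm_ne_zero_iff.2 hz
    simp only [hg']
    positivity
  have h1 := hF.mul_volume_ball_le hq (h := fun _ => (d ^ k)⁻¹) continuous_const
    (fun z hz => by have := hdb z hz; gcongr) hg fun z => le_rfl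
  rw [integral_const, smul_eq_mul, ← div_eq_mul_inv, le_div_iff₀ (by positivity)] at h1
  have h2 : 0 < d ^ k * (((k : ℝ) + 1) * ∫ z, g z ∂(volMeasure k F)) := by positivity
  nlinarith

/-- In the equality case the centre is attained once. -/
theorem _root_.IsMinimalImmersion.eq_of_apply_eq (hF : IsMinimalImmersion (k + 1) F) [T2Space M]
    (hq : (𝓡∂ (k + 1)).IsInteriorPoint q) (hd : 0 < d)
    (hdb : ∀ z ∈ (𝓡∂ (k + 1)).boundary M, d ≤ ‖F z - F q‖)
    (heq : (bdMeasure k F).real univ ≤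
      d ^ k * (((k : ℝ) + 1) * volume.real (Metric.ball (0 : EuclideanSpace ℝ (Fin (k + 1))) 1)))
    {q' : M} (hq' : (𝓡∂ (k + 1)).IsInteriorPoint q') (hqq' : F q' = F q) : q' = q := by
  have := isFiniteMeasure_volMeasure hF
  by_contra hne
  obtain ⟨O', O, hO', hO, hq'O, hqO, hdisj⟩ := t2_separation hne
  -- Each preimage carries nearly a full mass in its own neighbourhood; any fraction above one half,
  -- here 3/4, makes the total exceed the mass allowed by equality.
  obtain ⟨ε, ⟨h1, h2⟩, hε⟩ := (((hF.eventually_le_integral_massKernel hq hO hqO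
    (show (3 / 4 : ℝ) < 1 by norm_num)).and (hF.eventually_le_integral_massKernel hq' hO' hq'O
    (show (3 / 4 : ℝ) < 1 by norm_num))).and self_mem_nhdsWithin).exists
  have hε0 : 0 < ε := hε
  rw [hqq'] at h2
  have hgi : Integrable (fun z => massKernel k ε ‖F z - F q‖) (volMeasure k F) :=
    ((continuous_massKernel hε0).comp
      (hF.contMDiff.continuous.sub continuous_const).norm).integrable_of_hasCompactSupport
      (HasCompactSupport.of_compactSpace _)
  have h3 : ∫ z in O' ∪ O, massKernel k ε ‖F z - F q‖ ∂(volMeasure k F) ≤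
      ∫ z, massKernel k ε ‖F z - F q‖ ∂(volMeasure k F) :=
    setIntegral_le_integral hgi (Eventually.of_forall fun z => massKernel_nonneg _ _)
  rw [setIntegral_union hdisj hO.measurableSet hgi.integrableOn hgi.integrableOn] at h3
  have h4 := hF.integral_massKernel_le hε0 (F q) (h := fun _ => (d ^ k)⁻¹) continuous_const
    (fun z hz => by have := hdb z hz; gcongr)
  rw [integral_const, smul_eq_mul, ← div_eq_mul_inv, le_div_iff₀ (by positivity)] at h4
  have h5 : 0 ≤ ∫ z, ‖normalPart k F (F q) z‖ ^ 2 /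
      (‖F z - F q‖ ^ 2 + ε ^ 2) ^ (((k : ℝ) + 1) / 2 + 1) ∂(volMeasure k F) :=
    integral_nonneg fun z => by positivity
  have h6 := volume_real_ball_pos (k := k)
  have h7 : 0 < d ^ k := by positivity
  have h8 : 3 / 2 * volume.real (Metric.ball (0 : EuclideanSpace ℝ (Fin (k + 1))) 1) ≤
      ∫ z, massKernel k ε ‖F z - F q‖ ∂(volMeasure k F) +
      ∫ z, ‖normalPart k F (F q) z‖ ^ 2 /
      (‖F z - F q‖ ^ 2 + ε ^ 2) ^ (((k : ℝ) + 1) / 2 + 1) ∂(volMeasure k F) := by linarith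
  have h9 := mul_le_mul_of_nonneg_left h8 (show 0 ≤ d ^ k * ((k : ℝ) + 1) by positivity)
  have h10 : 0 < d ^ k * ((k : ℝ) + 1) *
    volume.real (Metric.ball (0 : EuclideanSpace ℝ (Fin (k + 1))) 1) := by positivity
  linarith

/-- In the equality case the boundary lies on a sphere. -/
theorem _root_.IsMinimalImmersion.norm_sub_eq_of_mem_boundary (hF : IsMinimalImmersion (k + 1) F)
    (hk : k ≠ 0) (hq : (𝓡∂ (k + 1)).IsInteriorPoint q) (hd : 0 < d)
    (hdb : ∀ z ∈ (𝓡∂ (k + 1)).boundary M, d ≤ ‖F z - F q‖)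
    (heq : (bdMeasure k F).real univ ≤
      d ^ k * (((k : ℝ) + 1) * volume.real (Metric.ball (0 : EuclideanSpace ℝ (Fin (k + 1))) 1)))
    {z : M} (hz : z ∈ (𝓡∂ (k + 1)).boundary M) : ‖F z - F q‖ = d := by
  have := isFiniteMeasure_bdMeasure hF
  refine le_antisymm (not_lt.1 fun hlt => ?_) (hdb z hz)
  -- This equals |x|^(-k) on the boundary, never exceeds d^(-k), and is continuous also where F z =
  -- F q. Equality forces h = d^(-k) almost everywhere for the boundary measure.
  set h : M → ℝ := fun z => ((max ‖F z - F q‖ d) ^ k)⁻¹ with hh'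
  have hx : Continuous fun z => ‖F z - F q‖ :=
    (hF.contMDiff.continuous.sub continuous_const).norm
  have hm : ∀ z, 0 < max ‖F z - F q‖ d := fun z => lt_max_of_lt_right hd
  have hh : Continuous h := ((hx.max continuous_const).pow k).inv₀ fun z => (pow_pos (hm z) k).ne'
  have hint : ∀ {g : M → ℝ}, Continuous g → Integrable g (bdMeasure k F) :=
    fun hg => hg.integrable_of_hasCompactSupport (HasCompactSupport.of_compactSpace _)
  have h1 := hF.mul_volume_ball_le' hq hh fun y hy => by
    simp only [hh', max_eq_left (hdb y hy), le_refl]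
  have hle : ∀ y, 0 ≤ (d ^ k)⁻¹ - h y := fun y => by
    rw [sub_nonneg, hh']
    have := le_max_right ‖F y - F q‖ d
    simp only
    gcongr
  have h2 : ∫ y, ((d ^ k)⁻¹ - h y) ∂(bdMeasure k F) ≤ 0 := by
    rw [integral_sub (integrable_const _) (hint hh), integral_const, smul_eq_mul, sub_nonpos]
    refine le_trans ?_ h1
    rw [← div_eq_mul_inv, div_le_iff₀ (by positivity)]
    linarith
  have h3 := (integral_eq_zero_iff_of_nonneg hle (hint (continuous_const.sub hh))).1
    (le_antisymm h2 (integral_nonneg hle))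
  have hO : IsOpen {y | d < ‖F y - F q‖} := isOpen_lt continuous_const hx
  refine (bdMeasure_pos_of_isOpen hF hO hlt hz).ne' ?_
  rw [measure_eq_zero_iff_ae_notMem]
  filter_upwards [h3] with y hy hyO
  have hyO' : d < ‖F y - F q‖ := hyO
  have h4 : (d ^ k)⁻¹ = ((max ‖F y - F q‖ d) ^ k)⁻¹ := sub_eq_zero.1 hy
  rw [max_eq_left hyO'.le, inv_inj] at h4
  exact (pow_lt_pow_left₀ hyO' hd.le hk).ne h4

end Mass

theorem isInteriorPoint_of_notMem_boundary {k : ℕ} {M : Type*} [TopologicalSpace M]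
    [ChartedSpace (EuclideanHalfSpace (k + 1)) M] {z : M} (hz : z ∉ (𝓡∂ (k + 1)).boundary M) :
    (𝓡∂ (k + 1)).IsInteriorPoint z := by
  by_contra h
  exact hz ((𝓡∂ (k + 1)).isBoundaryPoint_iff_not_isInteriorPoint _ |>.2 h)

theorem unitBallVolume_eq {k : ℕ} : unitBallVolume (k + 1) =
    ENNReal.ofReal (volume.real (Metric.ball (0 : EuclideanSpace ℝ (Fin (k + 1))) 1)) :=
  (ENNReal.ofReal_toReal measure_ball_lt_top.ne).symm

theorem natCast_mul_unitBallVolume_eq {k : ℕ} : ((k + 1 : ℕ) : ℝ≥0∞) * unitBallVolume (k + 1) =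
    ENNReal.ofReal (((k : ℝ) + 1) *
      volume.real (Metric.ball (0 : EuclideanSpace ℝ (Fin (k + 1))) 1)) := by
  rw [ENNReal.ofReal_mul (by positivity), ← unitBallVolume_eq]
  congr 1
  rw [← ENNReal.ofReal_natCast]
  push_cast
  rfl

/-! ### The boundary inequality and its consequence for two boundary pieces. -/

section DensityInequality

variable {k n : ℕ} {M : Type*} [TopologicalSpace M]
  [ChartedSpace (EuclideanHalfSpace (k + 1)) M] [IsManifold (𝓡∂ (k + 1)) ∞ M]
  {F : M → EuclideanSpace ℝ (Fin n)}
  [PolishSpace M] [MeasurableSpace M] [BorelSpace M] [CompactSpace M]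

theorem _root_.IsMinimalImmersion.boundaryMeasure_eq_ofReal (hF : IsMinimalImmersion (k + 1) F) :
    boundaryMeasure (k + 1) F = ENNReal.ofReal ((bdMeasure k F).real univ) := by
  have := isFiniteMeasure_bdMeasure hF
  rw [hF.boundaryMeasure_eq, ofReal_measureReal]

/-- For an empty boundary h = 0 is an admissible majorant and the density inequality would give a
ball of nonpositive volume. As a result distances to the boundary image are finite. -/
theorem _root_.IsMinimalImmersion.boundary_nonempty [Nonempty M]
    (hF : IsMinimalImmersion (k + 1) F) : ((𝓡∂ (k + 1)).boundary M).Nonempty := by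
  obtain ⟨q, -, hq⟩ := exists_isInteriorPoint_mem (k := k) isOpen_univ
    (mem_univ (Classical.arbitrary M))
  by_contra! h
  have h1 := hF.mul_volume_ball_le' hq (h := fun _ => 0) continuous_const (by simp [h])
  have h2 := volume_real_ball_pos (k := k)
  rw [integral_zero] at h1
  have : 0 < ((k : ℝ) + 1) * volume.real (Metric.ball (0 : EuclideanSpace ℝ (Fin (k + 1))) 1) := by
    positivity
  linarith

theorem _root_.IsMinimalImmersion.exists_infEDist_eq (hF : IsMinimalImmersion (k + 1) F) {q : M}
    (hq : F q ∉ F '' (𝓡∂ (k + 1)).boundary M) :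
    ∃ d : ℝ, 0 < d ∧ Metric.infEDist (F q) (F '' (𝓡∂ (k + 1)).boundary M) = ENNReal.ofReal d ∧
      ∀ z ∈ (𝓡∂ (k + 1)).boundary M, d ≤ ‖F z - F q‖ := by
  have : Nonempty M := ⟨q⟩
  have hne := hF.boundary_nonempty.image F
  have hcl : IsClosed (F '' (𝓡∂ (k + 1)).boundary M) :=
    (isClosed_boundary.isCompact.image hF.contMDiff.continuous).isClosed
  refine ⟨Metric.infDist (F q) (F '' (𝓡∂ (k + 1)).boundary M),
    (hcl.notMem_iff_infDist_pos hne).1 hq, (ENNReal.ofReal_toReal (Metric.infEDist_ne_top hne)).symm,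
    fun z hz => ?_⟩
  rw [← dist_eq_norm, dist_comm]
  exact Metric.infDist_le_dist_of_mem (mem_image_of_mem F hz)

/-- The boundary of a minimal immersion is at least as large as that of the flat disk whose radius
is the distance from a point of the surface to the boundary. -/
theorem _root_.IsMinimalImmersion.le_boundaryMeasure (hF : IsMinimalImmersion (k + 1) F) (q : M) :
    ((k + 1 : ℕ) : ℝ≥0∞) * unitBallVolume (k + 1) *
      Metric.infEDist (F q) (F '' (𝓡∂ (k + 1)).boundary M) ^ k ≤ boundaryMeasure (k + 1) F := by
  rw [natCast_mul_unitBallVolume_eq, hF.boundaryMeasure_eq_ofReal]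
  rcases Nat.eq_zero_or_pos k with rfl | hk
  -- For k = 0 the power of the distance is 1, even at distance 0, so q may be replaced by any
  -- interior point.
  · obtain ⟨q', -, hq'⟩ := exists_isInteriorPoint_mem (k := 0) isOpen_univ (mem_univ q)
    have h1 := hF.mul_volume_ball_le' hq' (h := fun _ => 1) continuous_const (by simp)
    rw [pow_zero, mul_one]
    refine ENNReal.ofReal_le_ofReal (h1.trans ?_)
    simp
  by_cases hq : F q ∈ F '' (𝓡∂ (k + 1)).boundary M
  · rw [Metric.infEDist_zero_of_mem hq, zero_pow hk.ne', mul_zero]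
    exact zero_le
  · obtain ⟨d, hd, hd', hdb⟩ := hF.exists_infEDist_eq hq
    have h1 := hF.mul_volume_ball_le'
      (isInteriorPoint_of_notMem_boundary fun h => hq (mem_image_of_mem F h))
      (h := fun _ => (d ^ k)⁻¹) continuous_const
      fun z hz => by have := hdb z hz; gcongr
    rw [integral_const, smul_eq_mul, ← div_eq_mul_inv, le_div_iff₀ (by positivity)] at h1
    rw [hd', ← ENNReal.ofReal_pow hd.le, ← ENNReal.ofReal_mul (by positivity)]
    exact ENNReal.ofReal_le_ofReal h1

/-- The difference of the distances to the two boundary images is ≤ 0 on Γ₁ and ≥ 0 on Γ₂, so by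
connectedness it vanishes at some x. The distance from F x to the whole boundary image is then the
common value, and nearest points on the two images are at most twice that far apart. -/
theorem _root_.IsMinimalImmersion.iInf_edist_le (hF : IsMinimalImmersion (k + 1) F) (hk : k ≠ 0)
    [ConnectedSpace M] {Γ₁ Γ₂ : Set M} (h₁ : IsClosed Γ₁) (h₂ : IsClosed Γ₂) (hne₁ : Γ₁.Nonempty)
    (hne₂ : Γ₂.Nonempty) (hΓ : Γ₁ ∪ Γ₂ = (𝓡∂ (k + 1)).boundary M) :
    (⨅ x ∈ Γ₁, ⨅ y ∈ Γ₂, edist (F x) (F y)) ≤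
      2 * (boundaryMeasure (k + 1) F / (((k + 1 : ℕ) : ℝ≥0∞) * unitBallVolume (k + 1))) ^
        (1 / (k : ℝ)) := by
  have hFc := hF.contMDiff.continuous
  have hc₁ : IsCompact (F '' Γ₁) := h₁.isCompact.image hFc
  have hc₂ : IsCompact (F '' Γ₂) := h₂.isCompact.image hFc
  have hcont : Continuous fun x => Metric.infDist (F x) (F '' Γ₁) - Metric.infDist (F x) (F '' Γ₂) :=
    ((Metric.continuous_infDist_pt _).comp hFc).sub ((Metric.continuous_infDist_pt _).comp hFc)
  obtain ⟨a, ha⟩ := hne₁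
  obtain ⟨b, hb⟩ := hne₂
  obtain ⟨x, hx⟩ : (0 : ℝ) ∈ range fun x =>
      Metric.infDist (F x) (F '' Γ₁) - Metric.infDist (F x) (F '' Γ₂) := by
    refine mem_range_of_exists_le_of_exists_ge hcont ⟨a, ?_⟩ ⟨b, ?_⟩
    · simp only [Metric.infDist_zero_of_mem (mem_image_of_mem F ha), zero_sub]
      exact neg_nonpos.2 Metric.infDist_nonneg
    · simp only [Metric.infDist_zero_of_mem (mem_image_of_mem F hb), sub_zero]
      exact Metric.infDist_nonneg
  have hx' : Metric.infEDist (F x) (F '' Γ₁) = Metric.infEDist (F x) (F '' Γ₂) :=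
    (ENNReal.toReal_eq_toReal_iff' (Metric.infEDist_ne_top ⟨_, mem_image_of_mem F ha⟩)
      (Metric.infEDist_ne_top ⟨_, mem_image_of_mem F hb⟩)).1 (sub_eq_zero.1 hx)
  have hρ : Metric.infEDist (F x) (F '' (𝓡∂ (k + 1)).boundary M) =
      Metric.infEDist (F x) (F '' Γ₁) := by
    rw [← hΓ, image_union, Metric.infEDist_union, ← hx', min_self]
  have h1 := hF.le_boundaryMeasure x
  rw [hρ] at h1
  have hpos : ((k + 1 : ℕ) : ℝ≥0∞) * unitBallVolume (k + 1) ≠ 0 :=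
    mul_ne_zero (by simp) (Metric.measure_ball_pos _ _ one_pos).ne'
  have htop : ((k + 1 : ℕ) : ℝ≥0∞) * unitBallVolume (k + 1) ≠ ⊤ :=
    ENNReal.mul_ne_top (ENNReal.natCast_ne_top _) measure_ball_lt_top.ne
  have h2 : Metric.infEDist (F x) (F '' Γ₁) ≤
      (boundaryMeasure (k + 1) F / (((k + 1 : ℕ) : ℝ≥0∞) * unitBallVolume (k + 1))) ^
        (1 / (k : ℝ)) := by
    rw [one_div, ENNReal.le_rpow_inv_iff (by positivity), ENNReal.rpow_natCast,
      ENNReal.le_div_iff_mul_le (Or.inl hpos) (Or.inl htop), mul_comm]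
    exact h1
  obtain ⟨_, ⟨y₁, hy₁, rfl⟩, hxy₁⟩ := hc₁.exists_infEDist_eq_edist ⟨_, mem_image_of_mem F ha⟩ (F x)
  obtain ⟨_, ⟨y₂, hy₂, rfl⟩, hxy₂⟩ := hc₂.exists_infEDist_eq_edist ⟨_, mem_image_of_mem F hb⟩ (F x)
  calc (⨅ x ∈ Γ₁, ⨅ y ∈ Γ₂, edist (F x) (F y)) ≤ edist (F y₁) (F y₂) :=
        (iInf₂_le y₁ hy₁).trans (iInf₂_le y₂ hy₂)
    _ ≤ edist (F x) (F y₁) + edist (F x) (F y₂) := edist_triangle_left _ _ _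
    _ = 2 * Metric.infEDist (F x) (F '' Γ₁) := by
        rw [← hxy₁, ← hxy₂, ← hx', two_mul]
    _ ≤ _ := by gcongr

end DensityInequality

/-! ### First order conditions at a maximum, up to the boundary. -/

section Maximum

variable {k n : ℕ} {M : Type*} [TopologicalSpace M]
  [ChartedSpace (EuclideanHalfSpace (k + 1)) M] [IsManifold (𝓡∂ (k + 1)) ∞ M]
  {F : M → EuclideanSpace ℝ (Fin n)}

theorem eventually_of_eventually_chartInv {z : M} {P : M → Prop}
    (h : ∀ᶠ v in 𝓝[halfSpace k] (extChartAt (𝓡∂ (k + 1)) z z), P (chartInv k z v)) :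
    ∀ᶠ y in 𝓝 z, P y := by
  have hzs := mem_chart_source (EuclideanHalfSpace (k + 1)) z
  rw [← range_model, ← map_extChartAt_nhds z] at h
  filter_upwards [h, (chartAt (EuclideanHalfSpace (k + 1)) z).open_source.mem_nhds hzs]
    with y hy hys
  have h1 : P (chartInv k z (extChartAt (𝓡∂ (k + 1)) z y)) := hy
  rwa [chartInv_extChartAt hys] at h1

theorem _root_.IsMinimalImmersion.hasFDerivWithinAt_chart (hF : IsMinimalImmersion (k + 1) F)
    (z : M) : HasFDerivWithinAt (F ∘ chartInv k z) (chartDeriv k F z) (halfSpace k)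
      (extChartAt (𝓡∂ (k + 1)) z z) :=
  (hF.immersedPatch z).hasFDerivWithinAt (extChartAt_mem_chartDom (mem_chart_source _ z))

theorem isInteriorPoint_iff_extChartAt_pos (z : M) :
    (𝓡∂ (k + 1)).IsInteriorPoint z ↔ 0 < extChartAt (𝓡∂ (k + 1)) z z 0 := by
  have hzs := mem_chart_source (EuclideanHalfSpace (k + 1)) z
  rw [← isInteriorPoint_chartInv_iff (extChartAt_mem_chartDom hzs), chartInv_extChartAt hzs]

/-- The first order condition at a maximum, in a chart. -/
theorem _root_.IsMinimalImmersion.apply_halfDeriv_nonpos (hF : IsMinimalImmersion (k + 1) F)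
    {φ : EuclideanSpace ℝ (Fin n) → ℝ} {φ' : EuclideanSpace ℝ (Fin n) →L[ℝ] ℝ} {x : M}
    {u : EuclideanSpace ℝ (Fin (k + 1))} (hu : u ∈ chartDom x)
    (hφ : HasFDerivAt φ φ' (F (chartInv k x u))) (hmax : ∀ y, φ (F y) ≤ φ (F (chartInv k x u)))
    (v : EuclideanSpace ℝ (Fin (k + 1))) (hv : 0 < u 0 ∨ 0 ≤ v 0) :
    φ' (halfDeriv (F ∘ chartInv k x) u v) ≤ 0 := by
  have hu0 : 0 ≤ u 0 := chartDom_subset x hu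
  have h1 := HasFDerivAt.comp_hasFDerivWithinAt (f := F ∘ chartInv k x) u hφ
    ((hF.immersedPatch x).hasFDerivWithinAt hu)
  have h2 : IsLocalMaxOn (φ ∘ F ∘ chartInv k x) (halfSpace k) u :=
    Eventually.of_forall fun v => hmax _
  -- A vector v with v 0 < 0 is shortened so that the segment ends on the boundary hyperplane; this
  -- uses 0 < u 0.
  obtain ⟨t, ht, htv⟩ : ∃ t : ℝ, 0 < t ∧ u + t • v ∈ halfSpace k := by
    rcases le_or_gt 0 (v 0) with h | h
    · refine ⟨1, one_pos, ?_⟩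
      change 0 ≤ u 0 + 1 * v 0
      linarith
    · have hu1 : 0 < u 0 := hv.resolve_right h.not_ge
      refine ⟨u 0 / (-v 0), div_pos hu1 (by linarith), ?_⟩
      change 0 ≤ u 0 + u 0 / (-v 0) * v 0
      rw [div_neg, neg_mul, div_mul_cancel₀ _ h.ne]
      linarith
  have h3 := h2.hasFDerivWithinAt_nonpos h1 (mem_posTangentConeAt_of_segment_subset
    (convex_halfSpace.segment_subset (chartDom_subset x hu) htv))
  rw [ContinuousLinearMap.comp_apply, map_smul, map_smul, smul_eq_mul] at h3
  exact nonpos_of_mul_nonpos_right h3 ht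

/-- The first order condition at a maximum. -/
theorem _root_.IsMinimalImmersion.apply_chartDeriv_nonpos (hF : IsMinimalImmersion (k + 1) F)
    {φ : EuclideanSpace ℝ (Fin n) → ℝ} {φ' : EuclideanSpace ℝ (Fin n) →L[ℝ] ℝ} {z : M}
    (hφ : HasFDerivAt φ φ' (F z)) (hmax : ∀ y, φ (F y) ≤ φ (F z))
    (v : EuclideanSpace ℝ (Fin (k + 1))) (hv : (𝓡∂ (k + 1)).IsInteriorPoint z ∨ 0 ≤ v 0) :
    φ' (chartDeriv k F z v) ≤ 0 := by
  have hzs := mem_chart_source (EuclideanHalfSpace (k + 1)) z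
  have hzu := chartInv_extChartAt (k := k) hzs
  refine hF.apply_halfDeriv_nonpos (extChartAt_mem_chartDom hzs) (by rwa [hzu])
    (by rwa [hzu]) v ?_
  rwa [← isInteriorPoint_iff_extChartAt_pos]

end Maximum

/-! ### A cone with a smooth vertex is flat. -/

section Cone

variable {k n : ℕ} {M : Type*} [TopologicalSpace M]
  [ChartedSpace (EuclideanHalfSpace (k + 1)) M] [IsManifold (𝓡∂ (k + 1)) ∞ M]
  {F : M → EuclideanSpace ℝ (Fin n)} {p : EuclideanSpace ℝ (Fin n)} {d : ℝ}

theorem hasFDerivAt_norm_sub_sq (p y : EuclideanSpace ℝ (Fin n)) :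
    HasFDerivAt (fun y => ‖y - p‖ ^ 2) (2 • innerSL ℝ (y - p)) y :=
  ((hasFDerivAt_id y).sub_const p).norm_sq

/-- At a maximum of the distance to `p` the position vector is orthogonal to the inward tangent
vectors. -/
theorem _root_.IsMinimalImmersion.inner_chartDeriv_nonpos (hF : IsMinimalImmersion (k + 1) F)
    {z : M} (hmax : ∀ y, ‖F y - p‖ ≤ ‖F z - p‖) (v : EuclideanSpace ℝ (Fin (k + 1)))
    (hv : (𝓡∂ (k + 1)).IsInteriorPoint z ∨ 0 ≤ v 0) :
    inner ℝ (F z - p) (chartDeriv k F z v) ≤ 0 := by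
  have h1 := hF.apply_chartDeriv_nonpos (hasFDerivAt_norm_sub_sq p (F z))
    (fun y => pow_le_pow_left₀ (norm_nonneg _) (hmax y) 2) v hv
  rw [_root_.smul_apply, innerSL_apply_apply, two_smul] at h1
  linarith

/-- The tangent vector F z - p is itself a direction in which the distance to p grows, unless it is
zero. -/
theorem _root_.IsMinimalImmersion.apply_eq_of_isInteriorPoint_of_max
    (hF : IsMinimalImmersion (k + 1) F) {z : M} (hz : (𝓡∂ (k + 1)).IsInteriorPoint z)
    (hmax : ∀ y, ‖F y - p‖ ≤ ‖F z - p‖)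
    (hr : F z - p ∈ (chartDeriv k F z :
      EuclideanSpace ℝ (Fin (k + 1)) →ₗ[ℝ] EuclideanSpace ℝ (Fin n)).range) : F z = p := by
  obtain ⟨ξ, hξ⟩ := hr
  have h1 := hF.inner_chartDeriv_nonpos hmax ξ (Or.inl hz)
  rw [show chartDeriv k F z ξ = F z - p from hξ, real_inner_self_eq_norm_sq] at h1
  have h2 : ‖F z - p‖ = 0 := by nlinarith [norm_nonneg (F z - p)]
  exact sub_eq_zero.1 (norm_eq_zero.1 h2)

theorem mem_range_chartDeriv_of_normalPart_eq_zero {z : M} (hz : normalPart k F p z = 0) :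
    F z - p ∈ (chartDeriv k F z :
      EuclideanSpace ℝ (Fin (k + 1)) →ₗ[ℝ] EuclideanSpace ℝ (Fin n)).range :=
  ⟨pinv (chartDeriv k F z) (F z - p), (sub_eq_zero.1 hz).symm⟩

variable [CompactSpace M]

/-- An interior point at maximal distance would be mapped to p, but boundary points lie at distance
d > 0; so the maximum is on the boundary. -/
theorem _root_.IsMinimalImmersion.norm_sub_le_of_cone (hF : IsMinimalImmersion (k + 1) F)
    (hn : ∀ z, normalPart k F p z = 0) (hd : 0 < d)
    (hb : ∀ z ∈ (𝓡∂ (k + 1)).boundary M, ‖F z - p‖ = d)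
    (hne : ((𝓡∂ (k + 1)).boundary M).Nonempty) (z : M) : ‖F z - p‖ ≤ d := by
  obtain ⟨b, hbm⟩ := hne
  have hx : Continuous fun z => ‖F z - p‖ := (hF.contMDiff.continuous.sub continuous_const).norm
  obtain ⟨y, -, hy⟩ := isCompact_univ.exists_isMaxOn ⟨z, mem_univ z⟩ hx.continuousOn
  have hmax : ∀ w, ‖F w - p‖ ≤ ‖F y - p‖ := fun w => hy (mem_univ w)
  by_cases hyb : y ∈ (𝓡∂ (k + 1)).boundary M
  · exact (hmax z).trans (hb y hyb).le
  · have h1 := hF.apply_eq_of_isInteriorPoint_of_max (isInteriorPoint_of_notMem_boundary hyb) hmax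
      (mem_range_chartDeriv_of_normalPart_eq_zero (hn y))
    have h2 := hmax b
    rw [hb b hbm, h1, sub_self, norm_zero] at h2
    linarith

theorem _root_.IsMinimalImmersion.norm_sub_lt_of_cone (hF : IsMinimalImmersion (k + 1) F)
    (hn : ∀ z, normalPart k F p z = 0) (hd : 0 < d) (hle : ∀ z, ‖F z - p‖ ≤ d) {z : M}
    (hz : (𝓡∂ (k + 1)).IsInteriorPoint z) : ‖F z - p‖ < d := by
  refine lt_of_le_of_ne (hle z) fun h => ?_
  have h1 := hF.apply_eq_of_isInteriorPoint_of_max hz (fun y => (hle y).trans h.ge)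
    (mem_range_chartDeriv_of_normalPart_eq_zero (hn z))
  rw [h1, sub_self, norm_zero] at h
  exact hd.ne h

/-- The normal component to the tangent space at a point vanishes to first order there. -/
theorem _root_.IsMinimalImmersion.eventually_norm_starProjection_le
    (hF : IsMinimalImmersion (k + 1) F) (q : M) {e : ℝ} (he : 0 < e) (he1 : e ≤ 1) :
    ∀ᶠ y in 𝓝 q, ‖((chartDeriv k F q : EuclideanSpace ℝ (Fin (k + 1)) →ₗ[ℝ]
      EuclideanSpace ℝ (Fin n)).range)ᗮ.starProjection (F y - F q)‖ ≤ e * ‖F y - F q‖ := by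
  refine eventually_of_eventually_chartInv (k := k) ?_
  have hqs := mem_chart_source (EuclideanHalfSpace (k + 1)) q
  set u := extChartAt (𝓡∂ (k + 1)) q q with hu'
  have hu : u ∈ chartDom q := extChartAt_mem_chartDom hqs
  have hqu : chartInv k q u = q := chartInv_extChartAt hqs
  set A := chartDeriv k F q with hA
  set C := ‖pinv A‖ + 1 with hC
  have hC0 : 0 < C := by positivity
  -- Since ‖v - u‖ ≤ C ‖A (v - u)‖, this error is at most e/2 · ‖A (v - u)‖, and e ≤ 1 then gives ‖A
  -- (v - u)‖ ≤ 2 ‖x‖.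
  obtain ⟨r, hr, -, hr'⟩ := (hF.immersedPatch q).exists_approx hu (ε := e / (2 * C)) (by positivity)
  have hmem : Metric.ball u r ∩ halfSpace k ∈ 𝓝[halfSpace k] u :=
    inter_mem (mem_nhdsWithin_of_mem_nhds (Metric.ball_mem_nhds u hr)) self_mem_nhdsWithin
  filter_upwards [hmem] with v hv
  have h1 := hr' v hv u ⟨Metric.mem_ball_self hr, chartDom_subset q hu⟩
  simp only [Function.comp_apply, hqu] at h1
  change ‖F (chartInv k q v) - F q - A (v - u)‖ ≤ _ at h1
  set x := F (chartInv k q v) - F q with hx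
  have h2 : ‖v - u‖ ≤ C * ‖A (v - u)‖ := by
    have h3 := (pinv A).le_opNorm (A (v - u))
    rw [pinv_apply_self (hF.injective_chartDeriv q)] at h3
    nlinarith [norm_nonneg (A (v - u))]
  have h4 : ‖A (v - u)‖ ≤ ‖x‖ + ‖x - A (v - u)‖ := by
    have := norm_sub_le x (x - A (v - u))
    rwa [sub_sub_cancel] at this
  have h5 : e / (2 * C) * ‖v - u‖ ≤ e / 2 * ‖A (v - u)‖ := by
    calc e / (2 * C) * ‖v - u‖ ≤ e / (2 * C) * (C * ‖A (v - u)‖) := by gcongr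
      _ = _ := by field_simp
  have h6 : ‖A (v - u)‖ ≤ 2 * ‖x‖ := by nlinarith [norm_nonneg (A (v - u))]
  have h7 : ((A : EuclideanSpace ℝ (Fin (k + 1)) →ₗ[ℝ] EuclideanSpace ℝ (Fin n)).range)ᗮ.starProjection
      (A (v - u)) = 0 := by
    rw [Submodule.starProjection_apply_eq_zero_iff, Submodule.orthogonal_orthogonal]
    exact ⟨v - u, rfl⟩
  calc _ = ‖((A : EuclideanSpace ℝ (Fin (k + 1)) →ₗ[ℝ]
        EuclideanSpace ℝ (Fin n)).range)ᗮ.starProjection (x - A (v - u))‖ := by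
        rw [map_sub _ x, h7, sub_zero]
    _ ≤ ‖x - A (v - u)‖ := Submodule.norm_starProjection_apply_le _ _
    _ ≤ e / 2 * ‖A (v - u)‖ := h1.trans h5
    _ ≤ e / 2 * (2 * ‖x‖) := by gcongr
    _ = _ := by ring

/-- A conical minimal immersion with regular vertex and boundary on a sphere lies in a plane. -/
theorem _root_.IsMinimalImmersion.sub_mem_range_of_cone (hF : IsMinimalImmersion (k + 1) F)
    {q : M} (hn : ∀ z, normalPart k F (F q) z = 0)
    (hb : ∀ z ∈ (𝓡∂ (k + 1)).boundary M, ‖F z - F q‖ = d)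
    (hle : ∀ z, ‖F z - F q‖ ≤ d) (huniq : ∀ z, F z = F q → z = q) (z : M) :
    F z - F q ∈ (chartDeriv k F q : EuclideanSpace ℝ (Fin (k + 1)) →ₗ[ℝ]
      EuclideanSpace ℝ (Fin n)).range := by
  set V := (chartDeriv k F q : EuclideanSpace ℝ (Fin (k + 1)) →ₗ[ℝ]
      EuclideanSpace ℝ (Fin n)).range with hV
  set Q := Vᗮ.starProjection with hQ
  have hx : Continuous fun z => F z - F q := hF.contMDiff.continuous.sub continuous_const
  -- The quotient |Q x|² / |x|² is constant to first order in the radial direction. The added fourth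
  -- power makes K strictly decrease outwards wherever it is positive, so a positive maximum is
  -- impossible. At q the value 0 / 0 = 0 is the right one, since Q x is of smaller order than |x|.
  set K : M → ℝ := fun z => ‖Q (F z - F q)‖ ^ 2 / (‖F z - F q‖ ^ 2 + (‖F z - F q‖ ^ 2) ^ 2) with hK
  have hKc : Continuous K := by
    refine continuous_iff_continuousAt.2 fun y => ?_
    rcases eq_or_ne y q with rfl | hy
    · rw [Metric.continuousAt_iff']
      intro ε hε
      set e := min 1 (ε / 2) with he
      have he0 : 0 < e := lt_min one_pos (by linarith)
      have he1 : e ≤ 1 := min_le_left _ _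
      have he2 : e ≤ ε / 2 := min_le_right _ _
      filter_upwards [hF.eventually_norm_starProjection_le y he0 he1] with w hw
      have hKy : K y = 0 := by simp [hK]
      have hKw : 0 ≤ K w := by positivity
      rw [hKy, Real.dist_0_eq_abs, abs_of_nonneg hKw]
      have h1 : K w ≤ e ^ 2 := by
        refine div_le_of_le_mul₀ (by positivity) (by positivity) ?_
        have h2 := pow_le_pow_left₀ (norm_nonneg _) hw 2
        rw [mul_pow] at h2
        refine h2.trans (mul_le_mul_of_nonneg_left ?_ (by positivity))
        nlinarith [sq_nonneg (‖F w - F y‖ ^ 2)]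
      nlinarith
    · have h0 : F y - F q ≠ 0 := fun h => hy (huniq y (sub_eq_zero.1 h))
      have h1 : ‖F y - F q‖ ^ 2 + (‖F y - F q‖ ^ 2) ^ 2 ≠ 0 := by positivity
      exact ContinuousAt.div ((Q.continuous.comp hx).norm.pow 2).continuousAt
        ((hx.norm.pow 2).add ((hx.norm.pow 2).pow 2)).continuousAt h1
  obtain ⟨y, -, hy⟩ := isCompact_univ.exists_isMaxOn ⟨z, mem_univ z⟩ hKc.continuousOn
  have hmax : ∀ w, K w ≤ K y := fun w => hy (mem_univ w)
  have hmem : ∀ w, Q w = 0 → w ∈ V := fun w hw => by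
    rwa [hQ, Submodule.starProjection_apply_eq_zero_iff, Submodule.orthogonal_orthogonal] at hw
  by_cases hzq : z = q
  · rw [hzq, sub_self]
    exact zero_mem _
  have hden : ∀ w, w ≠ q → 0 < ‖F w - F q‖ ^ 2 + (‖F w - F q‖ ^ 2) ^ 2 := fun w hw => by
    have h0 : F w - F q ≠ 0 := fun h => hw (huniq w (sub_eq_zero.1 h))
    positivity
  rcases (show 0 ≤ K y by positivity).eq_or_lt with h0 | hpos
  · have h1 := hmax z
    rw [← h0] at h1
    have h2 : ‖Q (F z - F q)‖ ^ 2 ≤ 0 := by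
      have := (div_le_iff₀ (hden z hzq)).1 h1
      rwa [zero_mul] at this
    exact hmem _ (norm_eq_zero.1 (by nlinarith [norm_nonneg (Q (F z - F q))]))
  · exfalso
    have hyq : y ≠ q := by
      rintro rfl
      simp [hK] at hpos
    set c := K y with hc
    set x := F y - F q with hx'
    have hxne : 0 < ‖x‖ := norm_pos_iff.2 fun h => hyq (huniq y (sub_eq_zero.1 h))
    have heq : ‖Q x‖ ^ 2 = c * (‖x‖ ^ 2 + (‖x‖ ^ 2) ^ 2) := by
      rw [hc, hK]
      simp only
      rw [← hx', div_mul_cancel₀ _ (hden y hyq).ne']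
    -- Maximality of the quotient at y says that numerator minus c times denominator is maximal,
    -- with value 0, at y.
    have hφ : HasFDerivAt (fun w : EuclideanSpace ℝ (Fin n) =>
        ‖Q (w - F q)‖ ^ 2 - c * (‖w - F q‖ ^ 2 + (‖w - F q‖ ^ 2) ^ 2))
        (2 • (innerSL ℝ (Q x)).comp Q - c • (2 • innerSL ℝ x +
          (2 * ‖x‖ ^ 2) • (2 • innerSL ℝ x))) (F y) := by
      have h1 := hasFDerivAt_norm_sub_sq (F q) (F y)
      have h2 : HasFDerivAt (fun w => Q (w - F q)) Q (F y) :=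
        Q.hasFDerivAt.comp (F y) ((hasFDerivAt_id (F y)).sub_const (F q))
      have h3 := h1.pow 2
      refine (h2.norm_sq.sub ((h1.add h3).const_mul c)).congr_fderiv ?_
      ext1 w
      simp [hx']
    obtain ⟨ξ, hξ⟩ := mem_range_chartDeriv_of_normalPart_eq_zero (hn y)
    have hξ' : chartDeriv k F y ξ = x := hξ
    -- At a boundary point the distance to the vertex is maximal, so the outward radial vector
    -- cannot point into M and its negative does.
    have hdir : (𝓡∂ (k + 1)).IsInteriorPoint y ∨ 0 ≤ (-ξ) 0 := by
      by_cases hyb : y ∈ (𝓡∂ (k + 1)).boundary M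
      · right
        by_contra! hlt
        have h1 : 0 ≤ ξ 0 := by
          rw [PiLp.neg_apply] at hlt
          linarith
        have h2 := hF.inner_chartDeriv_nonpos (fun w => (hle w).trans (hb y hyb).ge) ξ (Or.inr h1)
        rw [hξ', real_inner_self_eq_norm_sq] at h2
        nlinarith
      · exact Or.inl (isInteriorPoint_of_notMem_boundary hyb)
    have h1 := hF.apply_chartDeriv_nonpos hφ (fun w => ?_) (-ξ) hdir
    · rw [map_neg, hξ', map_neg] at h1
      simp only [_root_.sub_apply, _root_.smul_apply, _root_.add_apply,
        ContinuousLinearMap.comp_apply, innerSL_apply_apply, real_inner_self_eq_norm_sq,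
        nsmul_eq_mul, smul_eq_mul, heq] at h1
      push_cast at h1
      -- By heq the derivative in the direction -x is 2 c ‖x‖⁴, which contradicts h1.
      have h2 : 0 < c * (‖x‖ ^ 2) ^ 2 := by positivity
      nlinarith
    · rw [heq, sub_self]
      rcases eq_or_ne w q with rfl | hw
      · simp
      · have := (div_le_iff₀ (hden w hw)).1 (hmax w)
        linarith

end Cone

/-! ### Planar immersions over a disk: covering arguments. -/

section Planar

variable {k n : ℕ} {M : Type*} [TopologicalSpace M]
  [ChartedSpace (EuclideanHalfSpace (k + 1)) M] [IsManifold (𝓡∂ (k + 1)) ∞ M]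
  {F : M → EuclideanSpace ℝ (Fin n)} {p : EuclideanSpace ℝ (Fin n)} {d : ℝ}
  {V : Submodule ℝ (EuclideanSpace ℝ (Fin n))}

theorem _root_.IsMinimalImmersion.chartDeriv_mem (hF : IsMinimalImmersion (k + 1) F)
    (hV : ∀ z, F z - p ∈ V) (z : M) (v : EuclideanSpace ℝ (Fin (k + 1))) :
    chartDeriv k F z v ∈ V := by
  have hu := extChartAt_mem_chartDom (k := k) (mem_chart_source (EuclideanHalfSpace (k + 1)) z)
  have hmem : ∀ w, Vᗮ.starProjection w = 0 ↔ w ∈ V := fun w => by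
    rw [Submodule.starProjection_apply_eq_zero_iff, Submodule.orthogonal_orthogonal]
  have h1 := (Vᗮ.starProjection.hasFDerivAt).comp_hasFDerivWithinAt _ (hF.hasFDerivWithinAt_chart z)
  have h2 : (⇑Vᗮ.starProjection ∘ F ∘ chartInv k z) = fun _ => Vᗮ.starProjection p := by
    funext w
    have h3 := (hmem _).2 (hV (chartInv k z w))
    rw [map_sub, sub_eq_zero] at h3
    exact h3
  rw [h2] at h1
  have h3 := (uniqueDiffOn_halfSpace _ (chartDom_subset z hu)).eq h1 (hasFDerivWithinAt_const _ _ _)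
  rw [← hmem]
  exact DFunLike.congr_fun h3 v

theorem _root_.IsMinimalImmersion.range_chartDeriv_eq (hF : IsMinimalImmersion (k + 1) F)
    (hVk : finrank ℝ V = k + 1) (hV : ∀ z, F z - p ∈ V) (z : M) :
    (chartDeriv k F z : EuclideanSpace ℝ (Fin (k + 1)) →ₗ[ℝ] EuclideanSpace ℝ (Fin n)).range = V := by
  refine Submodule.eq_of_le_of_finrank_eq ?_ ?_
  · rintro _ ⟨v, rfl⟩
    exact hF.chartDeriv_mem hV z v
  · rw [hVk, LinearMap.finrank_range_of_inj (hF.injective_chartDeriv z), finrank_euclideanSpace_fin]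

/-- The coordinates in `V` of the position vector. -/
noncomputable def planarMap (V : Submodule ℝ (EuclideanSpace ℝ (Fin n)))
    (p : EuclideanSpace ℝ (Fin n)) (F : M → EuclideanSpace ℝ (Fin n)) (z : M) : V :=
  V.orthogonalProjectionOnto (F z - p)

theorem coe_planarMap (hV : ∀ z, F z - p ∈ V) (z : M) : (planarMap V p F z : EuclideanSpace ℝ (Fin n)) =
    F z - p :=
  Submodule.starProjection_eq_self_iff.2 (hV z)

theorem norm_planarMap (hV : ∀ z, F z - p ∈ V) (z : M) : ‖planarMap V p F z‖ = ‖F z - p‖ := by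
  rw [← coe_planarMap hV, Submodule.coe_norm]

theorem planarMap_eq_iff (hV : ∀ z, F z - p ∈ V) (y z : M) :
    planarMap V p F y = planarMap V p F z ↔ F y = F z := by
  rw [Subtype.ext_iff, coe_planarMap hV, coe_planarMap hV, sub_left_inj]

theorem continuous_planarMap (hF : Continuous F) : Continuous (planarMap V p F) :=
  V.orthogonalProjectionOnto.continuous.comp (hF.sub continuous_const)

/-- A planar minimal immersion is open at interior points. -/
theorem _root_.IsMinimalImmersion.image_planarMap_mem_nhds (hF : IsMinimalImmersion (k + 1) F)
    (hVk : finrank ℝ V = k + 1) (hV : ∀ z, F z - p ∈ V) {z : M}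
    (hz : (𝓡∂ (k + 1)).IsInteriorPoint z) {O : Set M} (hO : O ∈ 𝓝 z) :
    planarMap V p F '' O ∈ 𝓝 (planarMap V p F z) := by
  have hzs := mem_chart_source (EuclideanHalfSpace (k + 1)) z
  set u := extChartAt (𝓡∂ (k + 1)) z z with hu'
  have hu : u ∈ chartDom z := extChartAt_mem_chartDom hzs
  have hzu : chartInv k z u = z := chartInv_extChartAt hzs
  have hu0 : 0 < u 0 := (isInteriorPoint_iff_extChartAt_pos z).1 hz
  have hH := halfSpace_mem_nhds hu0
  have h1 : HasStrictFDerivAt (F ∘ chartInv k z) (chartDeriv k F z) u := by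
    refine (((hF.immersedPatch z).contDiffWithinAt u hu).contDiffAt hH).hasStrictFDerivAt' ?_ (by simp)
    exact (hF.hasFDerivWithinAt_chart z).hasFDerivAt hH
  have h2 : HasStrictFDerivAt (planarMap V p F ∘ chartInv k z)
      (V.orthogonalProjectionOnto ∘L chartDeriv k F z) u :=
    V.orthogonalProjectionOnto.hasStrictFDerivAt.comp u (h1.sub_const p)
  have h3 : Function.Injective (V.orthogonalProjectionOnto ∘L chartDeriv k F z) := fun a b hab => by
    apply hF.injective_chartDeriv z
    have h4 := congrArg (Subtype.val) hab
    have h5 : ∀ v, ((V.orthogonalProjectionOnto (chartDeriv k F z v) : V) : EuclideanSpace ℝ (Fin n)) =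
        chartDeriv k F z v := fun v =>
      Submodule.starProjection_eq_self_iff.2 (hF.chartDeriv_mem hV z v)
    simp only [ContinuousLinearMap.comp_apply] at h4
    rwa [h5, h5] at h4
  -- Domain and target have the same dimension, so the injective derivative is onto and the inverse
  -- function theorem gives openness.
  have h6 : ((V.orthogonalProjectionOnto ∘L chartDeriv k F z :
      EuclideanSpace ℝ (Fin (k + 1)) →L[ℝ] V) : EuclideanSpace ℝ (Fin (k + 1)) →ₗ[ℝ] V).range = ⊤ := by
    rw [LinearMap.range_eq_top]
    refine (LinearMap.injective_iff_surjective_of_finrank_eq_finrank ?_).1 h3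
    rw [hVk, finrank_euclideanSpace_fin]
  have h7 := h2.map_nhds_eq_of_surj h6
  have h8 : ∀ᶠ v in 𝓝 u, v ∈ chartDom z ∧ chartInv k z v ∈ O := by
    have := eventually_chartInv_mem hu (by rwa [hzu])
    rwa [nhdsWithin_eq_nhds.2 hH] at this
  have h9 := image_mem_map (m := planarMap V p F ∘ chartInv k z) h8
  rw [h7, Function.comp_apply, hzu] at h9
  refine mem_of_superset h9 ?_
  rintro _ ⟨v, hv, rfl⟩
  exact ⟨_, hv.2, rfl⟩

variable [CompactSpace M] [T2Space M]

/-- Compactness of M makes the map closed, so fibres over nearby points stay in any open set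
containing the fibre over v. -/
theorem eventually_fiber (hF : Continuous F) {v : V} {O : Set M} (hO : IsOpen O)
    (hv : ∀ z, planarMap V p F z = v → z ∈ O) :
    ∀ᶠ w in 𝓝 v, ∀ z, planarMap V p F z = w → z ∈ O := by
  have hc := (continuous_planarMap (V := V) (p := p) hF).isClosedMap
  have h1 : IsClosed (planarMap V p F '' Oᶜ) := hc _ hO.isClosed_compl
  have h2 : v ∉ planarMap V p F '' Oᶜ := fun ⟨z, hz, hzv⟩ => hz (hv z hzv)
  filter_upwards [h1.isOpen_compl.mem_nhds h2] with w hw z hz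
  by_contra hzO
  exact hw ⟨z, hzO, hz⟩

/-- Over the open disk a planar minimal immersion with one vertex is injective. -/
theorem _root_.IsMinimalImmersion.eq_of_norm_lt (hF : IsMinimalImmersion (k + 1) F)
    (hVk : finrank ℝ V = k + 1) (hV : ∀ z, F z - p ∈ V)
    (hb : ∀ z ∈ (𝓡∂ (k + 1)).boundary M, ‖F z - p‖ = d)
    (huniq : ∀ y z, F y = p → F z = p → y = z) (hd : 0 < d) {a b : M}
    (ha : ‖F a - p‖ < d) (hab : F a = F b) : a = b := by
  set G := planarMap V p F with hG
  have hint : ∀ z, ‖G z‖ < d → (𝓡∂ (k + 1)).IsInteriorPoint z := fun z hz =>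
    isInteriorPoint_of_notMem_boundary fun h => by
      rw [norm_planarMap hV, hb z h] at hz
      exact lt_irrefl _ hz
  have hpre : IsPreconnected (Metric.ball (0 : V) d) := (convex_ball _ _).isPreconnected
  by_contra hne
  -- At most one preimage versus at least two. Local injectivity with compactness makes S₁ open,
  -- openness of the map at interior points makes S₂ open; the ball is connected and its centre lies
  -- in S₁.
  set S₁ := {v ∈ Metric.ball (0 : V) d | ∀ y z, G y = v → G z = v → y = z} with hS₁
  set S₂ := {v ∈ Metric.ball (0 : V) d | ∃ y z, G y = v ∧ G z = v ∧ y ≠ z} with hS₂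
  have hS₁o : IsOpen S₁ := by
    rw [isOpen_iff_mem_nhds]
    rintro v ⟨hv, hvu⟩
    have hball := Metric.isOpen_ball.mem_nhds hv
    by_cases hex : ∃ y, G y = v
    · obtain ⟨y, hy⟩ := hex
      obtain ⟨N, hN, hNi⟩ := hF.exists_injOn_nhds y
      obtain ⟨O, hON, hO, hyO⟩ := mem_nhds_iff.1 hN
      have h1 := eventually_fiber (F := F) (p := p) hF.contMDiff.continuous hO
        (v := v) fun z hz => by rwa [hvu z y hz hy]
      filter_upwards [hball, h1] with w hw hwO
      refine ⟨hw, fun y' z' hy' hz' => hNi (hON (hwO y' hy')) (hON (hwO z' hz')) ?_⟩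
      exact (planarMap_eq_iff hV _ _).1 (hy'.trans hz'.symm)
    · have h1 := eventually_fiber (F := F) (p := p) hF.contMDiff.continuous isOpen_empty
        (v := v) fun z hz => (hex ⟨z, hz⟩).elim
      filter_upwards [hball, h1] with w hw hwO
      exact ⟨hw, fun y' _ hy' _ => (hwO y' hy').elim⟩
  have hS₂o : IsOpen S₂ := by
    rw [isOpen_iff_mem_nhds]
    rintro v ⟨hv, y, z, hy, hz, hyz⟩
    obtain ⟨O, O', hO, hO', hyO, hzO', hdisj⟩ := t2_separation hyz
    have hv' : ‖v‖ < d := by simpa using hv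
    have h1 := hF.image_planarMap_mem_nhds hVk hV (hint y (by rwa [hy])) (hO.mem_nhds hyO)
    have h2 := hF.image_planarMap_mem_nhds hVk hV (hint z (by rwa [hz])) (hO'.mem_nhds hzO')
    rw [← hG, hy] at h1
    rw [← hG, hz] at h2
    filter_upwards [Metric.isOpen_ball.mem_nhds hv, h1, h2] with w hw hw1 hw2
    obtain ⟨y', hy', hyw⟩ := hw1
    obtain ⟨z', hz', hzw⟩ := hw2
    exact ⟨hw, y', z', hyw, hzw, hdisj.ne_of_mem hy' hz'⟩
  have hzero : ∀ z, G z = 0 → F z = p := fun z hz => by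
    have := coe_planarMap (F := F) hV z
    rw [← hG, hz] at this
    exact (sub_eq_zero.1 this.symm)
  have hGa : G a ∈ Metric.ball (0 : V) d := by
    rw [mem_ball_zero_iff, norm_planarMap hV]
    exact ha
  obtain ⟨w, -, hw1, hw2⟩ := hpre S₁ S₂ hS₁o hS₂o (fun v hv => by
      by_cases h : ∀ y z, G y = v → G z = v → y = z
      · exact Or.inl ⟨hv, h⟩
      · push Not at h
        obtain ⟨y, z, h1, h2, h3⟩ := h
        exact Or.inr ⟨hv, y, z, h1, h2, h3⟩)
    ⟨0, Metric.mem_ball_self hd, Metric.mem_ball_self hd, fun y z hy hz =>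
      huniq y z (hzero y hy) (hzero z hz)⟩
    ⟨G a, hGa, hGa, a, b, rfl, ((planarMap_eq_iff hV _ _).2 hab).symm, hne⟩
  obtain ⟨-, y, z, hy, hz, hyz⟩ := hw2
  exact hyz (hw1.2 y z hy hz)

/-- The image of a planar minimal immersion contains the closed disk. -/
theorem _root_.IsMinimalImmersion.exists_eq_of_norm_le (hF : IsMinimalImmersion (k + 1) F)
    (hVk : finrank ℝ V = k + 1) (hV : ∀ z, F z - p ∈ V)
    (hb : ∀ z ∈ (𝓡∂ (k + 1)).boundary M, ‖F z - p‖ = d) (hd : 0 < d) {q : M} (hq : F q = p)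
    {y : EuclideanSpace ℝ (Fin n)} (hy : y - p ∈ V) (hyd : ‖y - p‖ ≤ d) : y ∈ range F := by
  set G := planarMap V p F with hG
  have hGc : Continuous G := continuous_planarMap hF.contMDiff.continuous
  have hcl : IsClosed (range G) := (isCompact_range hGc).isClosed
  have hint : ∀ z, ‖G z‖ < d → (𝓡∂ (k + 1)).IsInteriorPoint z := fun z hz =>
    isInteriorPoint_of_notMem_boundary fun h => by
      rw [norm_planarMap hV, hb z h] at hz
      exact lt_irrefl _ hz
  have hpre : IsPreconnected (Metric.ball (0 : V) d) := (convex_ball _ _).isPreconnected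
  have hGq : G q = 0 := by
    rw [← norm_eq_zero, norm_planarMap hV, hq, sub_self, norm_zero]
  have hball : Metric.ball (0 : V) d ⊆ range G := by
    -- Points over the open ball are interior points of M, so the image is open there; it is also
    -- closed by compactness.
    have ho : IsOpen (range G ∩ Metric.ball (0 : V) d) := by
      rw [isOpen_iff_mem_nhds]
      rintro _ ⟨⟨z, rfl⟩, hz⟩
      have h1 := hF.image_planarMap_mem_nhds hVk hV (hint z (by simpa using hz)) univ_mem
      rw [image_univ] at h1
      exact inter_mem h1 (Metric.isOpen_ball.mem_nhds hz)
    by_contra hnot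
    obtain ⟨w, hwb, hw⟩ := not_subset.1 hnot
    obtain ⟨v, hv, hv1, hv2⟩ := hpre _ _ ho hcl.isOpen_compl (fun v hv => by
        by_cases h : v ∈ range G
        · exact Or.inl ⟨h, hv⟩
        · exact Or.inr h)
      ⟨0, Metric.mem_ball_self hd, ⟨q, hGq⟩, Metric.mem_ball_self hd⟩ ⟨w, hwb, hw⟩
    exact hv2 hv1.1
  have hclosed : Metric.closedBall (0 : V) d ⊆ range G := by
    rw [← closure_ball _ hd.ne']
    exact closure_minimal hball hcl
  obtain ⟨z, hz⟩ := hclosed (show (⟨y - p, hy⟩ : V) ∈ Metric.closedBall (0 : V) d by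
    rw [mem_closedBall_zero_iff]
    exact hyd)
  refine ⟨z, ?_⟩
  have h1 := coe_planarMap (F := F) hV z
  rw [← hG, hz] at h1
  exact (sub_left_inj.1 h1).symm

/-- A planar minimal immersion over the disk with one vertex is injective. -/
theorem _root_.IsMinimalImmersion.injective_of_planar (hF : IsMinimalImmersion (k + 1) F)
    (hVk : finrank ℝ V = k + 1) (hV : ∀ z, F z - p ∈ V)
    (hb : ∀ z ∈ (𝓡∂ (k + 1)).boundary M, ‖F z - p‖ = d)
    (hi : ∀ z, (𝓡∂ (k + 1)).IsInteriorPoint z → ‖F z - p‖ < d)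
    (huniq : ∀ y z, F y = p → F z = p → y = z) (hd : 0 < d) {q : M} (hq : F q = p) :
    Function.Injective F := by
  intro a b hab
  by_contra hne
  have hlt : ∀ y z, ‖F y - p‖ < d → F y = F z → y = z := fun y z hy hyz =>
    hF.eq_of_norm_lt hVk hV hb huniq hd hy hyz
  set G := planarMap V p F with hG
  have hGab : G b = G a := ((planarMap_eq_iff hV _ _).2 hab).symm
  obtain ⟨N, hN, hNi⟩ := hF.exists_injOn_nhds a
  obtain ⟨C, hC, hCc, hCN⟩ := exists_mem_nhds_isClosed_subset hN
  set O := interior C with hO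
  have haO : a ∈ O := mem_interior_iff_mem_nhds.2 hC
  have hfib : ∀ z, G z = G a → z ∈ O ∪ Cᶜ := fun z hz => by
    by_cases hzC : z ∈ C
    · left
      rwa [hNi (hCN hzC) (mem_of_mem_nhds hN) ((planarMap_eq_iff hV _ _).1 hz)]
    · exact Or.inr hzC
  have hbC : b ∈ Cᶜ := fun hbC => hne (hNi (mem_of_mem_nhds hN) (hCN hbC) hab)
  have hGc : Continuous G := continuous_planarMap hF.contMDiff.continuous
  obtain ⟨r, hr, hrW⟩ := Metric.mem_nhds_iff.1
    (eventually_fiber (F := F) (p := p) (V := V) hF.contMDiff.continuous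
      (isOpen_interior.union hCc.isOpen_compl) hfib)
  -- Interior injectivity is known, so a double point could only lie over the sphere. Over D every
  -- fibre is contained in O ∪ Cᶜ. The images of O and Cᶜ are open in D, cover D, and both meet D
  -- because interior points accumulate at a and at b. As D is convex the two images overlap, which
  -- yields two preimages of a point of the open disk.
  set D := Metric.ball (G a) r ∩ Metric.ball (0 : V) d with hD
  have hpre : IsPreconnected D := ((convex_ball _ _).inter (convex_ball _ _)).isPreconnected
  have hDint : ∀ z, G z ∈ D → (𝓡∂ (k + 1)).IsInteriorPoint z := fun z hz =>
    isInteriorPoint_of_notMem_boundary fun h => by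
      have h1 := hz.2
      rw [mem_ball_zero_iff, norm_planarMap hV, hb z h] at h1
      exact lt_irrefl _ h1
  have himg : ∀ P : Set M, IsOpen P → IsOpen (G '' P ∩ D) := fun P hP => by
    rw [isOpen_iff_mem_nhds]
    rintro _ ⟨⟨z, hzP, rfl⟩, hz⟩
    exact inter_mem (hF.image_planarMap_mem_nhds hVk hV (hDint z hz) (hP.mem_nhds hzP))
      ((Metric.isOpen_ball.inter Metric.isOpen_ball).mem_nhds hz)
  have hne' : ∀ (c : M) (P : Set M), IsOpen P → c ∈ P → G c = G a → (D ∩ (G '' P ∩ D)).Nonempty := by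
    intro c P hP hcP hca
    obtain ⟨y, hy, hyi⟩ := exists_isInteriorPoint_mem (k := k)
      (hP.inter (Metric.isOpen_ball.preimage hGc)) (z := c)
      ⟨hcP, show G c ∈ Metric.ball (G a) r by rw [hca]; exact Metric.mem_ball_self hr⟩
    have hyD : G y ∈ D := ⟨hy.2, by
      rw [mem_ball_zero_iff, norm_planarMap hV]
      exact hi y hyi⟩
    exact ⟨G y, hyD, ⟨y, hy.1, rfl⟩, hyD⟩
  have hDrange : D ⊆ range G := by
    intro w hw
    obtain ⟨z, hz⟩ := hF.exists_eq_of_norm_le hVk hV hb hd hq (y := p + w)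
      (by simp) (by
        have := hw.2
        rw [mem_ball_zero_iff] at this
        simpa using this.le)
    refine ⟨z, Subtype.ext ?_⟩
    rw [coe_planarMap hV, hz, add_sub_cancel_left]
  obtain ⟨w, hwD, ⟨⟨y, hyO, hyw⟩, -⟩, ⟨z, hzC, hzw⟩, -⟩ := hpre _ _ (himg O isOpen_interior)
    (himg Cᶜ hCc.isOpen_compl) (fun w hw => by
      obtain ⟨z, rfl⟩ := hDrange hw
      rcases hrW hw.1 z rfl with h | h
      · exact Or.inl ⟨⟨z, h, rfl⟩, hw⟩
      · exact Or.inr ⟨⟨z, h, rfl⟩, hw⟩)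
    (hne' a O isOpen_interior haO rfl) (hne' b Cᶜ hCc.isOpen_compl hbC hGab)
  have hyd : ‖F y - p‖ < d := by
    have := hwD.2
    rwa [← hyw, mem_ball_zero_iff, norm_planarMap hV] at this
  have hyz := hlt y z hyd ((planarMap_eq_iff hV _ _).1 (hyw.trans hzw.symm))
  exact hzC (hyz ▸ interior_subset hyO)

end Planar

/-! ### Flat disks and the two directions of the equality case. -/

section Disk

variable {k n : ℕ}

theorem euclideanHausdorffMeasure_disk {V : Submodule ℝ (EuclideanSpace ℝ (Fin n))}
    (hVk : finrank ℝ V = k + 1) (p : EuclideanSpace ℝ (Fin n)) {R : ℝ} (hR : 0 ≤ R) :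
    μHE[k + 1] {y : EuclideanSpace ℝ (Fin n) | y - p ∈ V ∧ dist y p ≤ R} =
      ENNReal.ofReal (R ^ (k + 1)) * unitBallVolume (k + 1) := by
  let e : EuclideanSpace ℝ (Fin (k + 1)) ≃ₗᵢ[ℝ] V :=
    ((stdOrthonormalBasis ℝ V).reindex (finCongr hVk)).repr.symm
  have hiso : Isometry fun v : EuclideanSpace ℝ (Fin (k + 1)) =>
      (e v : EuclideanSpace ℝ (Fin n)) + p :=
    Isometry.of_dist_eq fun v w => by
      rw [dist_add_right, ← Subtype.dist_eq, e.dist_map]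
  have himg : {y : EuclideanSpace ℝ (Fin n) | y - p ∈ V ∧ dist y p ≤ R} =
      (fun v : EuclideanSpace ℝ (Fin (k + 1)) => (e v : EuclideanSpace ℝ (Fin n)) + p) ''
        Metric.closedBall 0 R := by
    ext y
    constructor
    · rintro ⟨hy, hyR⟩
      refine ⟨e.symm ⟨y - p, hy⟩, ?_, by simp⟩
      rw [mem_closedBall_zero_iff, LinearIsometryEquiv.norm_map, Submodule.coe_norm, ← dist_eq_norm]
      exact hyR
    · rintro ⟨v, hv, rfl⟩
      refine ⟨by simp, ?_⟩
      rw [dist_eq_norm, add_sub_cancel_right, ← Submodule.coe_norm, LinearIsometryEquiv.norm_map]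
      exact mem_closedBall_zero_iff.1 hv
  rw [himg, hiso.euclideanHausdorffMeasure_image, EuclideanSpace.euclideanHausdorffMeasure_eq_volume,
    Measure.addHaar_closedBall _ _ hR, finrank_euclideanSpace_fin]
  rfl

variable {M : Type*} [TopologicalSpace M]
  [ChartedSpace (EuclideanHalfSpace (k + 1)) M] [IsManifold (𝓡∂ (k + 1)) ∞ M]
  {F : M → EuclideanSpace ℝ (Fin n)} {p : EuclideanSpace ℝ (Fin n)} {R : ℝ}
  {V : Submodule ℝ (EuclideanSpace ℝ (Fin n))} [CompactSpace M]

/-- A boundary point of an injective planar immersion is not mapped to an interior point of the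
image. -/
theorem _root_.IsMinimalImmersion.norm_eq_of_mem_boundary_of_disk
    (hF : IsMinimalImmersion (k + 1) F) (hinj : Function.Injective F)
    (hr : range F = {y | y - p ∈ V ∧ dist y p ≤ R}) {z : M}
    (hz : z ∈ (𝓡∂ (k + 1)).boundary M) : ‖F z - p‖ = R := by
  have hVmem : ∀ z, F z - p ∈ V ∧ dist (F z) p ≤ R := fun z => by
    have : F z ∈ range F := mem_range_self z
    rwa [hr] at this
  refine le_antisymm (dist_eq_norm (F z) p ▸ (hVmem z).2) (not_lt.1 fun hlt => ?_)
  have hzs := mem_chart_source (EuclideanHalfSpace (k + 1)) z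
  set u := extChartAt (𝓡∂ (k + 1)) z z with hu'
  have hu : u ∈ chartDom z := extChartAt_mem_chartDom hzs
  have hzu : chartInv k z u = z := chartInv_extChartAt hzs
  have hu0 : u 0 = 0 := by rwa [← mem_boundary_chartInv_iff hu, hzu]
  set A := chartDeriv k F z with hA
  set C := ‖pinv A‖ + 1 with hC
  have hC0 : 0 < C := by positivity
  -- Let e₀ be the inward coordinate vector. If F z were inside the disk, F z - t A e₀ would have a
  -- preimage with coordinates v. The chosen error gives ‖v - u + t e₀‖ ≤ ‖v - u‖ / 4, hence ‖v - u‖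
  -- ≤ 4t/3 and v 0 ≤ -2t/3, outside the half-space.
  obtain ⟨r, hr0, -, hr'⟩ := (hF.immersedPatch z).exists_approx hu (ε := 1 / (4 * C)) (by positivity)
  have hAe : A (EuclideanSpace.single 0 1) ∈ V := hF.chartDeriv_mem (fun z => (hVmem z).1) z _
  have hP : ∀ᶠ y in 𝓝 z, chartInv k z (extChartAt (𝓡∂ (k + 1)) z y) = y ∧
      extChartAt (𝓡∂ (k + 1)) z y ∈ Metric.ball u r ∩ halfSpace k := by
    filter_upwards [(chartAt (EuclideanHalfSpace (k + 1)) z).open_source.mem_nhds hzs,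
      (continuousAt_extChartAt (I := 𝓡∂ (k + 1)) z) (Metric.ball_mem_nhds u hr0)] with y hy hyr
    exact ⟨chartInv_extChartAt hy, hyr, chartDom_subset z (extChartAt_mem_chartDom hy)⟩
  -- A continuous injection of a compact space is an embedding, so preimages of points near F z are
  -- near z.
  rw [(hF.contMDiff.continuous.isClosedEmbedding hinj).isInducing.nhds_eq_comap] at hP
  have hP' := eventually_comap.1 hP
  have hcont : Tendsto (fun t : ℝ => F z - t • A (EuclideanSpace.single 0 1)) (𝓝[>] 0)
      (𝓝 (F z)) := by
    have h1 : Continuous fun t : ℝ => F z - t • A (EuclideanSpace.single 0 1) := by fun_prop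
    have h2 := h1.tendsto 0
    rw [zero_smul, sub_zero] at h2
    exact h2.mono_left nhdsWithin_le_nhds
  have hlt' : ∀ᶠ y in 𝓝 (F z), ‖y - p‖ < R :=
    (by fun_prop : Continuous fun y : EuclideanSpace ℝ (Fin n) => ‖y - p‖).continuousAt.eventually
      (gt_mem_nhds hlt)
  obtain ⟨t, ⟨ht1, ht2⟩, ht⟩ := (((hcont.eventually hP').and (hcont.eventually hlt')).and
    self_mem_nhdsWithin).exists
  have ht0 : 0 < t := ht
  have hmem : F z - t • A (EuclideanSpace.single 0 1) ∈ range F := by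
    rw [hr]
    refine ⟨?_, by rw [dist_eq_norm]; exact ht2.le⟩
    rw [sub_right_comm]
    exact V.sub_mem (hVmem z).1 (V.smul_mem t hAe)
  obtain ⟨y, hy⟩ := hmem
  obtain ⟨hyc, hyb, hyH⟩ := ht1 y hy
  set v := extChartAt (𝓡∂ (k + 1)) z y with hv
  have h1 := hr' v ⟨hyb, hyH⟩ u ⟨Metric.mem_ball_self hr0, chartDom_subset z hu⟩
  simp only [Function.comp_apply, hzu, hyc, hy] at h1
  change ‖_ - A (v - u)‖ ≤ _ at h1
  have h2 : ‖(v - u) + t • EuclideanSpace.single (0 : Fin (k + 1)) (1 : ℝ)‖ ≤ 1 / 4 * ‖v - u‖ := by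
    calc ‖(v - u) + t • EuclideanSpace.single (0 : Fin (k + 1)) (1 : ℝ)‖
        = ‖pinv A (A ((v - u) + t • EuclideanSpace.single (0 : Fin (k + 1)) (1 : ℝ)))‖ := by
          rw [pinv_apply_self (hF.injective_chartDeriv z)]
      _ ≤ C * ‖A ((v - u) + t • EuclideanSpace.single (0 : Fin (k + 1)) (1 : ℝ))‖ := by
          refine ((pinv A).le_opNorm _).trans ?_
          gcongr
          exact le_add_of_nonneg_right zero_le_one
      _ ≤ C * (1 / (4 * C) * ‖v - u‖) := by
          gcongr
          refine le_trans (le_of_eq ?_) h1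
          rw [map_add, map_smul, ← norm_neg]
          congr 1
          abel
      _ = 1 / 4 * ‖v - u‖ := by field_simp
  have h3 : ‖v - u‖ ≤ 1 / 4 * ‖v - u‖ + t := by
    have h4 := norm_sub_le ((v - u) + t • EuclideanSpace.single (0 : Fin (k + 1)) (1 : ℝ))
      (t • EuclideanSpace.single (0 : Fin (k + 1)) (1 : ℝ))
    rw [add_sub_cancel_right, norm_smul, PiLp.norm_single, norm_one, mul_one,
      Real.norm_of_nonneg ht0.le] at h4
    linarith
  have h5 := (PiLp.norm_apply_le
    ((v - u) + t • EuclideanSpace.single (0 : Fin (k + 1)) (1 : ℝ)) 0).trans h2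
  have h6 : ((v - u) + t • EuclideanSpace.single (0 : Fin (k + 1)) (1 : ℝ)) 0 = v 0 + t := by
    simp [hu0]
  have h7 : 0 ≤ v 0 := hyH
  rw [h6, Real.norm_of_nonneg (by linarith)] at h5
  linarith

variable [PolishSpace M] [MeasurableSpace M] [BorelSpace M]

/-- The field -(y - p) has constant divergence -(k + 1) along the surface. On the boundary y - p is
an outward normal of length R, so h = -R is admissible with equality and the divergence inequality
becomes R |∂M| ≤ (k + 1) vol(M), where vol(M) is the volume of the disk. -/
theorem _root_.IsMinimalImmersion.bdMeasure_le_of_disk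
    (hF : IsMinimalImmersion (k + 1) F) (hinj : Function.Injective F) (hVk : finrank ℝ V = k + 1)
    (hR : 0 < R) (hr : range F = {y | y - p ∈ V ∧ dist y p ≤ R}) :
    (bdMeasure k F).real univ ≤ R ^ k * (((k : ℝ) + 1) *
      volume.real (Metric.ball (0 : EuclideanSpace ℝ (Fin (k + 1))) 1)) := by
  have hVmem : ∀ z, F z - p ∈ V ∧ ‖F z - p‖ ≤ R := fun z => by
    have : F z ∈ range F := mem_range_self z
    rw [hr, Set.mem_ofPred_eq, dist_eq_norm] at this
    exact this
  have hX : ContDiff ℝ ∞ fun y : EuclideanSpace ℝ (Fin n) => -(y - p) :=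
    (contDiff_id.sub contDiff_const).neg
  have h1 := hF.integral_tangentialDiv_le hX (h := fun _ => -R) continuous_const
    fun x u hu hu0 => by
      set A := halfDeriv (F ∘ chartInv k x) u with hA
      have hAi : Function.Injective A := (hF.immersedPatch x).injective u hu
      set y := F (chartInv k x u) - p with hy
      have hyR : ‖y‖ = R := hF.norm_eq_of_mem_boundary_of_disk hinj hr
        ((mem_boundary_chartInv_iff hu).2 hu0)
      have hle : ∀ v : EuclideanSpace ℝ (Fin (k + 1)), 0 ≤ v 0 → inner ℝ y (A v) ≤ 0 := by
        intro v hv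
        have h1 := hF.apply_halfDeriv_nonpos hu (hasFDerivAt_norm_sub_sq p (F (chartInv k x u)))
          (fun w => pow_le_pow_left₀ (norm_nonneg _) ((hVmem w).2.trans hyR.ge) 2) v (Or.inr hv)
        rw [_root_.smul_apply, innerSL_apply_apply, two_smul] at h1
        linarith
      obtain ⟨ξ, hξ⟩ : y ∈ (A : EuclideanSpace ℝ (Fin (k + 1)) →ₗ[ℝ]
          EuclideanSpace ℝ (Fin n)).range := by
        rw [hF.range_chartDeriv_chartInv hu, hF.range_chartDeriv_eq hVk (fun z => (hVmem z).1)]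
        exact (hVmem _).1
      have hξ' : A ξ = y := hξ
      set s := inner ℝ y (A (EuclideanSpace.single 0 1)) with hs
      have hs0 : s ≤ 0 := hle _ (by simp)
      -- Vectors with vanishing first coordinate are tangent to the boundary, so the one-sided
      -- condition applies to them and to their negatives.
      have hlin : ∀ v, inner ℝ y (A v) = s * v 0 := by
        intro v
        have h2 := hle (v - v 0 • EuclideanSpace.single 0 1) (by simp)
        have h3 := hle (-(v - v 0 • EuclideanSpace.single 0 1)) (by simp)
        rw [map_neg, inner_neg_right] at h3
        rw [map_sub, map_smul, inner_sub_right, inner_smul_right] at h2 h3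
        linarith
      have hyc : y = s • conormal A := by
        rw [← sub_eq_zero, ← inner_self_eq_zero (𝕜 := ℝ)]
        have h4 : y - s • conormal A = A (ξ - s • gramInv A (EuclideanSpace.single 0 1)) := by
          rw [map_sub, map_smul, hξ']
          rfl
        nth_rewrite 2 [h4]
        rw [inner_sub_left, inner_smul_left, hlin, inner_conormal hAi]
        simp
      have h5 : inner ℝ (conormal A) y = -(‖y‖ * ‖conormal A‖) := by
        rw [hyc, inner_smul_right, real_inner_self_eq_norm_sq, norm_smul, Real.norm_of_nonpos hs0]
        ring
      rw [inner_neg_right, neg_neg, h5, hyR]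
      linarith
  have hdiv : ∀ z, tangentialDiv k F (fun y => -(y - p)) z = -((k : ℝ) + 1) := fun z => by
    have h2 : HasFDerivAt (fun y : EuclideanSpace ℝ (Fin n) => -(y - p))
        (-ContinuousLinearMap.id ℝ _) (F z) := ((hasFDerivAt_id (F z)).sub_const p).neg
    rw [tangentialDiv, h2.fderiv, ← hF.trace_tangentProj z, ← map_neg]
    congr 1
    ext1 v
    simp
  simp only [hdiv, integral_const, smul_eq_mul] at h1
  have hvol : (volMeasure k F).real univ =
      R ^ (k + 1) * volume.real (Metric.ball (0 : EuclideanSpace ℝ (Fin (k + 1))) 1) := by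
    rw [measureReal_def, volMeasure, fiberMeasure_apply_of_injOn hF.contMDiff.continuous
      hF.exists_injOn_nhds _ MeasurableSet.univ hinj.injOn, image_univ, hr,
      euclideanHausdorffMeasure_disk hVk p hR.le, ENNReal.toReal_mul,
      ENNReal.toReal_ofReal (by positivity)]
    rfl
  rw [hvol] at h1
  have h6 : R * (bdMeasure k F).real univ ≤ R * (R ^ k * (((k : ℝ) + 1) *
      volume.real (Metric.ball (0 : EuclideanSpace ℝ (Fin (k + 1))) 1))) := by
    rw [pow_succ] at h1
    linarith
  exact le_of_mul_le_mul_left h6 hR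

/-- A flat disk realises equality in the density inequality. -/
theorem _root_.IsMinimalImmersion.eq_of_isFlatDisk (hF : IsMinimalImmersion (k + 1) F) {q : M}
    (hinj : Function.Injective F) (hD : IsFlatDisk (k + 1) (F q) (range F)) :
    ((k + 1 : ℕ) : ℝ≥0∞) * unitBallVolume (k + 1) *
      Metric.infEDist (F q) (F '' (𝓡∂ (k + 1)).boundary M) ^ k = boundaryMeasure (k + 1) F := by
  refine le_antisymm (hF.le_boundaryMeasure q) ?_
  obtain ⟨V, hVk, R, hR, hr⟩ := hD
  have h1 := hF.bdMeasure_le_of_disk hinj hVk hR hr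
  have h2 : ENNReal.ofReal R ≤ Metric.infEDist (F q) (F '' (𝓡∂ (k + 1)).boundary M) := by
    refine Metric.le_infEDist.2 ?_
    rintro _ ⟨z, hz, rfl⟩
    rw [edist_dist, dist_comm, dist_eq_norm, hF.norm_eq_of_mem_boundary_of_disk hinj hr hz]
  calc boundaryMeasure (k + 1) F ≤ ENNReal.ofReal (R ^ k * (((k : ℝ) + 1) *
        volume.real (Metric.ball (0 : EuclideanSpace ℝ (Fin (k + 1))) 1))) := by
        rw [hF.boundaryMeasure_eq_ofReal]
        exact ENNReal.ofReal_le_ofReal h1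
    _ = ((k + 1 : ℕ) : ℝ≥0∞) * unitBallVolume (k + 1) * ENNReal.ofReal R ^ k := by
        rw [natCast_mul_unitBallVolume_eq, ← ENNReal.ofReal_pow hR.le,
          ← ENNReal.ofReal_mul (by positivity), mul_comm]
    _ ≤ _ := by gcongr

/-- Equality in the density inequality forces a flat disk. -/
theorem _root_.IsMinimalImmersion.isFlatDisk_of_eq [T2Space M] (hF : IsMinimalImmersion (k + 1) F)
    (hk : k ≠ 0) {q : M} (heq : ((k + 1 : ℕ) : ℝ≥0∞) * unitBallVolume (k + 1) *
      Metric.infEDist (F q) (F '' (𝓡∂ (k + 1)).boundary M) ^ k = boundaryMeasure (k + 1) F) :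
    Function.Injective F ∧ IsFlatDisk (k + 1) (F q) (range F) := by
  have : Nonempty M := ⟨q⟩
  have hne := hF.boundary_nonempty
  -- Otherwise the distance and, since k ≠ 0, its power would vanish, whereas the boundary measure
  -- is positive.
  have hq : F q ∉ F '' (𝓡∂ (k + 1)).boundary M := by
    intro hq
    obtain ⟨b, hb⟩ := hne
    rw [Metric.infEDist_zero_of_mem hq, zero_pow hk, mul_zero, hF.boundaryMeasure_eq] at heq
    exact (bdMeasure_pos_of_isOpen hF isOpen_univ (mem_univ b) hb).ne heq
  obtain ⟨d, hd, hd', hdb⟩ := hF.exists_infEDist_eq hq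
  have hqi := isInteriorPoint_of_notMem_boundary fun h => hq (mem_image_of_mem F h)
  have hle : (bdMeasure k F).real univ ≤ d ^ k * (((k : ℝ) + 1) *
      volume.real (Metric.ball (0 : EuclideanSpace ℝ (Fin (k + 1))) 1)) := by
    rw [natCast_mul_unitBallVolume_eq, hF.boundaryMeasure_eq_ofReal, hd', ← ENNReal.ofReal_pow hd.le,
      ← ENNReal.ofReal_mul (by positivity)] at heq
    rw [mul_comm]
    exact (ENNReal.ofReal_le_ofReal_iff (by positivity)).1 heq.ge
  have hn := hF.normalPart_eq_zero hqi hd hdb hle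
  have hb : ∀ z ∈ (𝓡∂ (k + 1)).boundary M, ‖F z - F q‖ = d := fun z hz =>
    hF.norm_sub_eq_of_mem_boundary hk hqi hd hdb hle hz
  have huniq : ∀ z, F z = F q → z = q := fun z hz =>
    hF.eq_of_apply_eq hqi hd hdb hle (isInteriorPoint_of_notMem_boundary fun h => hq ⟨z, h, hz⟩) hz
  have hbd := hF.norm_sub_le_of_cone hn hd hb hne
  have hV := hF.sub_mem_range_of_cone hn hb hbd huniq
  set V := (chartDeriv k F q : EuclideanSpace ℝ (Fin (k + 1)) →ₗ[ℝ]
    EuclideanSpace ℝ (Fin n)).range with hV'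
  have hVk : finrank ℝ V = k + 1 := by
    rw [hV', LinearMap.finrank_range_of_inj (hF.injective_chartDeriv q), finrank_euclideanSpace_fin]
  refine ⟨hF.injective_of_planar hVk hV hb (fun z hz => hF.norm_sub_lt_of_cone hn hd hbd hz)
    (fun y z hy hz => (huniq y hy).trans (huniq z hz).symm) hd rfl, V, hVk, d, hd, ?_⟩
  refine Subset.antisymm ?_ fun y hy => ?_
  · rintro _ ⟨z, rfl⟩
    exact ⟨hV z, (dist_eq_norm (F z) (F q)).trans_le (hbd z)⟩
  · exact hF.exists_eq_of_norm_le hVk hV hb hd rfl hy.1 ((dist_eq_norm y (F q)).symm.trans_le hy.2)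

end Disk

end MinimalImmersion

/-! ### The main theorem. -/

theorem mainTheorem10 (m n : ℕ) [NeZero m] (M : Type*) [TopologicalSpace M] [T2Space M]
    [CompactSpace M] [ChartedSpace (EuclideanHalfSpace m) M] [IsManifold (𝓡∂ m) ∞ M]
    (F : M → EuclideanSpace ℝ (Fin n)) (hF : IsMinimalImmersion m F) :
    (∀ p ∈ range F,
      (m : ℝ≥0∞) * unitBallVolume m *
        Metric.infEDist p (F '' (𝓡∂ m).boundary M) ^ (m - 1) ≤ boundaryMeasure m F) ∧
    (2 ≤ m → ∀ p ∈ range F,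
      ((m : ℝ≥0∞) * unitBallVolume m *
          Metric.infEDist p (F '' (𝓡∂ m).boundary M) ^ (m - 1) = boundaryMeasure m F ↔
        Function.Injective F ∧ IsFlatDisk m p (range F))) ∧
    (2 ≤ m → ConnectedSpace M → ∀ Γ₁ Γ₂ : Set M,
      IsClosed Γ₁ → IsClosed Γ₂ → Γ₁.Nonempty → Γ₂.Nonempty → Disjoint Γ₁ Γ₂ →
      Γ₁ ∪ Γ₂ = (𝓡∂ m).boundary M →
      (⨅ x ∈ Γ₁, ⨅ y ∈ Γ₂, edist (F x) (F y)) ≤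
        2 * (boundaryMeasure m F / ((m : ℝ≥0∞) * unitBallVolume m)) ^ (1 / ((m : ℝ) - 1))) := by
  rcases m with _ | k
  · exact absurd rfl (NeZero.ne 0)
  -- A compact Hausdorff manifold is second countable and metrizable, hence Polish, as the fibre
  -- measures require.
  have : SecondCountableTopology (EuclideanHalfSpace (k + 1)) :=
    (𝓡∂ (k + 1)).secondCountableTopology
  have : SecondCountableTopology M :=
    ChartedSpace.secondCountable_of_sigmaCompact (EuclideanHalfSpace (k + 1)) M
  have : PolishSpace M := by
    let _ : MetricSpace M := TopologicalSpace.metrizableSpaceMetric M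
    infer_instance
  borelize M
  refine ⟨?_, fun hk => ?_, fun hk hM Γ₁ Γ₂ h₁ h₂ hne₁ hne₂ _ hΓ => ?_⟩
  · rintro _ ⟨q, rfl⟩
    exact hF.le_boundaryMeasure q
  · rintro _ ⟨q, rfl⟩
    exact ⟨fun h => hF.isFlatDisk_of_eq (by lia) h, fun h => hF.eq_of_isFlatDisk h.1 h.2⟩
  · rw [show ((k + 1 : ℕ) : ℝ) - 1 = k by push_cast; ring]
    exact hF.iInf_edist_le (by lia) h₁ h₂ hne₁ hne₂ hΓ
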